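/- Let $\Omega\subset\mathbb R^2$ be a bounded domain with Lipschitz boundary, let $\mu,\gamma,\delta,M_0,C>0$ and $\beta(t)=\gamma e^{-\delta t}$. Write $(\cdot,\cdot)$, $\|\cdot\|$ for the $L^2(\Omega)$ inner product and norm, $\mathbf H_0^1=[H_0^1(\Omega)]^2$, $\mathbf J_1=\{\phi\in\mathbf H_0^1:\nabla\cdot\phi=0\}$, $a(v,\phi)=(\nabla v,\nabla\phi)$ and $b(v,w,\phi)=\tfrac12(v\cdot\nabla w,\phi)-\tfrac12(v\cdot\nabla\phi,w)$. Assume that for every $g\in\mathbf L^2$ the Stokes problem $-\Delta v+\nabla q=g$, $\nabla\cdot v=0$ in $\Omega$, $v|_{\partial\Omega}=0$ has a solution $v\in\mathbf J_1\cap\mathbf H^2$, $q\in H^1/\mathbb R$ with $\|v\|_{H^2}+\|q\|_{H^1/\mathbb R}\le C\|g\|$. Let $\lambda_1$ be the least eigenvalue of the Stokes operator and let $0<\alpha<\min\{\mu\lambda_1/2,\delta\}$. Let $(\mathbf H_h,L_h)_{0<h<1}$ be a family of finite dimensional subspaces $\mathbf H_h\subset\mathbf H_0^1$, $L_h\subset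 L^2/\mathbb R$, nested in the sense that $\mathbf H_H\subset\mathbf H_h$ and $L_H\subset L_h$ whenever $0<h<H<1$, and put $\mathbf J_h=\{v\in\mathbf H_h:(\chi,\nabla\cdot v)=0\ \forall\chi\in L_h\}$. Assume that for all $0<h<1$: * every $w\in\mathbf H_0^1\cap\mathbf H^2$ has an approximation $v\in\mathbf H_h$, and every $w\in\mathbf J_1\cap\mathbf H^2$ an approximation $v\in\mathbf J_h$, with $\|w-v\|+h\|\nabla(w-v)\|\le Ch^2\|w\|_{H^2}$; * every $q\in H^1/\mathbb R$ has an approximation $\chi\in L_h$ with $\|q-\chi\|\le Ch\|q\|_{H^1/\mathbb R}$; * $\|\nabla v\|\le Ch^{-1}\|v\|$ for all $v\in\mathbf H_h$. Let $P_h$ be the $L^2$-projection onto $\mathbf J_h$. For $v_h\in\mathbf J_h$ put $\|v_h\|_1=\|\nabla v_h\|$ and $\|v_h\|_2=\|\tilde\Delta_hv_h\|$, where $\tilde\Delta_h=P_h\Delta_h$ and $\Delta_h:\mathbf H_h\to\mathbf H_h$ is given by $(-\Delta_hv,\phi)=a(v,\phi)$ for all $\phi\in\mathbf H_h$. Then there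 is a constant $K>0$, depending only on $\Omega,\mu,\gamma,\delta,\alpha,M_0,C$, such that the following holds for every such family, every $0<h<H<1$, every $0<T\le\infty$, every $u_0\in\mathbf J_1$ with $\|\nabla u_0\|\le M_0$ and every $f\in C((0,T);\mathbf L^2)$ with $\sup_{0<t<T}\|f(t)\|\le M_0$. Let $u_H:[0,T)\to\mathbf J_H$ be continuous, differentiable on $(0,T)$, with $u_H(0)=P_Hu_0$ and, for $0<t<T$, $$(u_{H,t},\phi)+\mu a(u_H,\phi)+b(u_H,u_H,\phi)+\int_0^t\beta(t-s)a(u_H(s),\phi)\,ds=(f,\phi)\qquad\forall\phi\in\mathbf J_H,$$ and let $u^h:[0,T)\to\mathbf J_h$ be continuous, differentiable on $(0,T)$, with $u^h(0)=P_hu_0$ (or, alternatively, any $u^h(0)\in\mathbf J_h$ with $\|u^h(0)\|_1\le M_0$) and, for $0<t<T$, $$(u^h_t,\phi)+\mu a(u^h,\phi)+b(u_H,u_H,\phi)+\int_0^t\beta(t-s)a(u^h(s),\phi)\,ds=(f,\phi)\qquad\forall\phi\in\mathbf J_h.$$ Then for all $0<t<T$ $$\|u^h(t)\|+e^{-2\alpha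 t}\int_0^te^{2\alpha s}\|u^h(s)\|_1^2\,ds\le K,\qquad \|u^h(t)\|_1+e^{-2\alpha t}\int_0^te^{2\alpha s}\|u^h(s)\|_2^2\,ds\le K.$$ -/

import Mathlib

open MeasureTheory Set
open scoped ContDiff NNReal InnerProductSpace

noncomputable section

namespace Oldroyd

/-- The Euclidean plane. -/
abbrev Plane : Type := EuclideanSpace ℝ (Fin 2)

/-- `2 × 2` matrices with the Frobenius inner product; entry `(i, j)` of a gradient is `∂ⱼ vᵢ`. -/
abbrev Mat : Type := EuclideanSpace ℝ (Fin 2 × Fin 2)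

/-- Third order arrays; entry `((i, j), k)` of a Hessian is `∂ₖ ∂ⱼ vᵢ`. -/
abbrev Ten : Type := EuclideanSpace ℝ ((Fin 2 × Fin 2) × Fin 2)

/-- The Hilbert space `L²(Ω; F)`. -/
abbrev L2 (Ω : Set Plane) (F : Type) [NormedAddCommGroup F] : Type :=
  Lp F 2 (volume.restrict Ω)

/-- The ambient space `L²(Ω; ℝ²) × L²(Ω; ℝ²ˣ²)` in which a velocity field of class `H¹` is
represented by the pair `(v, ∇v)`: `v.1` is the field and `v.2` is its weak gradient. -/
abbrev VField (Ω : Set Plane) : Type := L2 Ω Plane × L2 Ω Mat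

/-- The partial derivative `∂ⱼ φ` of a real function on the plane. -/
def partialD (j : Fin 2) (φ : Plane → ℝ) (x : Plane) : ℝ :=
  fderiv ℝ φ x (EuclideanSpace.single j 1)

/-- The Jacobian matrix of a vector field on the plane. -/
def jacobian (φ : Plane → Plane) (x : Plane) : Mat :=
  WithLp.toLp 2 fun p => partialD p.2 (fun y => φ y p.1) x

/-- `φ` is a test function on `Ω`: smooth with compact support inside `Ω`. -/
def IsTest {F : Type} [NormedAddCommGroup F] [NormedSpace ℝ F] (Ω : Set Plane) (φ : Plane → F) :
    Prop :=
  ContDiff ℝ ∞ φ ∧ HasCompactSupport φ ∧ tsupport φ ⊆ Ω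

/-- `g` is the weak partial derivative `∂ⱼ u` on `Ω`. -/
def IsWeakPartial (Ω : Set Plane) (j : Fin 2) (u g : Plane → ℝ) : Prop :=
  ∀ φ : Plane → ℝ, IsTest Ω φ →
    ∫ x in Ω, u x * partialD j φ x = -∫ x in Ω, g x * φ x

/-- The pairs `(φ, ∇φ)` of smooth vector fields `φ` with compact support in `Ω`. -/
def testFields (Ω : Set Plane) : Set (VField Ω) :=
  {v | ∃ φ : Plane → Plane, IsTest Ω φ ∧
    (v.1 : Plane → Plane) =ᵐ[volume.restrict Ω] φ ∧
    (v.2 : Plane → Mat) =ᵐ[volume.restrict Ω] jacobian φ}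

/-- `H₀¹(Ω; ℝ²)`, the `H¹`-closure of the test fields. -/
def H01 (Ω : Set Plane) : Submodule ℝ (VField Ω) :=
  (Submodule.span ℝ (testFields Ω)).topologicalClosure

/-- The trace of a matrix, as a continuous linear map. -/
def traceL : Mat →L[ℝ] ℝ :=
  EuclideanSpace.proj ((0, 0) : Fin 2 × Fin 2) + EuclideanSpace.proj ((1, 1) : Fin 2 × Fin 2)

/-- The divergence `∇ · v ∈ L²(Ω)`, the trace of the gradient. -/
def divL (Ω : Set Plane) : VField Ω →L[ℝ] L2 Ω ℝ :=
  (traceL.compLpL 2 (volume.restrict Ω)).comp (ContinuousLinearMap.snd ℝ (L2 Ω Plane) (L2 Ω Mat))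

/-- `J₁`: the divergence free fields in `H₀¹`. -/
def J1 (Ω : Set Plane) : Submodule ℝ (VField Ω) :=
  H01 Ω ⊓ LinearMap.ker (divL Ω).toLinearMap

/-- The weakly divergence free fields in `V` with respect to the pressure space `L`. -/
def discJ {Ω : Set Plane} (V : Submodule ℝ (VField Ω)) (L : Submodule ℝ (L2 Ω ℝ)) :
    Submodule ℝ (VField Ω) :=
  V ⊓ Lᗮ.comap (divL Ω).toLinearMap

/-- `D` is the array of weak second derivatives of `v`. -/
def IsHessian {Ω : Set Plane} (v : VField Ω) (D : L2 Ω Ten) : Prop :=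
  ∀ (i j k : Fin 2), IsWeakPartial Ω k (fun x => (v.2 : Plane → Mat) x (i, j))
    (fun x => (D : Plane → Ten) x ((i, j), k))

/-- The `H²`-norm of a field `v` with second derivatives `D`. -/
def h2norm {Ω : Set Plane} (v : VField Ω) (D : L2 Ω Ten) : ℝ :=
  Real.sqrt (‖v.1‖ ^ 2 + ‖v.2‖ ^ 2 + ‖D‖ ^ 2)

/-- `g` is the weak gradient of the scalar function `q`. -/
def IsGradient {Ω : Set Plane} (q : L2 Ω ℝ) (g : L2 Ω Plane) : Prop :=
  ∀ j : Fin 2, IsWeakPartial Ω j (q : Plane → ℝ) (fun x => (g : Plane → Plane) x j)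

/-- The `H¹`-norm of a scalar function `q` with gradient `g`. -/
def h1norm {Ω : Set Plane} (q : L2 Ω ℝ) (g : L2 Ω Plane) : ℝ :=
  Real.sqrt (‖q‖ ^ 2 + ‖g‖ ^ 2)

/-- `q` has mean value zero. The quotient `L²/ℝ` is represented, isometrically, by these. -/
def MeanZero {Ω : Set Plane} (q : L2 Ω ℝ) : Prop :=
  ∫ x in Ω, (q : Plane → ℝ) x = 0

/-- Near each boundary point, and in suitable Cartesian coordinates, `Ω` is the region above the
graph of a Lipschitz function. -/
def IsLipschitzDomain (Ω : Set Plane) : Prop :=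
  ∀ x ∈ frontier Ω, ∃ (R : Plane ≃ₗᵢ[ℝ] Plane) (g : ℝ → ℝ) (k : ℝ≥0) (r : ℝ),
    0 < r ∧ LipschitzWith k g ∧ ∀ y ∈ Metric.ball x r, (y ∈ Ω ↔ g (R y 0) < R y 1)

/-- The `H²`-regularity of the Stokes problem `-Δv + ∇q = g`, `∇ · v = 0`, `v = 0` on `∂Ω`,
with constant `C`. -/
def StokesRegular (Ω : Set Plane) (C : ℝ) : Prop :=
  ∀ g : L2 Ω Plane, ∃ v ∈ J1 Ω, ∃ (D : L2 Ω Ten) (q : L2 Ω ℝ) (q' : L2 Ω Plane),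
    (∀ φ ∈ H01 Ω, ⟪v.2, φ.2⟫_ℝ - ⟪q, divL Ω φ⟫_ℝ = ⟪g, φ.1⟫_ℝ) ∧
    IsHessian v D ∧ IsGradient q q' ∧ MeanZero q ∧ h2norm v D + h1norm q q' ≤ C * ‖g‖

/-- The eigenvalues of the Stokes operator with homogeneous Dirichlet conditions. -/
def stokesEigenvalues (Ω : Set Plane) : Set ℝ :=
  {l | ∃ v ∈ J1 Ω, v ≠ 0 ∧ ∀ φ ∈ J1 Ω, ⟪v.2, φ.2⟫_ℝ = l * ⟪v.1, φ.1⟫_ℝ}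

/-- A nested family of conforming mixed finite element spaces `V h ⊆ H₀¹`, `L h ⊆ L²/ℝ`,
`0 < h < 1`, with the approximation properties for velocities, pressures and weakly divergence
free velocities and the inverse inequality, all with the same constant `C`. -/
structure IsFEFamily (Ω : Set Plane) (C : ℝ) (V : ℝ → Submodule ℝ (VField Ω))
    (L : ℝ → Submodule ℝ (L2 Ω ℝ)) : Prop where
  finite_vel : ∀ h, 0 < h → h < 1 → FiniteDimensional ℝ (V h)
  finite_pres : ∀ h, 0 < h → h < 1 → FiniteDimensional ℝ (L h)
  conforming : ∀ h, 0 < h → h < 1 → V h ≤ H01 Ω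
  mean_zero : ∀ h, 0 < h → h < 1 → ∀ q ∈ L h, MeanZero q
  nested_vel : ∀ h H, 0 < h → h < H → H < 1 → V H ≤ V h
  nested_pres : ∀ h H, 0 < h → h < H → H < 1 → L H ≤ L h
  approx_vel : ∀ h, 0 < h → h < 1 → ∀ w ∈ H01 Ω, ∀ D : L2 Ω Ten, IsHessian w D →
    ∃ v ∈ V h, ‖w.1 - v.1‖ + h * ‖w.2 - v.2‖ ≤ C * h ^ 2 * h2norm w D
  approx_pres : ∀ h, 0 < h → h < 1 → ∀ (q : L2 Ω ℝ) (q' : L2 Ω Plane), IsGradient q q' →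
    MeanZero q → ∃ χ ∈ L h, ‖q - χ‖ ≤ C * h * h1norm q q'
  inverse : ∀ h, 0 < h → h < 1 → ∀ v ∈ V h, ‖v.2‖ ≤ C * h⁻¹ * ‖v.1‖
  approx_div : ∀ h, 0 < h → h < 1 → ∀ w ∈ J1 Ω, ∀ D : L2 Ω Ten, IsHessian w D →
    ∃ v ∈ discJ (V h) (L h), ‖w.1 - v.1‖ + h * ‖w.2 - v.2‖ ≤ C * h ^ 2 * h2norm w D

/-- The trilinear integral `((v · ∇) w, φ)`. -/
def convect {Ω : Set Plane} (v w φ : VField Ω) : ℝ :=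
  ∫ x in Ω, ∑ i, ∑ j, (v.1 : Plane → Plane) x j * (w.2 : Plane → Mat) x (i, j) *
    (φ.1 : Plane → Plane) x i

/-- The antisymmetrized convection form `b(v, w, φ)`. -/
def bForm {Ω : Set Plane} (v w φ : VField Ω) : ℝ :=
  (1 / 2) * convect v w φ - (1 / 2) * convect v φ w

/-- The field in `V` that represents the functional `l` on `V` in the `L²` inner product. -/
def l2Riesz {Ω : Set Plane} (V : Submodule ℝ (VField Ω)) (l : VField Ω → ℝ) : VField Ω :=
  open Classical in
  if h : ∃ w ∈ V, ∀ φ ∈ V, ⟪w.1, φ.1⟫_ℝ = l φ then h.choose else 0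

/-- The `L²` projection of `g` onto `V`. -/
def l2Proj {Ω : Set Plane} (V : Submodule ℝ (VField Ω)) (g : L2 Ω Plane) : VField Ω :=
  l2Riesz V fun φ => ⟪g, φ.1⟫_ℝ

/-- The negative discrete Laplacian `-Δₕ v ∈ V`, `(-Δₕ v, φ) = (∇v, ∇φ)` for `φ ∈ V`. -/
def discNegLaplacian {Ω : Set Plane} (V : Submodule ℝ (VField Ω)) (v : VField Ω) : VField Ω :=
  l2Riesz V fun φ => ⟪v.2, φ.2⟫_ℝ

/-- The discrete Stokes operator: the `L²` projection of `-Δₕ v` onto the weakly divergence free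
subspace. -/
def discStokes {Ω : Set Plane} (V : Submodule ℝ (VField Ω)) (L : Submodule ℝ (L2 Ω ℝ))
    (v : VField Ω) : VField Ω :=
  l2Proj (discJ V L) (discNegLaplacian V v).1

/-- `u` solves, on `[0, T)` and in `J`, the semidiscrete Oldroyd problem
`(u', φ) + μ a(u, φ) + b(c, c, φ) + ∫₀ᵗ γ e^{-δ(t-s)} a(u(s), φ) ds = (f, φ)` for all `φ ∈ J`,
with convecting field `c`. -/
structure Solves {Ω : Set Plane} (μ γ δ : ℝ) (T : EReal) (f : ℝ → L2 Ω Plane)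
    (J : Submodule ℝ (VField Ω)) (c u : ℝ → VField Ω) : Prop where
  mem : ∀ t : ℝ, 0 ≤ t → (t : EReal) < T → u t ∈ J
  cont : ContinuousOn u {t : ℝ | 0 ≤ t ∧ (t : EReal) < T}
  diff : ∀ t : ℝ, 0 < t → (t : EReal) < T → DifferentiableAt ℝ u t
  eqn : ∀ t : ℝ, 0 < t → (t : EReal) < T → ∀ φ ∈ J,
    ⟪(deriv u t).1, φ.1⟫_ℝ + μ * ⟪(u t).2, φ.2⟫_ℝ + bForm (c t) (c t) φ
      + ∫ s in (0 : ℝ)..t, γ * Real.exp (-δ * (t - s)) * ⟪(u s).2, φ.2⟫_ℝ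
      = ⟪f t, φ.1⟫_ℝ

/-- Integration by parts: the second component of an element of `H₀¹` is the weak gradient of the
first one. -/
theorem H01.isWeakPartial {Ω : Set Plane} {v : VField Ω} (hv : v ∈ H01 Ω) (i j : Fin 2) :
    IsWeakPartial Ω j (fun x => (v.1 : Plane → Plane) x i)
      (fun x => (v.2 : Plane → Mat) x (i, j)) := by
  intro ψ hψ
  obtain ⟨hψs, hψc, hψΩ⟩ := hψ
  have hd : ContDiff ℝ ∞ (partialD j ψ) := by
    have := hψs.fderiv_right (m := ∞) (by simp)
    exact this.clm_apply contDiff_const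
  have hdc : HasCompactSupport (partialD j ψ) :=
    (hψc.fderiv (𝕜 := ℝ)).comp_left (g := fun l : Plane →L[ℝ] ℝ => l (EuclideanSpace.single j 1))
      (by simp)
  have memA : MemLp (fun x => (partialD j ψ x) • (EuclideanSpace.single i 1 : Plane)) 2
      (volume.restrict Ω) :=
    ((hd.continuous.smul continuous_const).memLp_of_hasCompactSupport
      hdc.smul_right).restrict Ω
  have memB : MemLp (fun x => (ψ x) • (EuclideanSpace.single (i, j) 1 : Mat)) 2
      (volume.restrict Ω) :=
    ((hψs.continuous.smul continuous_const).memLp_of_hasCompactSupport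
      hψc.smul_right).restrict Ω
  have key1 : ∀ w : VField Ω, ⟪memA.toLp, w.1⟫_ℝ
      = ∫ x in Ω, (w.1 : Plane → Plane) x i * partialD j ψ x := by
    intro w
    rw [L2.inner_def]
    refine integral_congr_ae ?_
    filter_upwards [memA.coeFn_toLp] with x hx
    rw [hx, real_inner_smul_left, EuclideanSpace.inner_single_left]
    simp [mul_comm]
  have key2 : ∀ w : VField Ω, ⟪memB.toLp, w.2⟫_ℝ
      = ∫ x in Ω, (w.2 : Plane → Mat) x (i, j) * ψ x := by
    intro w
    rw [L2.inner_def]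
    refine integral_congr_ae ?_
    filter_upwards [memB.coeFn_toLp] with x hx
    rw [hx, real_inner_smul_left, EuclideanSpace.inner_single_left]
    simp [mul_comm]
  let Λ : VField Ω →L[ℝ] ℝ :=
    (innerSL ℝ memA.toLp).comp (ContinuousLinearMap.fst ℝ (L2 Ω Plane) (L2 Ω Mat)) +
    (innerSL ℝ memB.toLp).comp (ContinuousLinearMap.snd ℝ (L2 Ω Plane) (L2 Ω Mat))
  have hΛ : ∀ w, Λ w = (∫ x in Ω, (w.1 : Plane → Plane) x i * partialD j ψ x)
      + ∫ x in Ω, (w.2 : Plane → Mat) x (i, j) * ψ x := by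
    intro w
    rw [← key1, ← key2]
    rfl
  have hle : H01 Ω ≤ LinearMap.ker Λ.toLinearMap := by
    refine Submodule.topologicalClosure_minimal _ (Submodule.span_le.2 ?_) ?_
    · rintro w ⟨φ, ⟨hφs, hφc, hφΩ⟩, h1, h2⟩
      have hφi : ContDiff ℝ ∞ fun y => φ y i :=
        (EuclideanSpace.proj i : Plane →L[ℝ] ℝ).contDiff.comp hφs
      have hφic : HasCompactSupport fun y => φ y i :=
        hφc.comp_left (g := fun z : Plane => z i) (by simp)
      have hdφ : ContDiff ℝ ∞ (partialD j fun y => φ y i) :=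
        (hφi.fderiv_right (m := ∞) (by simp)).clm_apply contDiff_const
      have e1 : ∫ x in Ω, (w.1 : Plane → Plane) x i * partialD j ψ x
          = ∫ x, φ x i * partialD j ψ x := by
        rw [← setIntegral_eq_integral_of_forall_compl_eq_zero (s := Ω)
          (f := fun x => φ x i * partialD j ψ x)]
        · refine integral_congr_ae ?_
          filter_upwards [h1] with x hx
          rw [hx]
        · intro x hx
          have : φ x = 0 := image_eq_zero_of_notMem_tsupport fun h => hx (hφΩ h)
          simp [this]
      have e2 : ∫ x in Ω, (w.2 : Plane → Mat) x (i, j) * ψ x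
          = ∫ x, partialD j (fun y => φ y i) x * ψ x := by
        rw [← setIntegral_eq_integral_of_forall_compl_eq_zero (s := Ω)
          (f := fun x => partialD j (fun y => φ y i) x * ψ x)]
        · refine integral_congr_ae ?_
          filter_upwards [h2] with x hx
          rw [hx]
          simp [jacobian]
        · intro x hx
          have : ψ x = 0 := image_eq_zero_of_notMem_tsupport fun h => hx (hψΩ h)
          simp [this]
      have ibp : ∫ x, φ x i * partialD j ψ x = -∫ x, partialD j (fun y => φ y i) x * ψ x := by
        refine integral_mul_fderiv_eq_neg_fderiv_mul_of_integrable ?_ ?_ ?_ ?_ ?_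
        · exact (hdφ.continuous.mul hψs.continuous).integrable_of_hasCompactSupport
            hψc.mul_left
        · exact (hφi.continuous.mul hd.continuous).integrable_of_hasCompactSupport
            hdc.mul_left
        · exact (hφi.continuous.mul hψs.continuous).integrable_of_hasCompactSupport
            hψc.mul_left
        · exact fun x _ => hφi.differentiable (by simp) x
        · exact fun x _ => hψs.differentiable (by simp) x
      change Λ w = 0
      rw [hΛ, e1, e2, ibp]
      ring
    · exact ContinuousLinearMap.isClosed_ker Λ
  have h0 : Λ v = 0 := hle hv
  rw [hΛ] at h0
  linarith

/-- An element of `H₀¹` is determined by its first component. -/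
theorem H01.eq_zero {Ω : Set Plane} (hΩ : IsOpen Ω) {v : VField Ω} (hv : v ∈ H01 Ω)
    (h1 : v.1 = 0) : v = 0 := by
  refine Prod.ext h1 ?_
  have hcoe : (v.1 : Plane → Plane) =ᵐ[volume.restrict Ω] 0 := by
    rw [h1]; exact Lp.coeFn_zero _ _ _
  have hcomp : ∀ p : Fin 2 × Fin 2,
      ∀ᵐ x ∂(volume.restrict Ω), (v.2 : Plane → Mat) x p = 0 := by
    rintro ⟨i, j⟩
    have hm : MemLp (fun x => (v.2 : Plane → Mat) x (i, j)) 2 (volume.restrict Ω) :=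
      (EuclideanSpace.proj (i, j) : Mat →L[ℝ] ℝ).comp_memLp'
        (Lp.memLp v.2)
    have hl : LocallyIntegrableOn (fun x => (v.2 : Plane → Mat) x (i, j)) Ω volume :=
      locallyIntegrableOn_of_locallyIntegrable_restrict (hm.locallyIntegrable (by norm_num))
    have := hΩ.ae_eq_zero_of_integral_contDiff_smul_eq_zero hl (fun g hg hgc hgΩ => by
      have h := H01.isWeakPartial hv i j g ⟨hg, hgc, hgΩ⟩
      have hz : ∫ x in Ω, (v.1 : Plane → Plane) x i * partialD j g x = 0 := by
        refine integral_eq_zero_of_ae ?_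
        filter_upwards [hcoe] with x hx
        rw [hx]; simp
      rw [hz] at h
      rw [← setIntegral_eq_integral_of_forall_compl_eq_zero (s := Ω)]
      · simp only [smul_eq_mul]
        simp_rw [mul_comm (g _)]
        linarith
      · intro x hx
        have : g x = 0 := image_eq_zero_of_notMem_tsupport fun h => hx (hgΩ h)
        simp [this])
    exact (ae_restrict_iff' hΩ.measurableSet).2 this
  refine (Lp.eq_zero_iff_ae_eq_zero).2 ?_
  filter_upwards [ae_all_iff.2 hcomp] with x hx
  ext p
  simpa using hx p

/-- On a finite dimensional space of `H₀¹` fields, the representing field exists. -/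
theorem l2Riesz_spec {Ω : Set Plane} (hΩ : IsOpen Ω) (V : Submodule ℝ (VField Ω))
    [FiniteDimensional ℝ V] (hV : V ≤ H01 Ω) (l : VField Ω →ₗ[ℝ] ℝ) :
    l2Riesz V l ∈ V ∧ ∀ φ ∈ V, ⟪(l2Riesz V l).1, φ.1⟫_ℝ = l φ := by
  have hex : ∃ w ∈ V, ∀ φ ∈ V, ⟪w.1, φ.1⟫_ℝ = l φ := by
    let B : V →ₗ[ℝ] Module.Dual ℝ V := LinearMap.mk₂ ℝ
      (fun w φ => ⟪w.1.1, φ.1.1⟫_ℝ)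
      (fun a b c => by simp [inner_add_left]) (fun r a c => by simp [real_inner_smul_left])
      (fun a b c => by simp [inner_add_right]) (fun r a c => by simp [real_inner_smul_right])
    have hB : Function.Injective B := by
      rw [← LinearMap.ker_eq_bot, LinearMap.ker_eq_bot']
      intro w hw
      have h2 : ⟪w.1.1, w.1.1⟫_ℝ = 0 := by
        have := LinearMap.congr_fun hw w
        simpa [B] using this
      exact Subtype.ext (H01.eq_zero hΩ (hV w.2) (inner_self_eq_zero.1 h2))
    have : FiniteDimensional ℝ (Module.Dual ℝ V) := Subspace.instModuleDualFiniteDimensional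
    have hs : Function.Surjective B :=
      (LinearMap.injective_iff_surjective_of_finrank_eq_finrank
        (Subspace.dual_finrank_eq).symm).1 hB
    obtain ⟨w, hw⟩ := hs (l.comp V.subtype)
    exact ⟨w.1, w.2, fun φ hφ => LinearMap.congr_fun hw ⟨φ, hφ⟩⟩
  have : l2Riesz V l = hex.choose := by
    unfold l2Riesz
    exact dif_pos hex
  rw [this]
  exact hex.choose_spec

end Oldroyd

end

open Oldroyd

/-!
# Uniform bounds for the two-level approximation of an Oldroyd problem

Testing the fine problem with `uʰ` and with `A uʰ`, where `A` is the discrete Stokes operator,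
leaves two terms to be controlled: the memory and the convection of the coarse solution. The memory
is harmless. The field `w(t) = ∫₀ᵗ β(t-s) u(s) ds` solves `w' = γ u - δ w`, so that it contributes
exactly the derivative of a nonnegative stored energy and a damping of it (`exists_memory`,
`Solves.exists_energy`). Together with the Poincaré inequality this makes the energies decay at some
rate `κ`, chosen at most `2α`; the weight `2α` of the statement then only improves the means
(`expMean_anti`).

Everything else rests on the inequality `b(u, u, φ)² ≤ c ‖u‖ ‖Au‖ ‖∇u‖² ‖φ‖²` for discretely
divergence free `u`, with `c` independent of the mesh (`exists_abs_bForm_le`). It comes from the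
discrete Agmon inequality `‖u‖_∞² ≤ c ‖u‖ ‖Au‖` (`exists_discrete_agmon`). The solution `v` of the
continuous Stokes problem with right-hand side `Au` obeys the classical Agmon inequality (`agmon`)
and, by duality, `‖u - v‖ ≤ c h² ‖Au‖` (`exists_duality`, `exists_stokes_lift`); what remains is to
pass from `v` to `u` pointwise.

The finite element spaces are abstract: there are no elements on which an `L^∞` inverse inequality
could be used, and the `H¹` norm does not control the maximum in two dimensions. The bound
`|u| ≤ |v| + c (h⁻¹ ‖u - v‖ + h ‖D²v‖)` (`exists_sup_bound`) has to come from the nestedness of the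
spaces: `u` belongs to the spaces of all smaller mesh sizes `s ≤ h`, so the inverse inequality, used
there, bounds its gradient distance from any smooth field by the error at scale `s`
(`exists_norm_grad_sub_le`). Hence the `K`-functional `κ(s) = inf_z (s⁻¹ ‖u - z‖ + s ‖D²z‖)` over
`H₀¹ ∩ H²` has dyadic square tails controlled by their first term (`exists_sum_scaleK_sq_le`), which
forces geometric decay on average and thus summability (`sum_le_of_sq_tail_le`). Agmon's inequality
applied to the differences of near-optimal approximations at consecutive dyadic scales then gives a
convergent telescoping series with no logarithmic loss.

The square tails need the corresponding property of `H₀¹`: a field `w` has approximations in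
`H₀¹ ∩ H²` whose scaled errors are square summable over dyadic scales, with sum at most a multiple
of `‖∇w‖²` (`exists_dyadic_smoothing`). They are mollifications, by an even kernel, of `w` cut off
near the boundary. Inside, the errors are averages of second differences of the zero extension of
`w`; in the boundary strip they are single second differences, because in a Lipschitz domain two
equal steps along one of finitely many vectors lead out of `Ω` (`exists_exit_vectors`). Square
summability of second differences over dyadic scales is the telescoped parallelogram law
(`sum_diff2_le`).

With the convection inequality the coarse solution is bounded uniformly in time. Its second energy
inequality has the superquadratic term `K ‖∇u‖⁴`, but the first energy bounds the integral of
`‖∇u‖²` over unit intervals, and the stored memory energy is absorbed over a short time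
(`exists_bound_of_energy`, `exists_bound_self_convected`). The fine problem is linear, with the
convection of the coarse solution as a datum that has a bounded weighted mean
(`Solves.bound_of_convection`); its initial value is bounded in `H¹` by the stability of the
`L²` projection (`exists_norm_grad_l2Proj_le`).
-/

namespace Oldroyd

variable {Ω : Set Plane}

/-! ### Fields in `H₀¹` and integration by parts -/

/-- The `i`-th component of the velocity, as an element of `L²(Ω)`. -/
noncomputable def velC (i : Fin 2) : VField Ω →L[ℝ] L2 Ω ℝ :=
  ((EuclideanSpace.proj i : Plane →L[ℝ] ℝ).compLpL 2 (volume.restrict Ω)).comp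
    (ContinuousLinearMap.fst ℝ (L2 Ω Plane) (L2 Ω Mat))

/-- The entry `∂ⱼ vᵢ` of the gradient, as an element of `L²(Ω)`. -/
noncomputable def gradC (i j : Fin 2) : VField Ω →L[ℝ] L2 Ω ℝ :=
  ((EuclideanSpace.proj (i, j) : Mat →L[ℝ] ℝ).compLpL 2 (volume.restrict Ω)).comp
    (ContinuousLinearMap.snd ℝ (L2 Ω Plane) (L2 Ω Mat))

theorem velC_ae (i : Fin 2) (v : VField Ω) :
    (velC i v : Plane → ℝ) =ᵐ[volume.restrict Ω] fun x => (v.1 : Plane → Plane) x i :=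
  ContinuousLinearMap.coeFn_compLp _ _

theorem gradC_ae (i j : Fin 2) (v : VField Ω) :
    (gradC i j v : Plane → ℝ) =ᵐ[volume.restrict Ω] fun x => (v.2 : Plane → Mat) x (i, j) :=
  ContinuousLinearMap.coeFn_compLp _ _

theorem memLp_vel (i : Fin 2) (v : VField Ω) :
    MemLp (fun x => (v.1 : Plane → Plane) x i) 2 (volume.restrict Ω) :=
  (memLp_congr_ae (velC_ae i v)).1 (Lp.memLp _)

theorem memLp_grad (i j : Fin 2) (v : VField Ω) :
    MemLp (fun x => (v.2 : Plane → Mat) x (i, j)) 2 (volume.restrict Ω) :=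
  (memLp_congr_ae (gradC_ae i j v)).1 (Lp.memLp _)

theorem memLp_hess (p : (Fin 2 × Fin 2) × Fin 2) (D : L2 Ω Ten) :
    MemLp (fun x => (D : Plane → Ten) x p) 2 (volume.restrict Ω) :=
  (EuclideanSpace.proj p : Ten →L[ℝ] ℝ).comp_memLp' (Lp.memLp D)

/-- Integration against a square integrable function, as a functional on `L²(Ω)`. -/
noncomputable def pairL {g : Plane → ℝ} (hg : MemLp g 2 (volume.restrict Ω)) : L2 Ω ℝ →L[ℝ] ℝ :=
  innerSL ℝ hg.toLp

theorem pairL_apply {g : Plane → ℝ} (hg : MemLp g 2 (volume.restrict Ω)) (f : L2 Ω ℝ)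
    {f' : Plane → ℝ} (hf : (f : Plane → ℝ) =ᵐ[volume.restrict Ω] f') :
    pairL hg f = ∫ x in Ω, g x * f' x := by
  change ⟪hg.toLp, f⟫_ℝ = _
  rw [L2.inner_def]
  refine integral_congr_ae ?_
  filter_upwards [hg.coeFn_toLp, hf] with x hx hx'
  rw [hx, hx']
  simp [mul_comm]

/-- A square integrable function times a bounded continuous one is square integrable. -/
theorem memLp_mul_of_bound (hΩ : IsOpen Ω) {a ψ : Plane → ℝ} (ha : MemLp a 2 (volume.restrict Ω))
    (hψ : Continuous ψ) {B : ℝ} (hB : ∀ x ∈ Ω, |ψ x| ≤ B) :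
    MemLp (fun x => a x * ψ x) 2 (volume.restrict Ω) := by
  refine MemLp.of_le_mul (c := B) ha (ha.1.mul hψ.aestronglyMeasurable) ?_
  filter_upwards [ae_restrict_mem hΩ.measurableSet] with x hx
  rw [norm_mul, mul_comm]
  exact mul_le_mul_of_nonneg_right (by simpa using hB x hx) (norm_nonneg _)

theorem IsTest.add {F : Type} [NormedAddCommGroup F] [NormedSpace ℝ F] {φ ψ : Plane → F}
    (hφ : IsTest Ω φ) (hψ : IsTest Ω ψ) : IsTest Ω (φ + ψ) :=
  ⟨hφ.1.add hψ.1, hφ.2.1.add hψ.2.1,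
    (tsupport_add φ ψ).trans (union_subset hφ.2.2 hψ.2.2)⟩

theorem IsTest.const_smul {F : Type} [NormedAddCommGroup F] [NormedSpace ℝ F] {φ : Plane → F}
    (hφ : IsTest Ω φ) (c : ℝ) : IsTest Ω (c • φ) := by
  refine ⟨contDiff_const.smul hφ.1, ?_, ?_⟩
  · exact hφ.2.1.smul_left (f := fun _ => c)
  · exact (closure_mono (Function.support_const_smul_subset c φ)).trans hφ.2.2

theorem IsTest.comp {φ : Plane → Plane} (hφ : IsTest Ω φ) (i : Fin 2) :
    IsTest Ω fun x => φ x i := by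
  refine ⟨(EuclideanSpace.proj i : Plane →L[ℝ] ℝ).contDiff.comp hφ.1,
    hφ.2.1.comp_left (g := fun z : Plane => z i) (by simp), ?_⟩
  refine (closure_mono ?_).trans hφ.2.2
  intro x hx h
  exact hx (by simp [h])

theorem IsTest.mul_smooth {φ ψ : Plane → ℝ} (hφ : IsTest Ω φ) (hψ : ContDiff ℝ ∞ ψ) :
    IsTest Ω fun x => φ x * ψ x := by
  refine ⟨hφ.1.mul hψ, hφ.2.1.mul_right, ?_⟩
  refine (closure_mono ?_).trans hφ.2.2
  intro x hx h
  exact hx (by simp [h])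

theorem contDiff_partialD {φ : Plane → ℝ} (hφ : ContDiff ℝ ∞ φ) (j : Fin 2) :
    ContDiff ℝ ∞ (partialD j φ) :=
  (hφ.fderiv_right (m := ∞) (by simp)).clm_apply contDiff_const

theorem partialD_mul {φ ψ : Plane → ℝ} (hφ : ContDiff ℝ ∞ φ) (hψ : ContDiff ℝ ∞ ψ) (j : Fin 2)
    (x : Plane) :
    partialD j (fun y => φ y * ψ y) x = φ x * partialD j ψ x + partialD j φ x * ψ x := by
  have h1 := hφ.differentiable (by simp) x
  have h2 := hψ.differentiable (by simp) x
  unfold partialD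
  rw [fderiv_fun_mul h1 h2]
  simp [mul_comm]

theorem hasCompactSupport_partialD {φ : Plane → ℝ} (hφ : HasCompactSupport φ) (j : Fin 2) :
    HasCompactSupport (partialD j φ) :=
  (hφ.fderiv (𝕜 := ℝ)).comp_left (g := fun l : Plane →L[ℝ] ℝ => l (EuclideanSpace.single j 1))
    (by simp)

theorem IsTest.partialD {φ : Plane → ℝ} (hφ : IsTest Ω φ) (j : Fin 2) :
    IsTest Ω (partialD j φ) := by
  refine ⟨contDiff_partialD hφ.1 j, hasCompactSupport_partialD hφ.2.1 j, ?_⟩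
  refine subset_trans (closure_mono (t := Function.support (fderiv ℝ φ)) ?_)
    ((tsupport_fderiv_subset ℝ (f := φ)).trans hφ.2.2)
  intro x hx h
  exact hx (by simp [Oldroyd.partialD, h])

theorem contDiff_jacobian {φ : Plane → Plane} (hφ : ContDiff ℝ ∞ φ) :
    ContDiff ℝ ∞ (jacobian φ) := by
  rw [contDiff_euclidean]
  intro p
  exact contDiff_partialD ((EuclideanSpace.proj p.1 : Plane →L[ℝ] ℝ).contDiff.comp hφ) p.2

theorem hasCompactSupport_jacobian {φ : Plane → Plane} (hφ : HasCompactSupport φ) :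
    HasCompactSupport (jacobian φ) := by
  have h : ∀ p : Fin 2 × Fin 2, HasCompactSupport fun x => jacobian φ x p := fun p =>
    hasCompactSupport_partialD (hφ.comp_left (g := fun z : Plane => z p.1) (by simp)) p.2
  refine HasCompactSupport.intro (isCompact_iUnion fun p => (h p)) ?_
  intro x hx
  ext p
  have : x ∉ tsupport fun x => jacobian φ x p := fun h' => hx (mem_iUnion.2 ⟨p, h'⟩)
  simpa using image_eq_zero_of_notMem_tsupport this

theorem jacobian_add {φ ψ : Plane → Plane} (hφ : ContDiff ℝ ∞ φ) (hψ : ContDiff ℝ ∞ ψ) :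
    jacobian (φ + ψ) = jacobian φ + jacobian ψ := by
  ext x p
  have h1 : DifferentiableAt ℝ (fun y => φ y p.1) x :=
    ((EuclideanSpace.proj p.1 : Plane →L[ℝ] ℝ).contDiff.comp hφ).differentiable (by simp) x
  have h2 : DifferentiableAt ℝ (fun y => ψ y p.1) x :=
    ((EuclideanSpace.proj p.1 : Plane →L[ℝ] ℝ).contDiff.comp hψ).differentiable (by simp) x
  simp only [jacobian, partialD, Pi.add_apply, PiLp.add_apply]
  rw [fderiv_fun_add h1 h2]
  simp

theorem jacobian_smul {φ : Plane → Plane} (hφ : ContDiff ℝ ∞ φ) (c : ℝ) :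
    jacobian (c • φ) = c • jacobian φ := by
  ext x p
  have h1 : DifferentiableAt ℝ (fun y => φ y p.1) x :=
    ((EuclideanSpace.proj p.1 : Plane →L[ℝ] ℝ).contDiff.comp hφ).differentiable (by simp) x
  simp only [jacobian, partialD, Pi.smul_apply, PiLp.smul_apply, smul_eq_mul]
  rw [fderiv_const_mul h1]
  simp

/-- Each test function gives a test field. -/
theorem exists_testField {φ : Plane → Plane} (hφ : IsTest Ω φ) :
    ∃ v ∈ testFields Ω, (v.1 : Plane → Plane) =ᵐ[volume.restrict Ω] φ ∧
      (v.2 : Plane → Mat) =ᵐ[volume.restrict Ω] jacobian φ := by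
  have m1 : MemLp φ 2 (volume.restrict Ω) :=
    (hφ.1.continuous.memLp_of_hasCompactSupport hφ.2.1).restrict Ω
  have m2 : MemLp (jacobian φ) 2 (volume.restrict Ω) :=
    ((contDiff_jacobian hφ.1).continuous.memLp_of_hasCompactSupport
      (hasCompactSupport_jacobian hφ.2.1)).restrict Ω
  exact ⟨(m1.toLp, m2.toLp), ⟨φ, hφ, m1.coeFn_toLp, m2.coeFn_toLp⟩, m1.coeFn_toLp, m2.coeFn_toLp⟩

theorem span_testFields : (Submodule.span ℝ (testFields Ω) : Set (VField Ω)) = testFields Ω := by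
  refine subset_antisymm ?_ Submodule.subset_span
  let S : Submodule ℝ (VField Ω) :=
    { carrier := testFields Ω
      zero_mem' := by
        obtain ⟨φ, h⟩ : ∃ φ : Plane → Plane, φ = 0 := ⟨0, rfl⟩
        refine ⟨0, ⟨contDiff_const, HasCompactSupport.zero, ?_⟩, Lp.coeFn_zero _ _ _, ?_⟩
        · simp [tsupport]
        · refine (Lp.coeFn_zero _ _ _).trans (Filter.Eventually.of_forall fun x => ?_)
          ext p
          simp [jacobian, partialD]
      add_mem' := by
        rintro v w ⟨φ, hφ, h1, h2⟩ ⟨ψ, hψ, h3, h4⟩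
        refine ⟨φ + ψ, hφ.add hψ, ?_, ?_⟩
        · exact (Lp.coeFn_add _ _).trans (h1.add h3)
        · rw [jacobian_add hφ.1 hψ.1]
          exact (Lp.coeFn_add _ _).trans (h2.add h4)
      smul_mem' := by
        rintro c v ⟨φ, hφ, h1, h2⟩
        refine ⟨c • φ, hφ.const_smul c, ?_, ?_⟩
        · exact (Lp.coeFn_smul _ _).trans (h1.const_smul c)
        · rw [jacobian_smul hφ.1]
          exact (Lp.coeFn_smul _ _).trans (h2.const_smul c) }
  exact (Submodule.span_le (p := S)).2 (fun v hv => hv)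

/-- A closed condition that holds for test fields holds on `H₀¹`. -/
theorem H01.induction {p : VField Ω → Prop} (hp : IsClosed {v | p v})
    (ht : ∀ v ∈ testFields Ω, p v) {v : VField Ω} (hv : v ∈ H01 Ω) : p v := by
  have h : v ∈ closure (testFields Ω) := by
    rw [← span_testFields]
    exact hv
  exact (closure_minimal (s := testFields Ω) (t := {v | p v}) ht hp) h

/-- Leibniz' rule `∂ⱼ(a vᵢ ψ) = a vᵢ ∂ⱼψ + a ∂ⱼvᵢ ψ + ∂ⱼa vᵢ ψ` integrated over `Ω`, for
`v ∈ H₀¹` and `a` with square integrable weak derivative `b = ∂ⱼa`; no boundary values of `a` are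
needed. -/
theorem integral_product_rule (hΩ : IsOpen Ω) {a b : Plane → ℝ} {j : Fin 2}
    (ha : MemLp a 2 (volume.restrict Ω)) (hb : MemLp b 2 (volume.restrict Ω))
    (hab : IsWeakPartial Ω j a b) {v : VField Ω} (hv : v ∈ H01 Ω) (i : Fin 2) {ψ : Plane → ℝ}
    (hψ : ContDiff ℝ ∞ ψ) {B : ℝ} (hB : ∀ x ∈ Ω, |ψ x| ≤ B)
    (hB' : ∀ x ∈ Ω, |partialD j ψ x| ≤ B) :
    (∫ x in Ω, a x * partialD j ψ x * (v.1 : Plane → Plane) x i) +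
      (∫ x in Ω, a x * ψ x * (v.2 : Plane → Mat) x (i, j)) +
      (∫ x in Ω, b x * ψ x * (v.1 : Plane → Plane) x i) = 0 := by
  have hdψ := contDiff_partialD hψ j
  have m1 := memLp_mul_of_bound hΩ ha hdψ.continuous hB'
  have m2 := memLp_mul_of_bound hΩ ha hψ.continuous hB
  have m3 := memLp_mul_of_bound hΩ hb hψ.continuous hB
  let Λ : VField Ω →L[ℝ] ℝ :=
    (pairL m1).comp (velC i) + (pairL m2).comp (gradC i j) + (pairL m3).comp (velC i)
  have hΛ : ∀ w : VField Ω, Λ w =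
      (∫ x in Ω, a x * partialD j ψ x * (w.1 : Plane → Plane) x i) +
      (∫ x in Ω, a x * ψ x * (w.2 : Plane → Mat) x (i, j)) +
      (∫ x in Ω, b x * ψ x * (w.1 : Plane → Plane) x i) := by
    intro w
    rw [← pairL_apply m1 _ (velC_ae i w), ← pairL_apply m2 _ (gradC_ae i j w),
      ← pairL_apply m3 _ (velC_ae i w)]
    rfl
  rw [← hΛ]
  refine H01.induction (p := fun w => Λ w = 0) (isClosed_eq Λ.continuous continuous_const) ?_ hv
  rintro w ⟨φ, hφ, h1, h2⟩
  have n1 := memLp_vel i w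
  have n2 := memLp_grad i j w
  have hφi := hφ.comp i
  have key := hab _ (hφi.mul_smooth hψ)
  have e1 : ∫ x in Ω, a x * partialD j (fun x => φ x i * ψ x) x =
      (∫ x in Ω, a x * partialD j ψ x * (w.1 : Plane → Plane) x i) +
      (∫ x in Ω, a x * ψ x * (w.2 : Plane → Mat) x (i, j)) := by
    have i1 : Integrable (fun x => a x * partialD j ψ x * (w.1 : Plane → Plane) x i)
        (volume.restrict Ω) := m1.integrable_mul n1
    have i2 : Integrable (fun x => a x * ψ x * (w.2 : Plane → Mat) x (i, j))
        (volume.restrict Ω) := m2.integrable_mul n2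
    rw [← integral_add i1 i2]
    refine integral_congr_ae ?_
    filter_upwards [h1, h2] with x hx hx'
    rw [partialD_mul hφi.1 hψ, hx, hx']
    simp only [jacobian]
    ring
  have e2 : ∫ x in Ω, b x * (φ x i * ψ x) = ∫ x in Ω, b x * ψ x * (w.1 : Plane → Plane) x i := by
    refine integral_congr_ae ?_
    filter_upwards [h1] with x hx
    rw [hx]
    ring
  rw [hΛ, ← e1, ← e2]
  linarith

/-! ### Poincaré, interpolation and the space `H₀¹ ∩ H²` -/

theorem norm_sq_eq_sum {ι : Type} [Fintype ι] (f : L2 Ω (EuclideanSpace ℝ ι)) :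
    ‖f‖ ^ 2 = ∑ i, ∫ x in Ω, ((f : Plane → EuclideanSpace ℝ ι) x i) ^ 2 := by
  rw [← real_inner_self_eq_norm_sq, L2.inner_def, ← integral_finsetSum]
  · refine integral_congr_ae (Filter.Eventually.of_forall fun x => ?_)
    simp only [real_inner_self_eq_norm_sq]
    rw [EuclideanSpace.real_norm_sq_eq]
  · intro i _
    exact ((EuclideanSpace.proj i : EuclideanSpace ℝ ι →L[ℝ] ℝ).comp_memLp'
        (Lp.memLp f)).integrable_sq

theorem integral_sq_le_norm_sq {ι : Type} [Fintype ι] (f : L2 Ω (EuclideanSpace ℝ ι)) (i : ι) :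
    ∫ x in Ω, ((f : Plane → EuclideanSpace ℝ ι) x i) ^ 2 ≤ ‖f‖ ^ 2 := by
  rw [norm_sq_eq_sum]
  exact Finset.single_le_sum
    (f := fun i => ∫ x in Ω, ((f : Plane → EuclideanSpace ℝ ι) x i) ^ 2)
    (fun i _ => integral_nonneg fun x => sq_nonneg _) (Finset.mem_univ i)

/-- The Cauchy–Schwarz inequality for square integrable functions. -/
theorem abs_integral_mul_le {a b : Plane → ℝ} (ha : MemLp a 2 (volume.restrict Ω))
    (hb : MemLp b 2 (volume.restrict Ω)) {A B : ℝ} (hA : 0 ≤ A) (hB : 0 ≤ B)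
    (hA2 : ∫ x in Ω, a x ^ 2 ≤ A ^ 2) (hB2 : ∫ x in Ω, b x ^ 2 ≤ B ^ 2) :
    |∫ x in Ω, a x * b x| ≤ A * B := by
  have h1 : ∀ {c : Plane → ℝ} (hc : MemLp c 2 (volume.restrict Ω)),
      ‖hc.toLp‖ ^ 2 = ∫ x in Ω, c x ^ 2 := by
    intro c hc
    rw [← real_inner_self_eq_norm_sq, L2.inner_def]
    refine integral_congr_ae ?_
    filter_upwards [hc.coeFn_toLp] with x hx
    rw [hx, real_inner_self_eq_norm_sq, Real.norm_eq_abs, sq_abs]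
  have h2 : ⟪ha.toLp, hb.toLp⟫_ℝ = ∫ x in Ω, a x * b x := by
    rw [L2.inner_def]
    refine integral_congr_ae ?_
    filter_upwards [ha.coeFn_toLp, hb.coeFn_toLp] with x hx hx'
    rw [hx, hx']
    simp [mul_comm]
  rw [← h2]
  refine (abs_real_inner_le_norm _ _).trans ?_
  refine mul_le_mul ?_ ?_ (norm_nonneg _) hA
  · exact (sq_le_sq₀ (norm_nonneg _) hA).1 (by rw [h1 ha]; exact hA2)
  · exact (sq_le_sq₀ (norm_nonneg _) hB).1 (by rw [h1 hb]; exact hB2)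

theorem integral_abs_mul_le {a b : Plane → ℝ} (ha : MemLp a 2 (volume.restrict Ω))
    (hb : MemLp b 2 (volume.restrict Ω)) {A B : ℝ} (hA : 0 ≤ A) (hB : 0 ≤ B)
    (hA2 : ∫ x in Ω, a x ^ 2 ≤ A ^ 2) (hB2 : ∫ x in Ω, b x ^ 2 ≤ B ^ 2) :
    ∫ x in Ω, |a x * b x| ≤ A * B := by
  have := abs_integral_mul_le (a := fun x => |a x|) (b := fun x => |b x|) ha.abs hb.abs hA hB
    (by simpa using hA2) (by simpa using hB2)
  simp_rw [abs_mul]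
  exact (le_abs_self _).trans this

/-- Poincaré's inequality on `H₀¹(Ω)` for bounded `Ω`. -/
theorem exists_poincare (hΩ : IsOpen Ω) (hb : Bornology.IsBounded Ω) :
    ∃ c : ℝ, 0 < c ∧ ∀ v ∈ H01 Ω, ‖v.1‖ ≤ c * ‖v.2‖ := by
  obtain ⟨R, hR⟩ := hb.exists_norm_le
  set B := max R 1 with hBdef
  have hB1 : 1 ≤ B := le_max_right _ _
  have hB0 : 0 < B := by linarith
  refine ⟨2 * B, by positivity, fun v hv => ?_⟩
  have hcomp : ∀ i : Fin 2, ∫ x in Ω, ((v.1 : Plane → Plane) x i) ^ 2 ≤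
      (2 * B) ^ 2 * ∫ x in Ω, ((v.2 : Plane → Mat) x (i, 0)) ^ 2 := by
    intro i
    have hψ : ContDiff ℝ ∞ (fun x : Plane => x 0) :=
      (EuclideanSpace.proj (0 : Fin 2) : Plane →L[ℝ] ℝ).contDiff
    have hd : ∀ x, partialD 0 (fun x : Plane => x 0) x = 1 := by
      intro x
      have : HasFDerivAt (fun x : Plane => x 0)
        (EuclideanSpace.proj (0 : Fin 2) : Plane →L[ℝ] ℝ) x :=
        (EuclideanSpace.proj (0 : Fin 2) : Plane →L[ℝ] ℝ).hasFDerivAt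
      simp [partialD, this.fderiv]
    have hbd : ∀ x ∈ Ω, |x 0| ≤ B := fun x hx =>
      ((by simpa using PiLp.norm_apply_le x 0 : |x 0| ≤ ‖x‖).trans (hR x hx)).trans
        (le_max_left _ _)
    have m1 := memLp_vel i v
    have m2 := memLp_grad i 0 v
    have key := integral_product_rule hΩ m1 m2 (H01.isWeakPartial hv i 0) hv i hψ (B := B)
      hbd (fun x _ => by rw [hd]; simpa using hB1)
    simp only [hd, mul_one] at key
    set a2 := ∫ x in Ω, ((v.1 : Plane → Plane) x i) ^ 2 with ha2
    set b2 := ∫ x in Ω, ((v.2 : Plane → Mat) x (i, 0)) ^ 2 with hb2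
    have ha0 : 0 ≤ a2 := integral_nonneg fun x => sq_nonneg _
    have hb0 : 0 ≤ b2 := integral_nonneg fun x => sq_nonneg _
    have n1 := memLp_mul_of_bound hΩ m1 hψ.continuous hbd
    have n1' : ∫ x in Ω, ((v.1 : Plane → Plane) x i * x 0) ^ 2 ≤ (B * √a2) ^ 2 := by
      rw [mul_pow, Real.sq_sqrt ha0, ha2, ← integral_const_mul]
      refine setIntegral_mono_on n1.integrable_sq (m1.integrable_sq.const_mul _)
        hΩ.measurableSet fun x hx => ?_
      rw [mul_pow, mul_comm]
      refine mul_le_mul_of_nonneg_right ?_ (sq_nonneg _)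
      rw [← sq_abs]
      exact pow_le_pow_left₀ (abs_nonneg _) (hbd x hx) 2
    have c1 := abs_integral_mul_le n1 m2 (by positivity) (Real.sqrt_nonneg b2) n1'
      (by rw [Real.sq_sqrt hb0])
    have e1 : ∫ x in Ω, (v.1 : Plane → Plane) x i * (v.1 : Plane → Plane) x i = a2 := by
      simp only [ha2, sq]
    have e2 : ∫ x in Ω, (v.2 : Plane → Mat) x (i, 0) * x 0 * (v.1 : Plane → Plane) x i =
        ∫ x in Ω, (v.1 : Plane → Plane) x i * x 0 * (v.2 : Plane → Mat) x (i, 0) := by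
      congr 1; ext x; ring
    rw [e1, e2] at key
    have h3 : a2 ≤ 2 * B * √a2 * √b2 := by
      have := neg_abs_le
        (∫ x in Ω, (v.1 : Plane → Plane) x i * x 0 * (v.2 : Plane → Mat) x (i, 0))
      nlinarith
    have h4 : a2 = √a2 ^ 2 := (Real.sq_sqrt ha0).symm
    have h5 : √a2 ≤ 2 * B * √b2 := by
      rcases (Real.sqrt_nonneg a2).eq_or_lt with h0 | h0
      · rw [← h0]; positivity
      · by_contra hcon
        push Not at hcon
        have := mul_lt_mul_of_pos_left hcon h0
        nlinarith
    calc a2 = √a2 ^ 2 := h4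
      _ ≤ (2 * B * √b2) ^ 2 := pow_le_pow_left₀ (Real.sqrt_nonneg _) h5 2
      _ = (2 * B) ^ 2 * b2 := by rw [mul_pow, Real.sq_sqrt hb0]
  refine (sq_le_sq₀ (norm_nonneg _) (by positivity)).1 ?_
  rw [mul_pow, norm_sq_eq_sum v.1, norm_sq_eq_sum v.2, Fintype.sum_prod_type, Finset.mul_sum]
  refine Finset.sum_le_sum fun i _ => (hcomp i).trans ?_
  refine mul_le_mul_of_nonneg_left ?_ (by positivity)
  exact Finset.single_le_sum
    (f := fun j => ∫ x in Ω, ((v.2 : Plane → Mat) x (i, j)) ^ 2)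
    (fun i _ => integral_nonneg fun x => sq_nonneg _) (Finset.mem_univ 0)

/-- The interpolation inequality `‖∇v‖² ≤ 4 ‖v‖ ‖D²v‖` on `H₀¹ ∩ H²`. -/
theorem norm_grad_sq_le (hΩ : IsOpen Ω) {v : VField Ω} (hv : v ∈ H01 Ω) {D : L2 Ω Ten}
    (hD : IsHessian v D) : ‖v.2‖ ^ 2 ≤ 4 * (‖v.1‖ * ‖D‖) := by
  have hcomp : ∀ p : Fin 2 × Fin 2, ∫ x in Ω, ((v.2 : Plane → Mat) x p) ^ 2 ≤ ‖v.1‖ * ‖D‖ := by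
    rintro ⟨i, j⟩
    have hp : ∀ x, partialD j (fun _ : Plane => (1 : ℝ)) x = 0 := by
      intro x; simp [partialD]
    have key := integral_product_rule hΩ (memLp_grad i j v) (memLp_hess ((i, j), j) D)
      (hD i j j) hv i (contDiff_const (c := (1 : ℝ))) (B := 1) (by simp) (by simp [hp])
    simp only [hp, mul_zero, zero_mul, mul_one, integral_zero, zero_add] at key
    have c1 := abs_integral_mul_le (memLp_hess ((i, j), j) D) (memLp_vel i v) (norm_nonneg D)
      (norm_nonneg v.1) (integral_sq_le_norm_sq D _) (integral_sq_le_norm_sq v.1 _)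
    have := neg_abs_le (∫ x in Ω, (D : Plane → Ten) x ((i, j), j) * (v.1 : Plane → Plane) x i)
    simp only [sq]
    linarith
  rw [norm_sq_eq_sum v.2]
  calc _ ≤ ∑ _p : Fin 2 × Fin 2, ‖v.1‖ * ‖D‖ := Finset.sum_le_sum fun p _ => hcomp p
    _ = _ := by simp

/-- On `H₀¹ ∩ H²` the full `H²`-norm is controlled by the second derivatives. -/
theorem exists_h2norm_le (hΩ : IsOpen Ω) (hb : Bornology.IsBounded Ω) :
    ∃ c : ℝ, 1 ≤ c ∧ ∀ v ∈ H01 Ω, ∀ D : L2 Ω Ten, IsHessian v D → h2norm v D ≤ c * ‖D‖ := by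
  obtain ⟨c, hc, hP⟩ := exists_poincare hΩ hb
  refine ⟨4 * c ^ 2 + 4 * c + 1, by nlinarith, fun v hv D hD => ?_⟩
  have h1 := hP v hv
  have h2 := norm_grad_sq_le hΩ hv hD
  have hn1 := norm_nonneg v.1
  have hn2 := norm_nonneg v.2
  have hnD := norm_nonneg D
  have h3 : ‖v.2‖ ≤ 4 * c * ‖D‖ := by
    rcases hn2.eq_or_lt with h0 | h0
    · rw [← h0]; positivity
    · by_contra hcon
      push Not at hcon
      have := mul_lt_mul_of_pos_left hcon h0
      have := mul_le_mul_of_nonneg_right h1 hnD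
      nlinarith
  have h4 : ‖v.1‖ ≤ 4 * c ^ 2 * ‖D‖ := by nlinarith
  have : h2norm v D ≤ ‖v.1‖ + ‖v.2‖ + ‖D‖ := by
    refine Real.sqrt_le_iff.2 ⟨by positivity, ?_⟩
    nlinarith [mul_nonneg hn1 hn2, mul_nonneg hn1 hnD, mul_nonneg hn2 hnD]
  linarith

theorem norm_hess_le_h2norm {v : VField Ω} {D : L2 Ω Ten} : ‖D‖ ≤ h2norm v D :=
  Real.le_sqrt_of_sq_le (by nlinarith [sq_nonneg ‖v.1‖, sq_nonneg ‖v.2‖])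

/-- The entry `∂ₖ∂ⱼvᵢ` of a third order array, as an element of `L²(Ω)`. -/
noncomputable def hessC (p : (Fin 2 × Fin 2) × Fin 2) : L2 Ω Ten →L[ℝ] L2 Ω ℝ :=
  (EuclideanSpace.proj p : Ten →L[ℝ] ℝ).compLpL 2 (volume.restrict Ω)

theorem hessC_ae (p : (Fin 2 × Fin 2) × Fin 2) (D : L2 Ω Ten) :
    (hessC p D : Plane → ℝ) =ᵐ[volume.restrict Ω] fun x => (D : Plane → Ten) x p :=
  ContinuousLinearMap.coeFn_compLp _ _

theorem IsTest.memLp {φ : Plane → ℝ} (hφ : IsTest Ω φ) : MemLp φ 2 (volume.restrict Ω) :=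
  (hφ.1.continuous.memLp_of_hasCompactSupport hφ.2.1).restrict Ω

theorem isHessian_iff {v : VField Ω} {D : L2 Ω Ten} :
    IsHessian v D ↔ ∀ (i j k : Fin 2) (φ : Plane → ℝ) (hφ : IsTest Ω φ),
      pairL (hφ.partialD k).memLp (gradC i j v) + pairL hφ.memLp (hessC ((i, j), k) D) = 0 := by
  unfold IsHessian IsWeakPartial
  refine forall_congr' fun i => forall_congr' fun j => forall_congr' fun k =>
    forall_congr' fun φ => forall_congr' fun hφ => ?_
  rw [pairL_apply _ _ (gradC_ae i j v), pairL_apply _ _ (hessC_ae _ D)]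
  simp_rw [mul_comm (partialD k φ _), mul_comm (φ _)]
  exact eq_neg_iff_add_eq_zero

/-- `H₀¹ ∩ H²`, as the space of pairs of a field and its array of second derivatives. -/
def H2 (Ω : Set Plane) : Submodule ℝ (VField Ω × L2 Ω Ten) where
  carrier := {p | p.1 ∈ H01 Ω ∧ IsHessian p.1 p.2}
  zero_mem' := ⟨zero_mem _, isHessian_iff.2 fun i j k φ hφ => by simp⟩
  add_mem' := by
    rintro p q ⟨hp, hp'⟩ ⟨hq, hq'⟩
    refine ⟨add_mem hp hq, isHessian_iff.2 fun i j k φ hφ => ?_⟩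
    have h1 := isHessian_iff.1 hp' i j k φ hφ
    have h2 := isHessian_iff.1 hq' i j k φ hφ
    simp only [Prod.fst_add, Prod.snd_add, map_add]
    linarith
  smul_mem' := by
    rintro c p ⟨hp, hp'⟩
    refine ⟨Submodule.smul_mem _ c hp, isHessian_iff.2 fun i j k φ hφ => ?_⟩
    have h1 := isHessian_iff.1 hp' i j k φ hφ
    simp only [Prod.smul_fst, Prod.smul_snd, map_smul, smul_eq_mul]
    rw [← mul_add, h1, mul_zero]

/-! ### Mollification and Agmon's inequality -/

/-- The convolution `κ * g`. -/
noncomputable def moll (κ g : Plane → ℝ) (x : Plane) : ℝ := ∫ t, κ (x - t) * g t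

theorem moll_eq_convolution (κ g : Plane → ℝ) :
    moll κ g = convolution g κ (ContinuousLinearMap.lsmul ℝ ℝ) volume := by
  ext x
  simp [moll, convolution, mul_comm]

theorem moll_eq_swap (κ g : Plane → ℝ) (x : Plane) : moll κ g x = ∫ t, κ t * g (x - t) := by
  rw [moll, ← integral_sub_left_eq_self (fun t => κ (x - t) * g t) volume x]
  simp

theorem contDiff_moll {κ g : Plane → ℝ} (hκ : ContDiff ℝ ∞ κ) (hκc : HasCompactSupport κ)
    (hg : LocallyIntegrable g) : ContDiff ℝ ∞ (moll κ g) := by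
  rw [moll_eq_convolution]
  exact hκc.contDiff_convolution_right _ hg hκ

theorem partialD_moll {κ g : Plane → ℝ} (hκ : ContDiff ℝ ∞ κ) (hκc : HasCompactSupport κ)
    (hg : LocallyIntegrable g) (j : Fin 2) :
    partialD j (moll κ g) = moll (partialD j κ) g := by
  ext x
  have h := hκc.hasFDerivAt_convolution_right (ContinuousLinearMap.lsmul ℝ ℝ) hg
    (hκ.of_le (by simp)) x
  rw [← moll_eq_convolution] at h
  rw [partialD, h.fderiv]
  have hint : ConvolutionExistsAt g (fderiv ℝ κ) x
      ((ContinuousLinearMap.lsmul ℝ ℝ : ℝ →L[ℝ] ℝ →L[ℝ] ℝ).precompR Plane) volume :=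
    (hκc.fderiv (𝕜 := ℝ)).convolutionExists_right _ hg
      ((hκ.fderiv_right (m := ∞) (by simp)).continuous) x
  rw [convolution, ContinuousLinearMap.integral_apply hint]
  simp [moll, partialD, mul_comm]

theorem hasCompactSupport_moll {κ g : Plane → ℝ} (hκ : HasCompactSupport κ)
    (hg : HasCompactSupport g) : HasCompactSupport (moll κ g) := by
  rw [moll_eq_convolution]
  exact hg.convolution (ContinuousLinearMap.lsmul ℝ ℝ) hκ

/-- In the plane, a smooth compactly supported function is bounded by the integral of its mixed
second derivative. -/
theorem enorm_le_lintegral_mixed {f : Plane → ℝ} (hf : ContDiff ℝ ∞ f) (hc : HasCompactSupport f)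
    (x : Plane) : ‖f x‖ₑ ≤ ∫⁻ y, ‖partialD 1 (partialD 0 f) y‖ₑ := by
  have hline : ∀ (g : Plane → ℝ), ContDiff ℝ ∞ g → HasCompactSupport g → ∀ (j : Fin 2) (y : Plane),
      ‖g y‖ₑ ≤ ∫⁻ t : ℝ, ‖partialD j g (y + (t - y j) • EuclideanSpace.single j 1)‖ₑ := by
    intro g hg hgc j y
    let ℓ : ℝ → Plane := fun t => y + (t - y j) • EuclideanSpace.single j (1 : ℝ)
    have hℓ : ContDiff ℝ ∞ ℓ := by fun_prop
    have hℓd : ∀ t, HasDerivAt ℓ (EuclideanSpace.single j (1 : ℝ)) t := by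
      intro t
      have := (((hasDerivAt_id t).sub_const (y j)).smul_const
        (EuclideanSpace.single j (1 : ℝ) : Plane)).const_add y
      rw [one_smul] at this
      exact this
    have hemb : Topology.IsClosedEmbedding ℓ := by
      refine (Isometry.of_dist_eq fun s t => ?_).isClosedEmbedding
      simp [ℓ, dist_eq_norm, ← sub_smul, norm_smul]
    have h1 := HasCompactSupport.enorm_le_lintegral_Ici_deriv (f := g ∘ ℓ)
      ((hg.comp hℓ).of_le (by simp)) (hgc.comp_isClosedEmbedding hemb) (y j)
    have h2 : (g ∘ ℓ) (y j) = g y := by simp [ℓ]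
    rw [h2] at h1
    refine h1.trans ((setLIntegral_le_lintegral _ _).trans (lintegral_mono fun t => ?_))
    have h3 : deriv (g ∘ ℓ) t = partialD j g (ℓ t) :=
      ((hg.differentiable (by simp) (ℓ t)).hasFDerivAt.comp_hasDerivAt t (hℓd t)).deriv
    rw [h3]
  have hpt : ∀ (y : Plane) (s t : ℝ), (y + (s - y 0) • EuclideanSpace.single 0 (1 : ℝ)) +
      (t - (y + (s - y 0) • EuclideanSpace.single 0 (1 : ℝ) : Plane) 1) • EuclideanSpace.single 1
          (1 : ℝ)
      = WithLp.toLp 2 ((MeasurableEquiv.finTwoArrow (α := ℝ)).symm (s, t)) := by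
    intro y s t
    ext i
    fin_cases i <;> simp [MeasurableEquiv.finTwoArrow]
  have hcont : Continuous fun y => ‖partialD 1 (partialD 0 f) y‖ₑ :=
    (contDiff_partialD (contDiff_partialD hf 0) 1).continuous.enorm
  calc ‖f x‖ₑ ≤ ∫⁻ s : ℝ, ‖partialD 0 f (x + (s - x 0) • EuclideanSpace.single 0 1)‖ₑ :=
        hline f hf hc 0 x
    _ ≤ ∫⁻ s : ℝ, ∫⁻ t : ℝ, ‖partialD 1 (partialD 0 f)
          (WithLp.toLp 2 ((MeasurableEquiv.finTwoArrow (α := ℝ)).symm (s, t)))‖ₑ := by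
        refine lintegral_mono fun s => ?_
        refine (hline _ (contDiff_partialD hf 0) (hasCompactSupport_partialD hc 0) 1 _).trans_eq ?_
        simp_rw [hpt]
    _ = ∫⁻ z : ℝ × ℝ, ‖partialD 1 (partialD 0 f)
          (WithLp.toLp 2 ((MeasurableEquiv.finTwoArrow (α := ℝ)).symm z))‖ₑ := by
        rw [Measure.volume_eq_prod, lintegral_prod]
        refine Measurable.aemeasurable ?_
        exact hcont.measurable.comp ((PiLp.volume_preserving_toLp (Fin 2)).measurable.comp
          (MeasurableEquiv.finTwoArrow (α := ℝ)).symm.measurable)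
    _ = ∫⁻ y, ‖partialD 1 (partialD 0 f) y‖ₑ := by
        rw [(volume_preserving_finTwoArrow ℝ).symm.lintegral_comp
          (f := fun z => ‖partialD 1 (partialD 0 f) (WithLp.toLp 2 z)‖ₑ)
          (hcont.measurable.comp (PiLp.volume_preserving_toLp (Fin 2)).measurable)]
        exact (PiLp.volume_preserving_toLp (Fin 2)).lintegral_comp hcont.measurable

/-- An integrable function of bounded support whose mixed weak derivative `∂₁∂₀F = m` is
integrable is bounded by `‖m‖₁`. -/
theorem ae_le_of_weak_mixed {F m : Plane → ℝ} (hF : Integrable F) (hFc : HasCompactSupport F)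
    (hm : Integrable m)
    (hFm : ∀ ψ : Plane → ℝ, ContDiff ℝ ∞ ψ → HasCompactSupport ψ →
      ∫ x, F x * partialD 1 (partialD 0 ψ) x = ∫ x, m x * ψ x) :
    ∀ᵐ x, |F x| ≤ ∫ y, |m y| := by
  let b : ℕ → ContDiffBump (0 : Plane) := fun n =>
    { rIn := 1 / (2 * ((n : ℝ) + 1)), rOut := 1 / ((n : ℝ) + 1), rIn_pos := by positivity
      rIn_lt_rOut := by
        apply one_div_lt_one_div_of_lt <;> [positivity; linarith [(n.cast_nonneg : (0 : ℝ) ≤ n)]] }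
  have hconv := ContDiffBump.ae_convolution_tendsto_right_of_locallyIntegrable (μ := volume)
    (φ := b) (l := Filter.atTop) (K := 2) tendsto_one_div_add_atTop_nhds_zero_nat
    (Filter.Eventually.of_forall fun n => by
      simp only [b]; field_simp; norm_num) hF.locallyIntegrable
  filter_upwards [hconv] with x hx
  have hx' : Filter.Tendsto (fun n => moll ((b n).normed volume) F x) Filter.atTop
      (nhds (F x)) := by
    refine hx.congr fun n => ?_
    rw [moll_eq_swap]
    simp [convolution]
  refine le_of_tendsto hx'.abs (Filter.Eventually.of_forall fun n => ?_)
  set κ := (b n).normed volume with hκ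
  have hκs : ContDiff ℝ ∞ κ := (b n).contDiff_normed
  have hκc : HasCompactSupport κ := (b n).hasCompactSupport_normed
  have hκi : Integrable κ := (b n).integrable_normed
  have hsmooth := contDiff_moll hκs hκc hF.locallyIntegrable
  have hcomp := hasCompactSupport_moll hκc hFc
  have hd : partialD 1 (partialD 0 (moll κ F)) = moll κ m := by
    rw [partialD_moll hκs hκc hF.locallyIntegrable, partialD_moll (contDiff_partialD hκs 0)
      (hasCompactSupport_partialD hκc 0) hF.locallyIntegrable]
    ext z
    have hrefl : ∀ (g : Plane → ℝ), ContDiff ℝ ∞ g → ∀ (j : Fin 2) (t : Plane),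
        partialD j (fun s => g (z - s)) t = -partialD j g (z - t) := by
      intro g hg j t
      have h1 := (hg.differentiable (by simp) (z - t)).hasFDerivAt.comp t
        ((hasFDerivAt_id t).const_sub z)
      have h1' : fderiv ℝ (fun s => g (z - s)) t =
        (fderiv ℝ g (z - t)).comp (-(ContinuousLinearMap.id ℝ Plane)) := h1.fderiv
      simp [partialD, h1']
    have e : partialD 1 (partialD 0 (fun s => κ (z - s))) =
        fun t => partialD 1 (partialD 0 κ) (z - t) := by
      have e0 : partialD 0 (fun s => κ (z - s)) = fun t => -partialD 0 κ (z - t) :=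
        funext fun t => hrefl κ hκs 0 t
      rw [e0]
      ext t
      have := hrefl _ (contDiff_partialD hκs 0) 1 t
      simp only [partialD] at this ⊢
      rw [fderiv_fun_neg]
      simp only [neg_apply]
      rw [this]
      simp
    have h2 := hFm (fun s => κ (z - s)) (hκs.comp (contDiff_const.sub contDiff_id))
      (hκc.comp_homeomorph (Homeomorph.subLeft z))
    rw [e] at h2
    simp only [moll]
    simp_rw [mul_comm _ (F _), mul_comm _ (m _)]
    exact h2
  have hbound := enorm_le_lintegral_mixed hsmooth hcomp x
  rw [hd] at hbound
  have hint : ∫⁻ y, ‖moll κ m y‖ₑ ≤ ∫⁻ y, ‖m y‖ₑ := by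
    have h3 : ∀ y, ‖moll κ m y‖ₑ ≤ ∫⁻ t, ‖κ (y - t)‖ₑ * ‖m t‖ₑ := fun y => by
      refine (enorm_integral_le_lintegral_enorm _).trans_eq ?_
      simp_rw [enorm_mul]
    refine (lintegral_mono h3).trans ?_
    rw [lintegral_lintegral_swap]
    · have h4 : ∀ t, ∫⁻ y, ‖κ (y - t)‖ₑ * ‖m t‖ₑ = ‖m t‖ₑ := by
        intro t
        rw [lintegral_mul_const' _ _ enorm_ne_top,
          lintegral_sub_right_eq_self (fun y => ‖κ y‖ₑ) t,
          ← ofReal_integral_norm_eq_lintegral_enorm hκi]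
        have : ∫ y, ‖κ y‖ = 1 := by
          rw [← (b n).integral_normed (μ := volume)]
          refine integral_congr_ae (Filter.Eventually.of_forall fun y => ?_)
          exact Real.norm_of_nonneg ((b n).nonneg_normed y)
        rw [this]; simp
      simp_rw [h4]; exact le_rfl
    · exact (((hκs.continuous.comp
          (continuous_fst.sub continuous_snd)).enorm.measurable.aemeasurable).mul
        hm.1.comp_snd.enorm)
  have h5 := hbound.trans hint
  rw [← ofReal_integral_norm_eq_lintegral_enorm hm, ← ofReal_norm] at h5
  have h6 := (ENNReal.ofReal_le_ofReal_iff (integral_nonneg fun y => norm_nonneg _)).1 h5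
  simpa using h6

/-- Agmon's inequality on `H₀¹ ∩ H²`: no regularity of the boundary is needed. -/
theorem agmon (hΩ : IsOpen Ω) (hb : Bornology.IsBounded Ω) {v : VField Ω} (hv : v ∈ H01 Ω)
    {D : L2 Ω Ten} (hD : IsHessian v D) :
    ∀ᵐ x ∂(volume.restrict Ω), ‖(v.1 : Plane → Plane) x‖ ^ 2 ≤ 20 * (‖v.1‖ * ‖D‖) := by
  have hcomp : ∀ i : Fin 2, ∀ᵐ x ∂(volume.restrict Ω),
      ((v.1 : Plane → Plane) x i) ^ 2 ≤ 10 * (‖v.1‖ * ‖D‖) := by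
    intro i
    have m0 := memLp_vel i v
    have g0 := memLp_grad i 0 v
    have g1 := memLp_grad i 1 v
    have hh := memLp_hess ((i, 1), 0) D
    set u : Plane → ℝ := fun x => (v.1 : Plane → Plane) x i with hu
    set u0 : Plane → ℝ := fun x => (v.2 : Plane → Mat) x (i, 0) with hu0
    set u1 : Plane → ℝ := fun x => (v.2 : Plane → Mat) x (i, 1) with hu1
    set d : Plane → ℝ := fun x => (D : Plane → Ten) x ((i, 1), 0) with hd
    have iF : IntegrableOn (fun x => u x ^ 2) Ω := m0.integrable_sq
    have i1 : IntegrableOn (fun x => u0 x * u1 x) Ω := g0.integrable_mul g1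
    have i2 : IntegrableOn (fun x => d x * u x) Ω := hh.integrable_mul m0
    have im : IntegrableOn (fun x => 2 * (u0 x * u1 x + d x * u x)) Ω := (i1.add i2).const_mul 2
    have hmeas := hΩ.measurableSet
    have hcpt : HasCompactSupport (Ω.indicator fun x => u x ^ 2) := by
      refine HasCompactSupport.of_support_subset_isCompact hb.isCompact_closure ?_
      exact support_indicator_subset.trans subset_closure
    have hbd : ∀ ψ : Plane → ℝ, Continuous ψ → HasCompactSupport ψ → ∃ B, ∀ x, |ψ x| ≤ B := by
      intro ψ h1 h2
      obtain ⟨B, hB⟩ := h2.exists_bound_of_continuous h1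
      exact ⟨B, fun x => by simpa using hB x⟩
    have key := ae_le_of_weak_mixed (iF.integrable_indicator hmeas) hcpt
      (im.integrable_indicator hmeas) (fun ψ hψ hψc => by
        have hs0 := contDiff_partialD hψ 0
        have hc0 := hasCompactSupport_partialD hψc 0
        have hs1 := contDiff_partialD hs0 1
        have hc1 := hasCompactSupport_partialD hc0 1
        obtain ⟨B, hB⟩ := hbd ψ hψ.continuous hψc
        obtain ⟨B0, hB0⟩ := hbd _ hs0.continuous hc0
        obtain ⟨B1, hB1⟩ := hbd _ hs1.continuous hc1
        -- `u²` has the mixed weak derivative `2 (∂₀u ∂₁u + u ∂₀∂₁u)`; each factor `u` is moved by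
        -- the product rule in which `u` itself plays the role of the field in `H₀¹`
        have p1 := integral_product_rule hΩ m0 g1 (H01.isWeakPartial hv i 1) hv i hs0
          (B := max B0 B1) (fun x _ => (hB0 x).trans (le_max_left _ _))
          (fun x _ => (hB1 x).trans (le_max_right _ _))
        have p2 := integral_product_rule hΩ g1 hh (hD i 1 0) hv i hψ
          (B := max B B0) (fun x _ => (hB x).trans (le_max_left _ _))
          (fun x _ => (hB0 x).trans (le_max_right _ _))
        have e1 : ∀ x, Ω.indicator (fun x => u x ^ 2) x * partialD 1 (partialD 0 ψ) x =
            Ω.indicator (fun x => u x * partialD 1 (partialD 0 ψ) x * u x) x := by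
          intro x
          by_cases hx : x ∈ Ω
          · simp [hx]; ring
          · simp [hx]
        have e2 : ∀ x, Ω.indicator (fun x => 2 * (u0 x * u1 x + d x * u x)) x * ψ x =
            Ω.indicator (fun x => 2 * (u1 x * ψ x * u0 x) + 2 * (d x * ψ x * u x)) x := by
          intro x
          by_cases hx : x ∈ Ω
          · simp [hx]; ring
          · simp [hx]
        simp_rw [e1, e2]
        rw [integral_indicator hmeas, integral_indicator hmeas]
        have j1 : Integrable (fun x => u1 x * ψ x * u0 x) (volume.restrict Ω) :=
          (memLp_mul_of_bound hΩ g1 hψ.continuous fun x _ => hB x).integrable_mul g0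
        have j2 : Integrable (fun x => d x * ψ x * u x) (volume.restrict Ω) :=
          (memLp_mul_of_bound hΩ hh hψ.continuous fun x _ => hB x).integrable_mul m0
        rw [integral_add (j1.const_mul 2) (j2.const_mul 2), integral_const_mul,
          integral_const_mul]
        have e3 : ∫ x in Ω, u x * partialD 0 ψ x * u1 x = ∫ x in Ω, u1 x * partialD 0 ψ x * u x :=
            by
          congr 1; ext x; ring
        linarith)
    have hnorm : ∫ y, |Ω.indicator (fun x => 2 * (u0 x * u1 x + d x * u x)) y| ≤
        10 * (‖v.1‖ * ‖D‖) := by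
      have e4 : ∀ y, |Ω.indicator (fun x => 2 * (u0 x * u1 x + d x * u x)) y| =
          Ω.indicator (fun x => |2 * (u0 x * u1 x + d x * u x)|) y := by
        intro x
        by_cases hx : x ∈ Ω <;> simp [hx]
      simp_rw [e4]
      rw [integral_indicator hmeas]
      calc ∫ x in Ω, |2 * (u0 x * u1 x + d x * u x)|
          ≤ ∫ x in Ω, (2 * |u0 x * u1 x| + 2 * |d x * u x|) := by
            refine integral_mono im.abs ((i1.abs.const_mul 2).add (i2.abs.const_mul 2)) fun x => ?_
            simp only [abs_mul, abs_two]
            have := abs_add_le (u0 x * u1 x) (d x * u x)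
            rw [abs_mul, abs_mul] at this
            linarith
        _ = 2 * (∫ x in Ω, |u0 x * u1 x|) + 2 * ∫ x in Ω, |d x * u x| := by
            rw [integral_add (i1.abs.const_mul 2) (i2.abs.const_mul 2), integral_const_mul,
              integral_const_mul]
        _ ≤ 2 * (‖v.2‖ * ‖v.2‖) + 2 * (‖D‖ * ‖v.1‖) := by
            have k1 := integral_abs_mul_le g0 g1 (norm_nonneg v.2) (norm_nonneg v.2)
              (integral_sq_le_norm_sq v.2 _) (integral_sq_le_norm_sq v.2 _)
            have k2 := integral_abs_mul_le hh m0 (norm_nonneg D) (norm_nonneg v.1)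
              (integral_sq_le_norm_sq D _) (integral_sq_le_norm_sq v.1 _)
            linarith
        _ ≤ 10 * (‖v.1‖ * ‖D‖) := by
            have := norm_grad_sq_le hΩ hv hD
            nlinarith
    rw [ae_restrict_iff' hmeas]
    filter_upwards [key] with x hx hxΩ
    have := hx.trans hnorm
    simp only [hxΩ, indicator_of_mem, abs_pow, sq_abs] at this
    exact this
  filter_upwards [hcomp 0, hcomp 1] with x h0 h1
  rw [EuclideanSpace.real_norm_sq_eq, Fin.sum_univ_two]
  linarith

section

open scoped ENNReal

/-! ### Second differences of the zero extension -/

/-- The squared `L²`-norm of the first difference `f(· + y) - f`. -/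
noncomputable def diff1 (f : Plane → ℝ) (y : Plane) : ℝ≥0∞ := ∫⁻ x, ‖f (x + y) - f x‖ₑ ^ 2

/-- The squared `L²`-norm of the symmetric second difference `f(· + y) + f(· - y) - 2 f`. -/
noncomputable def diff2 (f : Plane → ℝ) (y : Plane) : ℝ≥0∞ :=
  ∫⁻ x, ‖f (x + y) + f (x - y) - 2 * f x‖ₑ ^ 2

theorem measurable_diff2 {f : Plane → ℝ} (hf : Measurable f) : Measurable (diff2 f) := by
  unfold diff2
  have : Measurable fun p : Plane × Plane =>
      ‖f (p.2 + p.1) + f (p.2 - p.1) - 2 * f p.2‖ₑ ^ 2 := by fun_prop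
  exact this.lintegral_prod_right'

theorem enorm_sq_eq_ofReal (r : ℝ) : ‖r‖ₑ ^ 2 = ENNReal.ofReal (r ^ 2) := by
  rw [← ofReal_norm, ← ENNReal.ofReal_pow (norm_nonneg _), Real.norm_eq_abs, sq_abs]

/-- The parallelogram law for differences: since translations are isometries, the second
difference at step `y` is the defect between the first differences at steps `y` and `2y`. -/
theorem diff2_add_diff1 {f : Plane → ℝ} (hf : Measurable f) (y : Plane) :
    diff2 f y + diff1 f ((2 : ℝ) • y) = 4 * diff1 f y := by
  have h1 : diff2 f y = ∫⁻ x, ‖(f (x + y + y) - f (x + y)) - (f (x + y) - f x)‖ₑ ^ 2 := by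
    rw [diff2, ← lintegral_add_right_eq_self _ y]
    refine lintegral_congr fun x => ?_
    congr 2
    rw [add_sub_cancel_right]; ring
  have h2 : diff1 f ((2 : ℝ) • y) =
      ∫⁻ x, ‖(f (x + y + y) - f (x + y)) + (f (x + y) - f x)‖ₑ ^ 2 := by
    refine lintegral_congr fun x => ?_
    congr 2
    rw [two_smul, add_assoc]; ring
  have hm : Measurable fun x => ‖f (x + y) - f x‖ₑ ^ 2 := by fun_prop
  rw [h1, h2, ← lintegral_add_left (by fun_prop)]
  have h3 : ∀ a b : ℝ, ‖a - b‖ₑ ^ 2 + ‖a + b‖ₑ ^ 2 = 2 * ‖a‖ₑ ^ 2 + 2 * ‖b‖ₑ ^ 2 := by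
    intro a b
    simp only [enorm_sq_eq_ofReal]
    rw [← ENNReal.ofReal_add (by positivity) (by positivity), ← ENNReal.ofReal_ofNat 2,
      ← ENNReal.ofReal_mul (by positivity), ← ENNReal.ofReal_mul (by positivity),
      ← ENNReal.ofReal_add (by positivity) (by positivity)]
    congr 1; ring
  simp_rw [h3]
  rw [lintegral_add_right _ (hm.const_mul 2), lintegral_const_mul _ hm,
    lintegral_const_mul _ (by fun_prop),
    lintegral_add_right_eq_self (fun x => ‖f (x + y) - f x‖ₑ ^ 2) y, diff1, ← add_mul]
  norm_num

/-- The square function estimate: over dyadic scales the second differences of a function with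
square integrable gradient are square summable, by telescoping the parallelogram law. -/
theorem sum_diff2_le {f : Plane → ℝ} (hf : Measurable f) {G : ℝ≥0∞}
    (hG : ∀ y, diff1 f y ≤ ‖y‖ₑ ^ 2 * G) (y : Plane) (n : ℕ) :
    ∑ k ∈ Finset.range n, 4 ^ k * diff2 f ((1 / 2 : ℝ) ^ k • y) ≤ 4 * (‖y‖ₑ ^ 2 * G) := by
  have key : ∀ n : ℕ, ∑ k ∈ Finset.range n, 4 ^ k * diff2 f ((1 / 2 : ℝ) ^ k • y) +
      diff1 f ((2 : ℝ) • y) = 4 ^ n * diff1 f ((2 : ℝ) • (1 / 2 : ℝ) ^ n • y) := by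
    intro n
    induction n with
    | zero => simp
    | succ n ih =>
      have e : (2 : ℝ) • (1 / 2 : ℝ) ^ (n + 1) • y = (1 / 2 : ℝ) ^ n • y := by
        rw [smul_smul]; congr 1; ring
      rw [Finset.sum_range_succ, add_right_comm, ih, e, ← mul_add, add_comm (diff1 _ _),
        diff2_add_diff1 hf, pow_succ, mul_assoc]
  refine (le_self_add.trans_eq (key n)).trans ?_
  refine (mul_le_mul_right (hG _) _).trans_eq ?_
  have e2 : (2 : ℝ) • (1 / 2 : ℝ) ^ n • y = (2 * (1 / 2 : ℝ) ^ n) • y := smul_smul _ _ _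
  rw [e2, enorm_smul, mul_pow, ← mul_assoc, ← mul_assoc, enorm_sq_eq_ofReal, ← mul_assoc]
  congr 2
  rw [← ENNReal.ofReal_ofNat 4, ← ENNReal.ofReal_pow (by positivity),
    ← ENNReal.ofReal_mul (by positivity)]
  congr 1
  rw [mul_pow, ← pow_mul, mul_comm n 2, pow_mul, mul_left_comm, ← mul_pow]
  norm_num

/-- The `i`-th component of a velocity field, extended by zero outside `Ω`. -/
noncomputable def ext0 (v : VField Ω) (i : Fin 2) : Plane → ℝ :=
  Ω.indicator fun x => (v.1 : Plane → Plane) x i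

theorem measurable_ext0 (hΩ : IsOpen Ω) (v : VField Ω) (i : Fin 2) : Measurable (ext0 v i) := by
  refine Measurable.indicator ?_ hΩ.measurableSet
  exact (EuclideanSpace.proj i : Plane →L[ℝ] ℝ).measurable.comp
    (Lp.stronglyMeasurable v.1).measurable

theorem enorm_sq_eq_lintegral {F : Type} [NormedAddCommGroup F] (f : L2 Ω F) :
    ‖f‖ₑ ^ 2 = ∫⁻ x in Ω, ‖(f : Plane → F) x‖ₑ ^ 2 := by
  rw [Lp.enorm_def]
  have := eLpNorm_nnreal_pow_eq_lintegral (f := (f : Plane → F)) (μ := volume.restrict Ω)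
    (p := 2) (by norm_num)
  simpa using this

theorem integrable_ext0 (hΩ : IsOpen Ω) (hb : Bornology.IsBounded Ω) (v : VField Ω) (i : Fin 2) :
    Integrable (ext0 v i) := by
  have : IsFiniteMeasure (volume.restrict Ω) := ⟨by simpa using hb.measure_lt_top⟩
  have h : IntegrableOn (fun x => (v.1 : Plane → Plane) x i) Ω :=
    (memLp_vel i v).integrable (by norm_num)
  exact h.integrable_indicator hΩ.measurableSet

theorem diff1_test_le {φ : Plane → Plane} (hφ : ContDiff ℝ ∞ φ) (i : Fin 2) (y : Plane) :
    diff1 (fun x => φ x i) y ≤ ‖y‖ₑ ^ 2 * ∫⁻ x, ‖jacobian φ x‖ₑ ^ 2 := by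
  have hφi : ContDiff ℝ ∞ fun x => φ x i :=
    (EuclideanSpace.proj i : Plane →L[ℝ] ℝ).contDiff.comp hφ
  have hJ : Continuous (jacobian φ) := (contDiff_jacobian hφ).continuous
  have hd : ∀ x : Plane, |fderiv ℝ (fun x => φ x i) x y| ≤ ‖y‖ * ‖jacobian φ x‖ := by
    intro x
    have e : fderiv ℝ (fun x => φ x i) x y =
        y 0 * jacobian φ x (i, 0) + y 1 * jacobian φ x (i, 1) := by
      have hy : y = y 0 • EuclideanSpace.single 0 (1 : ℝ) + y 1 • EuclideanSpace.single 1
          (1 : ℝ) := by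
        ext k; fin_cases k <;> simp
      conv_lhs => rw [hy]
      simp [jacobian, partialD]
    rw [e]
    refine abs_le_of_sq_le_sq ?_ (by positivity)
    rw [mul_pow, EuclideanSpace.real_norm_sq_eq, EuclideanSpace.real_norm_sq_eq,
      Fin.sum_univ_two, Fintype.sum_prod_type]
    have h1 : jacobian φ x (i, 0) ^ 2 + jacobian φ x (i, 1) ^ 2 ≤
        ∑ a : Fin 2, ∑ b : Fin 2, jacobian φ x (a, b) ^ 2 := by
      have := Finset.single_le_sum (f := fun a => ∑ b : Fin 2, jacobian φ x (a, b) ^ 2)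
        (fun a _ => Finset.sum_nonneg fun b _ => sq_nonneg _) (Finset.mem_univ i)
      simpa [Fin.sum_univ_two] using this
    refine le_trans ?_ (mul_le_mul_of_nonneg_left h1 (by positivity))
    nlinarith [sq_nonneg (y 0 * jacobian φ x (i, 1) - y 1 * jacobian φ x (i, 0))]
  have hpt : ∀ x : Plane, ‖φ (x + y) i - φ x i‖ₑ ^ 2 ≤
      ∫⁻ t in Icc (0 : ℝ) 1, ‖y‖ₑ ^ 2 * ‖jacobian φ (x + t • y)‖ₑ ^ 2 := by
    intro x
    have hder : ∀ t : ℝ, HasDerivAt (fun t : ℝ => φ (x + t • y) i)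
        (fderiv ℝ (fun x => φ x i) (x + t • y) y) t := by
      intro t
      have h1 := (hφi.differentiable (by simp) (x + t • y)).hasFDerivAt
      have h2 : HasDerivAt (fun t : ℝ => x + t • y) y t := by
        have := ((hasDerivAt_id t).smul_const y).const_add x
        rw [one_smul] at this
        exact this
      exact h1.comp_hasDerivAt t h2
    have hcd : Continuous fun t : ℝ => fderiv ℝ (fun x => φ x i) (x + t • y) y :=
      ((hφi.fderiv_right (m := ∞) (by simp)).continuous.comp (by fun_prop)).clm_apply
        continuous_const
    have hftc := intervalIntegral.integral_eq_sub_of_hasDerivAt (a := 0) (b := 1)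
      (fun t _ => hder t) (hcd.intervalIntegrable _ _)
    simp only [one_smul, zero_smul, add_zero] at hftc
    rw [← hftc, intervalIntegral.integral_of_le zero_le_one, ← integral_Icc_eq_integral_Ioc]
    have hprob : IsProbabilityMeasure (volume.restrict (Icc (0 : ℝ) 1)) := ⟨by simp⟩
    have hcs : (∫⁻ t in Icc (0 : ℝ) 1, ‖y‖ₑ * ‖jacobian φ (x + t • y)‖ₑ) ^ 2 ≤
        ∫⁻ t in Icc (0 : ℝ) 1, (‖y‖ₑ * ‖jacobian φ (x + t • y)‖ₑ) ^ 2 := by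
      have := ENNReal.lintegral_mul_le_Lp_mul_Lq (volume.restrict (Icc (0 : ℝ) 1))
        (p := 2) (q := 2) (by constructor <;> norm_num)
        (f := fun t => ‖y‖ₑ * ‖jacobian φ (x + t • y)‖ₑ) (g := fun _ => 1)
        (by fun_prop) (by fun_prop)
      simp only [Pi.mul_apply, mul_one, ENNReal.one_rpow, lintegral_const, measure_univ] at this
      calc _ ≤ ((∫⁻ t in Icc (0 : ℝ) 1,
            (‖y‖ₑ * ‖jacobian φ (x + t • y)‖ₑ) ^ (2 : ℝ)) ^ (1 / 2 : ℝ)) ^ 2 :=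
            pow_le_pow_left₀ (by positivity) this 2
        _ = _ := by
            rw [← ENNReal.rpow_natCast, ← ENNReal.rpow_mul]
            norm_num
    simp_rw [mul_pow] at hcs
    refine le_trans (pow_le_pow_left₀ (by positivity) ?_ 2) hcs
    refine (enorm_integral_le_lintegral_enorm _).trans (lintegral_mono fun t => ?_)
    rw [← ofReal_norm, ← ofReal_norm, ← ofReal_norm, ← ENNReal.ofReal_mul (norm_nonneg _)]
    exact ENNReal.ofReal_le_ofReal (by simpa using hd (x + t • y))
  refine (lintegral_mono hpt).trans ?_
  rw [lintegral_lintegral_swap (by fun_prop)]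
  have : ∀ t : ℝ, ∫⁻ x, ‖y‖ₑ ^ 2 * ‖jacobian φ (x + t • y)‖ₑ ^ 2 =
      ‖y‖ₑ ^ 2 * ∫⁻ x, ‖jacobian φ x‖ₑ ^ 2 := by
    intro t
    have hm : Measurable fun x => ‖jacobian φ (x + t • y)‖ₑ ^ 2 :=
      ((hJ.measurable.comp (measurable_add_const (t • y))).enorm).pow_const 2
    rw [lintegral_const_mul _ hm,
      lintegral_add_right_eq_self (fun x => ‖jacobian φ x‖ₑ ^ 2)]
  simp_rw [this]
  simp

theorem eLpNorm_two_sq {f : Plane → ℝ} {μ : Measure Plane} :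
    eLpNorm f 2 μ ^ 2 = ∫⁻ x, ‖f x‖ₑ ^ 2 ∂μ := by
  have := eLpNorm_nnreal_pow_eq_lintegral (f := f) (μ := μ) (p := 2) (by norm_num)
  simpa using this

/-- The zero extension of a field in `H₀¹` has first differences of order `‖y‖ ‖∇v‖`. -/
theorem diff1_ext0_le (hΩ : IsOpen Ω) {v : VField Ω} (hv : v ∈ H01 Ω) (i : Fin 2) (y : Plane) :
    diff1 (ext0 v i) y ≤ ‖y‖ₑ ^ 2 * ‖v.2‖ₑ ^ 2 := by
  have hcl : v ∈ closure (testFields Ω) := by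
    rw [← span_testFields]
    exact hv
  have hroot : ∀ w : VField Ω, diff1 (ext0 w i) y =
      eLpNorm (fun x => ext0 w i (x + y) - ext0 w i x) 2 volume ^ 2 := fun w =>
    eLpNorm_two_sq.symm
  have hshift : ∀ f : Plane → ℝ, Measurable f →
      eLpNorm (fun x => f (x + y) - f x) 2 volume ≤ 2 * eLpNorm f 2 volume := by
    intro f hf
    have h1 : eLpNorm (fun x => f (x + y)) 2 volume = eLpNorm f 2 volume :=
      eLpNorm_comp_measurePreserving (g := f) hf.aestronglyMeasurable
        (measurePreserving_add_right volume y)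
    refine (eLpNorm_sub_le (f := fun x => f (x + y))
      (hf.comp (measurable_add_const y)).aestronglyMeasurable hf.aestronglyMeasurable
      (by norm_num)).trans_eq ?_
    rw [h1, two_mul]
  have hext : ∀ w : VField Ω, eLpNorm (ext0 w i) 2 volume ≤ ‖w‖ₑ := by
    intro w
    rw [ext0, eLpNorm_indicator_eq_eLpNorm_restrict hΩ.measurableSet]
    refine le_trans ?_ (show ‖w.1‖ₑ ≤ ‖w‖ₑ from ?_)
    · rw [Lp.enorm_def]
      exact eLpNorm_mono fun x => PiLp.norm_apply_le ((w.1 : Plane → Plane) x) i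
    · rw [← ofReal_norm, ← ofReal_norm]
      exact ENNReal.ofReal_le_ofReal (norm_fst_le w)
  have htest : ∀ w ∈ testFields Ω,
      eLpNorm (fun x => ext0 w i (x + y) - ext0 w i x) 2 volume ≤ ‖y‖ₑ * ‖w.2‖ₑ := by
    rintro w ⟨φ, hφ, h1, h2⟩
    have hae : ext0 w i =ᵐ[volume] fun x => φ x i := by
      have h3 := (ae_restrict_iff' hΩ.measurableSet).1 h1
      filter_upwards [h3] with x hx
      by_cases hxΩ : x ∈ Ω
      · simp [ext0, hxΩ, hx hxΩ]
      · have : φ x = 0 := image_eq_zero_of_notMem_tsupport fun h => hxΩ (hφ.2.2 h)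
        simp [ext0, hxΩ, this]
    have hae' := (measurePreserving_add_right volume y).quasiMeasurePreserving.ae_eq_comp hae
    have e1 : eLpNorm (fun x => ext0 w i (x + y) - ext0 w i x) 2 volume =
        eLpNorm (fun x => φ (x + y) i - φ x i) 2 volume := by
      refine eLpNorm_congr_ae ?_
      filter_upwards [hae, hae'] with x hx hx'
      simp only [Function.comp] at hx'
      rw [hx, hx']
    have e2 : ∫⁻ x, ‖jacobian φ x‖ₑ ^ 2 = ‖w.2‖ₑ ^ 2 := by
      rw [enorm_sq_eq_lintegral, ← lintegral_indicator hΩ.measurableSet]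
      refine lintegral_congr_ae ?_
      filter_upwards [(ae_restrict_iff' hΩ.measurableSet).1 h2] with x hx
      by_cases hxΩ : x ∈ Ω
      · simp [hxΩ, hx hxΩ]
      · have : jacobian φ x = 0 := by
          ext p
          have h5 := (hφ.comp p.1).partialD p.2
          have : x ∉ tsupport (partialD p.2 fun x => φ x p.1) := fun h => hxΩ (h5.2.2 h)
          simpa [jacobian] using image_eq_zero_of_notMem_tsupport this
        simp [hxΩ, this]
    have h4 := diff1_test_le hφ.1 i y
    rw [e2, diff1, ← eLpNorm_two_sq, ← mul_pow] at h4
    rw [e1]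
    exact (ENNReal.pow_le_pow_left_iff two_ne_zero).1 h4
  rw [hroot, ← mul_pow]
  refine pow_le_pow_left₀ (by positivity) ?_ 2
  refine ENNReal.le_of_forall_pos_le_add fun ε hε _ => ?_
  obtain ⟨δ, hδ, hδε⟩ : ∃ δ : ℝ, 0 < δ ∧ (‖y‖ + 2) * δ ≤ ε :=
    ⟨ε / (‖y‖ + 2), by positivity, by rw [mul_div_cancel₀]; positivity⟩
  obtain ⟨w, hw, hd⟩ := Metric.mem_closure_iff.1 hcl δ hδ
  have hdn : ‖v - w‖ ≤ δ := by rw [← dist_eq_norm]; exact hd.le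
  have hsub : ∀ᵐ x ∂(volume : Measure Plane), ext0 v i x = ext0 w i x + ext0 (v - w) i x := by
    filter_upwards [(ae_restrict_iff' hΩ.measurableSet).1 (Lp.coeFn_sub v.1 w.1)] with x hx
    by_cases hxΩ : x ∈ Ω
    · have h3 : ((v - w).1 : Plane → Plane) x =
          (v.1 : Plane → Plane) x - (w.1 : Plane → Plane) x := hx hxΩ
      simp only [ext0, hxΩ, indicator_of_mem]
      rw [h3]
      simp
    · simp [ext0, hxΩ]
  have hsub' := (measurePreserving_add_right volume y).quasiMeasurePreserving.ae hsub
  have m1 := measurable_ext0 hΩ w i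
  have m2 := measurable_ext0 hΩ (v - w) i
  calc eLpNorm (fun x => ext0 v i (x + y) - ext0 v i x) 2 volume
      = eLpNorm ((fun x => ext0 w i (x + y) - ext0 w i x) +
          fun x => ext0 (v - w) i (x + y) - ext0 (v - w) i x) 2 volume := by
        refine eLpNorm_congr_ae ?_
        filter_upwards [hsub, hsub'] with x hx hx'
        simp only [Pi.add_apply]
        rw [hx, hx']; ring
    _ ≤ eLpNorm (fun x => ext0 w i (x + y) - ext0 w i x) 2 volume +
        eLpNorm (fun x => ext0 (v - w) i (x + y) - ext0 (v - w) i x) 2 volume :=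
        eLpNorm_add_le (by fun_prop) (by fun_prop) (by norm_num)
    _ ≤ ‖y‖ₑ * ‖w.2‖ₑ + 2 * ‖v - w‖ₑ :=
        add_le_add (htest w hw) ((hshift _ m2).trans (mul_le_mul_right (hext _) _))
    _ ≤ ‖y‖ₑ * ‖v.2‖ₑ + ε := by
        have h6 : ‖w.2‖ ≤ ‖v.2‖ + δ := by
          have : ‖w.2 - v.2‖ ≤ δ := by
            rw [norm_sub_rev]
            exact (norm_snd_le (v - w)).trans hdn
          linarith [norm_le_norm_add_norm_sub' w.2 v.2]
        have h7 : ‖y‖ * ‖w.2‖ + 2 * ‖v - w‖ ≤ ‖y‖ * ‖v.2‖ + ε := by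
          have := mul_le_mul_of_nonneg_left h6 (norm_nonneg y)
          linarith
        simp only [← ofReal_norm]
        rw [← ENNReal.ofReal_mul (norm_nonneg _), ← ENNReal.ofReal_mul (norm_nonneg _),
          two_mul, ← ENNReal.ofReal_add (by positivity) (by positivity), ← two_mul,
          ← ENNReal.ofReal_add (by positivity) (by positivity), ← ENNReal.ofReal_coe_nnreal,
          ← ENNReal.ofReal_add (by positivity) (by positivity)]
        exact ENNReal.ofReal_le_ofReal h7

/-! ### Leaving a Lipschitz domain by translation -/

/-- A segment that leaves a set meets its frontier. -/
theorem exists_frontier_dist_lt {s : Set Plane} {x z : Plane} (hx : x ∈ s) (hz : z ∉ s) {r : ℝ}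
    (hxz : dist x z < r) : ∃ p ∈ frontier s, dist x p < r := by
  have hseg : ∀ p ∈ segment ℝ x z, dist x p < r := by
    intro p hp
    have h := (convex_ball x r).segment_subset
      (Metric.mem_ball_self (dist_nonneg.trans_lt hxz)) (by rwa [Metric.mem_ball, dist_comm]) hp
    rwa [Metric.mem_ball, dist_comm] at h
  by_contra hcon
  push Not at hcon
  have hdis : ∀ p ∈ segment ℝ x z, p ∉ frontier s := fun p hp hpf =>
    absurd (hseg p hp) (not_lt.2 (hcon p hpf))
  have hpre : IsPreconnected (segment ℝ x z) := (convex_segment x z).isPreconnected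
  obtain ⟨p, -, hp1, hp2⟩ := hpre (interior s) (closure s)ᶜ isOpen_interior
    isClosed_closure.isOpen_compl
    (fun p hp => by
      by_cases h : p ∈ interior s
      · exact Or.inl h
      · exact Or.inr fun h' => hdis p hp ⟨h', h⟩)
    ⟨x, left_mem_segment ℝ x z, by
      by_contra h
      exact hdis x (left_mem_segment ℝ x z) ⟨subset_closure hx, h⟩⟩
    ⟨z, right_mem_segment ℝ x z, fun h =>
      hdis z (right_mem_segment ℝ x z) ⟨h, fun h' => hz (interior_subset h')⟩⟩
  exact hp2 (interior_subset_closure hp1)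

/-- In a bounded Lipschitz domain there are finitely many vectors such that each point at distance
at most `2η` from the complement leaves `Ω` when it is translated by `-ηy`, and also when it is
translated by `-2ηy`, for one of these vectors `y`. -/
theorem exists_exit_vectors (hb : Bornology.IsBounded Ω) (hlip : IsLipschitzDomain Ω) :
    ∃ (Y : Finset Plane) (η₀ : ℝ), 0 < η₀ ∧ ∀ η : ℝ, 0 < η → η ≤ η₀ → ∀ x ∈ Ω,
      Metric.infDist x Ωᶜ ≤ 2 * η → ∃ y ∈ Y, x - η • y ∉ Ω ∧ x - (2 * η) • y ∉ Ω := by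
  classical
  have hcomp : IsCompact (frontier Ω) := hb.isCompact_closure.of_isClosed_subset isClosed_frontier
    frontier_subset_closure
  have hne : (Ωᶜ).Nonempty := by
    by_contra h
    rw [not_nonempty_iff_eq_empty, compl_empty_iff] at h
    rw [h] at hb
    exact NormedSpace.unbounded_univ ℝ Plane hb
  choose! R g k r hr hg hΩ using hlip
  obtain ⟨t, ht, hcov⟩ := hcomp.elim_nhds_subcover (fun p => Metric.ball p (r p / 4))
    (fun p hp => Metric.ball_mem_nhds p (by have := hr p hp; positivity))
  obtain ⟨η₀, hη₀, hη₀'⟩ : ∃ η₀ : ℝ, 0 < η₀ ∧ ∀ p ∈ t, 24 * η₀ * (2 + k p) ≤ r p := by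
    have h1 : ∀ᶠ η in nhdsWithin (0 : ℝ) (Ioi 0), ∀ p ∈ t, 24 * η * (2 + k p) ≤ r p := by
      rw [Filter.eventually_all_finset]
      intro p hp
      have h2 : Filter.Tendsto (fun η : ℝ => 24 * η * (2 + (k p : ℝ))) (nhdsWithin 0 (Ioi 0))
          (nhds 0) := by
        have : Continuous fun η : ℝ => 24 * η * (2 + (k p : ℝ)) := by fun_prop
        have h3 := this.tendsto 0
        simp only [mul_zero, zero_mul] at h3
        exact h3.mono_left nhdsWithin_le_nhds
      exact (h2.eventually_lt_const (hr p (ht p hp))).mono fun η h => h.le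
    obtain ⟨η, h, hpos⟩ := (h1.and self_mem_nhdsWithin).exists
    exact ⟨η, hpos, h⟩
  let e : Plane := EuclideanSpace.single 1 1
  -- Within a chart of slope `k`, a point at distance less than `3η` from the complement lies at
  -- most `3η (1 + k)` above the graph, so a vertical step of length `η · 3 (1 + k)` takes it below;
  -- the smallness of `η₀` keeps both translates in the chart.
  refine ⟨t.image fun p => (3 * (1 + (k p : ℝ))) • (R p).symm e, η₀, hη₀, fun η hη hηη x hx hd =>
      ?_⟩
  obtain ⟨z, hz, hxz⟩ := (Metric.infDist_lt_iff (r := 3 * η) hne).1 (by linarith)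
  obtain ⟨q, hq, hxq⟩ := exists_frontier_dist_lt hx hz hxz
  obtain ⟨p, hp, hqp⟩ := mem_iUnion₂.1 (hcov hq)
  rw [Metric.mem_ball] at hqp
  have hk0 : (0 : ℝ) ≤ k p := (k p).2
  have hrp : 24 * η * (2 + k p) ≤ r p := by
    refine le_trans ?_ (hη₀' p hp)
    gcongr
  have hrpos := hr p (ht p hp)
  have hxp : dist x p < r p / 4 + 3 * η := by
    have := dist_triangle x q p
    linarith
  have hzp : z ∈ Metric.ball p (r p) := by
    have := dist_triangle_left z p x
    rw [Metric.mem_ball]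
    nlinarith
  have hzg : R p z 1 ≤ g p (R p z 0) := by
    by_contra h
    push Not at h
    exact hz ((hΩ p (ht p hp) z hzp).2 h)
  have hcoord : ∀ j : Fin 2, |R p x j - R p z j| ≤ dist x z := by
    intro j
    rw [← (R p).dist_map x z, dist_eq_norm]
    simpa using PiLp.norm_apply_le (R p x - R p z) j
  have hgx : R p x 1 - g p (R p x 0) ≤ 3 * η * (1 + k p) := by
    have h1 := (abs_le.1 (hcoord 1)).2
    have h2 : |g p (R p z 0) - g p (R p x 0)| ≤ k p * dist x z := by
      have := (hg p (ht p hp)).dist_le_mul (R p z 0) (R p x 0)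
      rw [Real.dist_eq, Real.dist_eq, abs_sub_comm (R p z 0)] at this
      exact this.trans (mul_le_mul_of_nonneg_left (hcoord 0) hk0)
    have h3 := (abs_le.1 h2).2
    have : k p * dist x z ≤ k p * (3 * η) := mul_le_mul_of_nonneg_left hxz.le hk0
    nlinarith
  have hout : ∀ c : ℝ, 1 ≤ c → c ≤ 2 →
      x - (c * η) • (3 * (1 + (k p : ℝ))) • (R p).symm e ∉ Ω := by
    intro c hc1 hc2 hmem
    set s : ℝ := c * η * (3 * (1 + k p)) with hs
    have hR : R p (x - (c * η) • (3 * (1 + (k p : ℝ))) • (R p).symm e) = R p x - s • e := by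
      rw [smul_smul, map_sub, map_smul, LinearIsometryEquiv.apply_symm_apply]
    have he : ‖(R p).symm e‖ = 1 := by simp [e]
    have hs0 : 0 ≤ s := by positivity
    have hs2 : s ≤ 2 * η * (3 * (1 + k p)) := by
      rw [hs]; gcongr
    have hs1 : 3 * η * (1 + k p) ≤ s := by
      have : 1 * η * (3 * (1 + k p)) ≤ s := by rw [hs]; gcongr
      linarith
    have hball : x - (c * η) • (3 * (1 + (k p : ℝ))) • (R p).symm e ∈ Metric.ball p (r p) := by
      rw [Metric.mem_ball, dist_eq_norm, smul_smul, sub_right_comm]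
      have h1 := norm_sub_le (x - p) (s • (R p).symm e)
      rw [norm_smul, he, mul_one, Real.norm_of_nonneg hs0] at h1
      rw [dist_eq_norm] at hxp
      nlinarith
    have h2 := (hΩ p (ht p hp) _ hball).1 hmem
    rw [hR] at h2
    simp only [PiLp.sub_apply, PiLp.smul_apply, e, PiLp.single_apply, smul_eq_mul] at h2
    norm_num at h2
    linarith
  refine ⟨_, Finset.mem_image_of_mem _ hp, ?_, hout 2 (by norm_num) le_rfl⟩
  simpa using hout 1 le_rfl (by norm_num)

/-! ### Mollification at a given scale -/

theorem enorm_sub_sq_le (a b : ℝ) : ‖a - b‖ₑ ^ 2 ≤ 2 * ‖a‖ₑ ^ 2 + 2 * ‖b‖ₑ ^ 2 := by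
  simp only [enorm_sq_eq_ofReal]
  rw [← ENNReal.ofReal_ofNat 2, ← ENNReal.ofReal_mul (by norm_num),
    ← ENNReal.ofReal_mul (by norm_num), ← ENNReal.ofReal_add (by positivity) (by positivity)]
  refine ENNReal.ofReal_le_ofReal ?_
  nlinarith [sq_nonneg (a + b)]

theorem sq_lintegral_mul_le {m F : Plane → ℝ≥0∞} (hm : Measurable m) (hF : Measurable F) :
    (∫⁻ s, m s * F s) ^ 2 ≤ (∫⁻ s, m s) * ∫⁻ s, m s * F s ^ 2 := by
  have h := ENNReal.lintegral_mul_le_Lp_mul_Lq volume (p := 2) (q := 2)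
    (by constructor <;> norm_num) (f := fun s => m s ^ (1 / 2 : ℝ))
    (g := fun s => m s ^ (1 / 2 : ℝ) * F s) (by fun_prop) (by fun_prop)
  have e1 : ∀ s, m s ^ (1 / 2 : ℝ) * (m s ^ (1 / 2 : ℝ) * F s) = m s * F s := by
    intro s
    rw [← mul_assoc, ← ENNReal.rpow_add_of_nonneg _ _ (by norm_num) (by norm_num)]
    norm_num
  have e2 : ∀ s, (m s ^ (1 / 2 : ℝ)) ^ (2 : ℝ) = m s := by
    intro s
    rw [← ENNReal.rpow_mul]; norm_num
  have e3 : ∀ a : ℝ≥0∞, (a ^ (1 / 2 : ℝ)) ^ 2 = a := by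
    intro a
    rw [← ENNReal.rpow_natCast, ← ENNReal.rpow_mul]; norm_num
  simp only [Pi.mul_apply, e1, e2, ENNReal.mul_rpow_of_nonneg _ _ (zero_le_two (α := ℝ)),
    ENNReal.rpow_ofNat] at h
  calc _ ≤ ((∫⁻ s, m s) ^ (1 / 2 : ℝ) * (∫⁻ s, m s * F s ^ 2) ^ (1 / 2 : ℝ)) ^ 2 :=
        pow_le_pow_left₀ (by positivity) h 2
    _ = _ := by rw [mul_pow, e3, e3]

theorem lintegral_enorm_integral_sq_le {κ : Plane → ℝ} (hκ : Measurable κ)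
    {F : Plane → Plane → ℝ} (hF : Measurable fun p : Plane × Plane => F p.1 p.2) :
    ∫⁻ x, ‖∫ s, κ s * F x s‖ₑ ^ 2 ≤ (∫⁻ s, ‖κ s‖ₑ) * ∫⁻ s, ‖κ s‖ₑ * ∫⁻ x, ‖F x s‖ₑ ^ 2 := by
  have hpt : ∀ x, ‖∫ s, κ s * F x s‖ₑ ^ 2 ≤ (∫⁻ s, ‖κ s‖ₑ) * ∫⁻ s, ‖κ s‖ₑ * ‖F x s‖ₑ ^ 2 := by
    intro x
    refine le_trans (pow_le_pow_left₀ (by positivity) (enorm_integral_le_lintegral_enorm _) 2) ?_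
    simp_rw [enorm_mul]
    exact sq_lintegral_mul_le hκ.enorm (hF.comp measurable_prodMk_left).enorm
  refine (lintegral_mono hpt).trans_eq ?_
  have hm : Measurable fun p : Plane × Plane => ‖κ p.2‖ₑ * ‖F p.1 p.2‖ₑ ^ 2 :=
    (hκ.comp measurable_snd).enorm.mul (hF.enorm.pow_const 2)
  rw [lintegral_const_mul _ hm.lintegral_prod_right', lintegral_lintegral_swap hm.aemeasurable]
  congr 1
  refine lintegral_congr fun s => ?_
  simp only
  rw [lintegral_const_mul]
  exact (hF.comp measurable_prodMk_right).enorm.pow_const 2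

/-- Young's inequality `‖κ * g‖₂ ≤ ‖κ‖₁ ‖g‖₂`. -/
theorem lintegral_moll_sq_le {κ g : Plane → ℝ} (hκ : Measurable κ) (hg : Measurable g) :
    ∫⁻ x, ‖moll κ g x‖ₑ ^ 2 ≤ (∫⁻ s, ‖κ s‖ₑ) ^ 2 * ∫⁻ x, ‖g x‖ₑ ^ 2 := by
  simp_rw [moll_eq_swap]
  refine (lintegral_enorm_integral_sq_le hκ (F := fun x s => g (x - s)) (by fun_prop)).trans_eq ?_
  have : ∀ s, ∫⁻ x, ‖g (x - s)‖ₑ ^ 2 = ∫⁻ x, ‖g x‖ₑ ^ 2 := fun s =>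
    lintegral_sub_right_eq_self (fun x => ‖g x‖ₑ ^ 2) s
  simp_rw [this]
  rw [lintegral_mul_const _ hκ.enorm, sq, mul_assoc]

/-- Convolution with an even kernel differs from a multiple of the identity by an average of
symmetric second differences. -/
theorem lintegral_moll_sub_sq_le {κ f : Plane → ℝ} (hκ : Continuous κ) (hκc : HasCompactSupport κ)
    (heven : ∀ s, κ (-s) = κ s) (hf : Measurable f) (hfi : Integrable f) :
    ∫⁻ x, ‖moll κ f x - (∫ s, κ s) * f x‖ₑ ^ 2 ≤
      (∫⁻ s, ‖κ s‖ₑ) * ∫⁻ s, ‖κ s‖ₑ * diff2 f s := by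
  obtain ⟨B, hB⟩ := hκc.exists_bound_of_continuous hκ
  have hi1 : ∀ x, Integrable fun s => κ s * f (x - s) := fun x =>
    (hfi.comp_sub_left x).bdd_mul hκ.aestronglyMeasurable (Filter.Eventually.of_forall hB)
  have hi2 : ∀ x, Integrable fun s => κ s * f (x + s) := fun x =>
    (hfi.comp_add_left x).bdd_mul hκ.aestronglyMeasurable (Filter.Eventually.of_forall hB)
  have hi3 : Integrable κ := hκ.integrable_of_hasCompactSupport hκc
  have hrep : ∀ x, moll κ f x - (∫ s, κ s) * f x =
      ∫ s, κ s * ((1 / 2 : ℝ) * (f (x + s) + f (x - s) - 2 * f x)) := by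
    intro x
    have e1 : ∫ s, κ s * f (x + s) = ∫ s, κ s * f (x - s) := by
      rw [← integral_neg_eq_self]
      simp_rw [heven, ← sub_eq_add_neg]
    have e2 : ∀ s, κ s * ((1 / 2 : ℝ) * (f (x + s) + f (x - s) - 2 * f x)) =
        ((1 / 2 : ℝ) * (κ s * f (x + s)) + (1 / 2 : ℝ) * (κ s * f (x - s))) - κ s * f x := by
      intro s; ring
    simp_rw [e2]
    have hi12 : Integrable fun s =>
        (1 / 2 : ℝ) * (κ s * f (x + s)) + (1 / 2 : ℝ) * (κ s * f (x - s)) :=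
      ((hi2 x).const_mul _).add ((hi1 x).const_mul _)
    rw [integral_sub hi12 (hi3.mul_const _),
      integral_add ((hi2 x).const_mul _) ((hi1 x).const_mul _), integral_const_mul,
      integral_const_mul, integral_mul_const, e1, moll_eq_swap]
    ring
  simp_rw [hrep]
  refine (lintegral_enorm_integral_sq_le hκ.measurable (by fun_prop)).trans ?_
  refine mul_le_mul_right (lintegral_mono fun s => mul_le_mul_right (lintegral_mono fun x => ?_) _)
      _
  rw [enorm_sq_eq_ofReal, enorm_sq_eq_ofReal]
  refine ENNReal.ofReal_le_ofReal ?_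
  rw [mul_pow]
  nlinarith [sq_nonneg (f (x + s) + f (x - s) - 2 * f x)]

/-- The kernel `κ` rescaled to width `η`, with the same integral. -/
noncomputable def dil (η : ℝ) (κ : Plane → ℝ) (x : Plane) : ℝ := (η ^ 2)⁻¹ * κ (η⁻¹ • x)

theorem contDiff_dil {κ : Plane → ℝ} (hκ : ContDiff ℝ ∞ κ) (η : ℝ) : ContDiff ℝ ∞ (dil η κ) :=
  contDiff_const.mul (hκ.comp (contDiff_const_smul _))

theorem hasCompactSupport_dil {κ : Plane → ℝ} (hκ : HasCompactSupport κ) {η : ℝ} (hη : 0 < η) :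
    HasCompactSupport (dil η κ) :=
  (hκ.comp_smul (inv_ne_zero hη.ne')).mul_left

theorem partialD_dil {κ : Plane → ℝ} (hκ : ContDiff ℝ ∞ κ) (η : ℝ) (j : Fin 2) :
    partialD j (dil η κ) = fun x => η⁻¹ * dil η (partialD j κ) x := by
  ext x
  have h1 : HasFDerivAt (fun x : Plane => η⁻¹ • x) (η⁻¹ • ContinuousLinearMap.id ℝ Plane) x :=
    (hasFDerivAt_id x).const_smul η⁻¹
  have h2 := ((hκ.differentiable (by simp) (η⁻¹ • x)).hasFDerivAt.comp x h1).const_mul (η ^ 2)⁻¹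
  have h3 : fderiv ℝ (dil η κ) x = (η ^ 2)⁻¹ •
    (fderiv ℝ κ (η⁻¹ • x)).comp (η⁻¹ • ContinuousLinearMap.id ℝ Plane) := h2.fderiv
  rw [partialD, h3]
  simp [dil, partialD]
  ring

theorem lintegral_dil {κ : Plane → ℝ} (hκ : Measurable κ) {Φ : Plane → ℝ≥0∞} (hΦ : Measurable Φ)
    {η : ℝ} (hη : 0 < η) :
    ∫⁻ s, ‖dil η κ s‖ₑ * Φ s = ∫⁻ s, ‖κ s‖ₑ * Φ (η • s) := by
  have hm : Measurable fun s => ‖κ (η⁻¹ • s)‖ₑ * Φ s :=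
    ((hκ.comp (measurable_const_smul _)).enorm).mul hΦ
  have h1 : ∫⁻ s, ‖κ (η⁻¹ • s)‖ₑ * Φ s ∂(Measure.map (η • ·) volume) =
      ∫⁻ s, ‖κ s‖ₑ * Φ (η • s) := by
    rw [lintegral_map hm (measurable_const_smul η)]
    simp_rw [smul_smul, inv_mul_cancel₀ hη.ne', one_smul]
  rw [← h1, Measure.map_addHaar_smul volume hη.ne', lintegral_smul_measure,
    smul_eq_mul, ← lintegral_const_mul _ hm]
  refine lintegral_congr fun s => ?_
  rw [dil, enorm_mul, mul_assoc]
  congr 1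
  rw [← ofReal_norm]
  congr 1
  simp

theorem integral_dil (κ : Plane → ℝ) {η : ℝ} (hη : 0 < η) : ∫ s, dil η κ s = ∫ s, κ s := by
  simp_rw [dil]
  rw [integral_const_mul, Measure.integral_comp_smul]
  simp only [finrank_euclideanSpace, Fintype.card_fin, smul_eq_mul]
  rw [abs_of_nonneg (by positivity), ← mul_assoc]
  have : (η ^ 2)⁻¹ * (η⁻¹ ^ 2)⁻¹ = 1 := by field_simp
  rw [this, one_mul]

theorem partialD_neg_arg {κ : Plane → ℝ} (hκ : ContDiff ℝ ∞ κ) (j : Fin 2) (c : ℝ)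
    (h : ∀ s, κ (-s) = c * κ s) (s : Plane) :
    partialD j κ (-s) = -(c * partialD j κ s) := by
  have h1 := (hκ.differentiable (by simp) (-s)).hasFDerivAt.comp s (hasFDerivAt_id s).neg
  have h2 : HasFDerivAt (fun s => c * κ s) (c • fderiv ℝ κ s) s :=
    (hκ.differentiable (by simp) s).hasFDerivAt.const_mul c
  have h3 : (κ ∘ fun s => -s) = fun s => c * κ s := funext h
  have h4 : HasFDerivAt (fun s => c * κ s) ((fderiv ℝ κ (-s)).comp
    (-(ContinuousLinearMap.id ℝ Plane))) s := by rw [← h3]; exact h1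
  have h5 := congrArg (fun l : Plane →L[ℝ] ℝ => l (EuclideanSpace.single j 1)) (h2.unique h4)
  simp only [FunLike.coe_smul, Pi.smul_apply, smul_eq_mul, ContinuousLinearMap.comp_apply,
    neg_apply, ContinuousLinearMap.id_apply, map_neg] at h5
  simp only [partialD]
  linarith

theorem integral_partialD_eq_zero {κ : Plane → ℝ} (hκ : ContDiff ℝ ∞ κ)
    (hκc : HasCompactSupport κ) (j : Fin 2) : ∫ s, partialD j κ s = 0 := by
  have h := integral_mul_fderiv_eq_neg_fderiv_mul_of_integrable (μ := (volume : Measure Plane))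
    (f := fun _ : Plane => (1 : ℝ)) (g := κ) (v := EuclideanSpace.single j 1)
    (by simp)
    (by
      simp only [one_mul]
      exact (contDiff_partialD hκ j).continuous.integrable_of_hasCompactSupport
        (hasCompactSupport_partialD hκc j))
    (by simpa using hκ.continuous.integrable_of_hasCompactSupport hκc)
    (fun x _ => differentiableAt_const _) (fun x _ => hκ.differentiable (by simp) x)
  simpa [partialD] using h

/-- Error of mollifying `g` at scale `η`, in terms of the second differences of `f` and of the
`L²`-distance of `f` and `g`. -/
theorem lintegral_moll_dil_le {κ f g : Plane → ℝ} (hκ : ContDiff ℝ ∞ κ) (hκc : HasCompactSupport κ)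
    (heven : ∀ s, κ (-s) = κ s) (hf : Measurable f) (hfi : Integrable f) (hg : Measurable g)
    (hgi : Integrable g) {η : ℝ} (hη : 0 < η) :
    ∫⁻ x, ‖moll (dil η κ) g x - (∫ s, κ s) * f x‖ₑ ^ 2 ≤
      2 * ((∫⁻ s, ‖κ s‖ₑ) * ∫⁻ s, ‖κ s‖ₑ * diff2 f (η • s)) +
      2 * ((∫⁻ s, ‖κ s‖ₑ) ^ 2 * ∫⁻ x, ‖f x - g x‖ₑ ^ 2) := by
  have hs := contDiff_dil hκ η
  have hc := hasCompactSupport_dil hκc hη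
  have h1 := lintegral_moll_sub_sq_le hs.continuous hc (fun s => by simp [dil, heven]) hf hfi
  have h2 := lintegral_moll_sq_le (g := fun x => f x - g x) hs.continuous.measurable (hf.sub hg)
  have e1 : ∫⁻ s, ‖dil η κ s‖ₑ = ∫⁻ s, ‖κ s‖ₑ := by
    simpa using lintegral_dil hκ.continuous.measurable (Φ := fun _ => 1) measurable_const hη
  rw [lintegral_dil hκ.continuous.measurable (measurable_diff2 hf) hη, e1, integral_dil κ hη] at h1
  rw [e1] at h2
  obtain ⟨B, hB⟩ := hc.exists_bound_of_continuous hs.continuous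
  have hi : ∀ (u : Plane → ℝ), Integrable u → ∀ x, Integrable fun t => dil η κ (x - t) * u t :=
    fun u hu x => hu.bdd_mul (hs.continuous.comp (continuous_const.sub
      continuous_id)).aestronglyMeasurable (Filter.Eventually.of_forall fun t => hB _)
  have hsub : ∀ x, moll (dil η κ) g x =
      moll (dil η κ) f x - moll (dil η κ) (fun x => f x - g x) x := by
    intro x
    simp only [moll]
    rw [← integral_sub (hi f hfi x) (hi (fun x => f x - g x) (hfi.sub hgi) x)]
    congr 1; ext t; ring
  have hmf : Measurable (moll (dil η κ) f) :=
      (contDiff_moll hs hc hfi.locallyIntegrable).continuous.measurable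
  refine le_trans (lintegral_mono (g := fun x =>
    2 * ‖moll (dil η κ) f x - (∫ s, κ s) * f x‖ₑ ^ 2 +
    2 * ‖moll (dil η κ) (fun x => f x - g x) x‖ₑ ^ 2) fun x => ?_) ?_
  · rw [hsub, sub_right_comm]
    exact enorm_sub_sq_le _ _
  · have hm : Measurable fun x => ‖moll (dil η κ) f x - (∫ s, κ s) * f x‖ₑ ^ 2 :=
      ((hmf.sub (hf.const_mul _)).enorm).pow_const 2
    have hm2 : Measurable fun x => ‖moll (dil η κ) (fun x => f x - g x) x‖ₑ ^ 2 :=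
      ((contDiff_moll hs hc (hfi.sub hgi).locallyIntegrable).continuous.measurable.enorm).pow_const
          2
    rw [lintegral_add_left (hm.const_mul 2), lintegral_const_mul _ hm, lintegral_const_mul _ hm2]
    exact add_le_add (mul_le_mul_right h1 _) (mul_le_mul_right h2 _)

/-! ### Approximation of `H₀¹` by `H₀¹ ∩ H²` along dyadic scales -/

/-- A test function belongs to `H₀¹ ∩ H²`, with its classical second derivatives. -/
theorem exists_mem_H2_of_isTest {φ : Plane → Plane} (hφ : IsTest Ω φ) :
    ∃ p ∈ H2 Ω, (p.1.1 : Plane → Plane) =ᵐ[volume.restrict Ω] φ ∧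
      ∀ i j k : Fin 2, (fun x => (p.2 : Plane → Ten) x ((i, j), k)) =ᵐ[volume.restrict Ω]
        partialD k (partialD j fun y => φ y i) := by
  obtain ⟨v, hv, hv1, hv2⟩ := exists_testField hφ
  set h : Plane → Ten := fun x =>
    WithLp.toLp 2 fun q => partialD q.2 (partialD q.1.2 fun y => φ y q.1.1) x with hh
  have hcomp : ∀ q : (Fin 2 × Fin 2) × Fin 2,
      IsTest Ω (partialD q.2 (partialD q.1.2 fun y => φ y q.1.1)) := fun q =>
    ((hφ.comp q.1.1).partialD q.1.2).partialD q.2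
  have hm : MemLp h 2 (volume.restrict Ω) := by
    have h1 : ContDiff ℝ ∞ h := contDiff_euclidean.2 fun q => (hcomp q).1
    have h2 : HasCompactSupport h := by
      refine HasCompactSupport.intro (isCompact_iUnion fun q => (hcomp q).2.1) fun x hx => ?_
      ext q
      have : x ∉ tsupport (partialD q.2 (partialD q.1.2 fun y => φ y q.1.1)) := fun h' =>
        hx (mem_iUnion.2 ⟨q, h'⟩)
      simpa [hh] using image_eq_zero_of_notMem_tsupport this
    exact (h1.continuous.memLp_of_hasCompactSupport h2).restrict Ω
  have hDae : ∀ i j k : Fin 2, (fun x => (hm.toLp : Plane → Ten) x ((i, j), k))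
      =ᵐ[volume.restrict Ω] partialD k (partialD j fun y => φ y i) := by
    intro i j k
    filter_upwards [hm.coeFn_toLp] with x hx
    rw [hx]
  refine ⟨(v, hm.toLp), ⟨Submodule.le_topologicalClosure _ (Submodule.subset_span hv), ?_⟩, hv1,
      hDae⟩
  intro i j k
  -- the derivative of a test function is a test function, so its gradient is a weak gradient
  set Φ : Plane → Plane := fun x => WithLp.toLp 2 fun a => partialD j (fun y => φ y a) x with hΦ
  have hΦt : IsTest Ω Φ := by
    have hc : ∀ a : Fin 2, IsTest Ω (partialD j fun y => φ y a) := fun a => (hφ.comp a).partialD j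
    have hs : Function.support Φ ⊆ ⋃ a, tsupport (partialD j fun y => φ y a) := by
      intro x hx
      by_contra hcon
      refine hx ?_
      ext a
      have : x ∉ tsupport (partialD j fun y => φ y a) := fun h' => hcon (mem_iUnion.2 ⟨a, h'⟩)
      simpa [hΦ] using image_eq_zero_of_notMem_tsupport this
    have hcpt : IsCompact (⋃ a, tsupport (partialD j fun y => φ y a)) :=
      isCompact_iUnion fun a => (hc a).2.1
    exact ⟨contDiff_euclidean.2 fun a => (hc a).1, HasCompactSupport.of_support_subset_isCompact
        hcpt hs,
      (closure_minimal hs hcpt.isClosed).trans (iUnion_subset fun a => (hc a).2.2)⟩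
  obtain ⟨w, hw, hw1, hw2⟩ := exists_testField hΦt
  have hw' : w ∈ H01 Ω := Submodule.le_topologicalClosure _ (Submodule.subset_span hw)
  intro ψ hψ
  have key := H01.isWeakPartial hw' i k ψ hψ
  have e1 : ∫ x in Ω, (v.2 : Plane → Mat) x (i, j) * partialD k ψ x =
      ∫ x in Ω, (w.1 : Plane → Plane) x i * partialD k ψ x := by
    refine integral_congr_ae ?_
    filter_upwards [hv2, hw1] with x h1 h2
    rw [h1, h2]
    rfl
  have e2 : ∫ x in Ω, (hm.toLp : Plane → Ten) x ((i, j), k) * ψ x =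
      ∫ x in Ω, (w.2 : Plane → Mat) x (i, k) * ψ x := by
    refine integral_congr_ae ?_
    filter_upwards [hDae i j k, hw2] with x h1 h2
    rw [h1, h2]
    rfl
  rw [e1, e2]
  exact key

theorem enorm_sq_eq_sum {ι : Type} [Fintype ι] (f : L2 Ω (EuclideanSpace ℝ ι)) :
    ‖f‖ₑ ^ 2 = ∑ i, ∫⁻ x in Ω, ‖(f : Plane → EuclideanSpace ℝ ι) x i‖ₑ ^ 2 := by
  have hm : ∀ i, Measurable fun x => ‖(f : Plane → EuclideanSpace ℝ ι) x i‖ₑ ^ 2 := fun i =>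
    (((EuclideanSpace.proj i : EuclideanSpace ℝ ι →L[ℝ] ℝ).measurable.comp
      (Lp.stronglyMeasurable f).measurable).enorm).pow_const 2
  rw [enorm_sq_eq_lintegral, ← lintegral_finsetSum _ fun i _ => hm i]
  refine lintegral_congr fun x => ?_
  simp only [enorm_sq_eq_ofReal]
  rw [← ofReal_norm, ← ENNReal.ofReal_pow (norm_nonneg _), EuclideanSpace.real_norm_sq_eq,
    ENNReal.ofReal_sum_of_nonneg fun i _ => sq_nonneg _]

theorem partialD_const_mul {κ : Plane → ℝ} (hκ : ContDiff ℝ ∞ κ) (c : ℝ) (j : Fin 2) :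
    partialD j (fun x => c * κ x) = fun x => c * partialD j κ x := by
  ext x
  have := ((hκ.differentiable (by simp) x).hasFDerivAt.const_mul c).fderiv
  simp [partialD, this]

theorem moll_const_mul (κ g : Plane → ℝ) (c : ℝ) :
    moll (fun x => c * κ x) g = fun x => c * moll κ g x := by
  ext x
  simp only [moll, mul_assoc]
  exact integral_const_mul _ _

theorem partialD_partialD_moll_dil {κ g : Plane → ℝ} (hκ : ContDiff ℝ ∞ κ)
    (hκc : HasCompactSupport κ) (hg : Integrable g) {η : ℝ} (hη : 0 < η) (j k : Fin 2) :
    partialD k (partialD j (moll (dil η κ) g)) =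
      fun x => (η⁻¹) ^ 2 * moll (dil η (partialD k (partialD j κ))) g x := by
  have h1 := contDiff_partialD hκ j
  have h2 := hasCompactSupport_partialD hκc j
  rw [partialD_moll (contDiff_dil hκ η) (hasCompactSupport_dil hκc hη) hg.locallyIntegrable,
    partialD_dil hκ, moll_const_mul,
    partialD_const_mul (contDiff_moll (contDiff_dil h1 η) (hasCompactSupport_dil h2 hη)
      hg.locallyIntegrable),
    partialD_moll (contDiff_dil h1 η) (hasCompactSupport_dil h2 hη) hg.locallyIntegrable,
    partialD_dil h1, moll_const_mul]
  ext x
  ring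

/-- An even smoothing kernel of mass one, supported in the unit ball. -/
theorem exists_even_kernel : ∃ ρ : Plane → ℝ, ContDiff ℝ ∞ ρ ∧ HasCompactSupport ρ ∧
    (∀ s, ρ (-s) = ρ s) ∧ ∫ s, ρ s = 1 ∧ ∀ s, 1 ≤ ‖s‖ → ρ s = 0 := by
  let b : ContDiffBump (0 : Plane) := ⟨1 / 2, 1, by norm_num, by norm_num⟩
  let ρ : Plane → ℝ := b.normed volume
  have hρs : ContDiff ℝ ∞ ρ := b.contDiff_normed
  have hρc : HasCompactSupport ρ := b.hasCompactSupport_normed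
  have hρe : ∀ s, ρ (-s) = ρ s := fun s => b.normed_neg s
  have hρ1 : ∫ s, ρ s = 1 := b.integral_normed
  have hρsupp : ∀ s, 1 ≤ ‖s‖ → ρ s = 0 := by
    intro s hs
    have h1 : Function.support ρ = Metric.ball 0 1 := b.support_normed_eq
    by_contra h
    have : s ∈ Metric.ball (0 : Plane) 1 := by rw [← h1]; exact h
    rw [mem_ball_zero_iff] at this
    linarith
  exact ⟨ρ, hρs, hρc, hρe, hρ1, hρsupp⟩

/-- An integrable density with finite second moment that dominates a kernel and its second
derivatives. -/
theorem exists_dominating_density {ρ : Plane → ℝ} {ρ' : Fin 2 → Fin 2 → Plane → ℝ}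
    (hρs : Continuous ρ) (hρc : HasCompactSupport ρ) (hρ's : ∀ j k, Continuous (ρ' j k))
    (hρ'c : ∀ j k, HasCompactSupport (ρ' j k)) :
    ∃ m : Plane → ℝ≥0∞, Measurable m ∧ ∫⁻ s, m s ≠ ⊤ ∧ ∫⁻ s, m s * ‖s‖ₑ ^ 2 ≠ ⊤ ∧
      (∀ s, ‖ρ s‖ₑ ≤ m s) ∧ ∀ j k s, ‖ρ' j k s‖ₑ ≤ m s := by
  set M : Plane → ℝ := fun s => ‖ρ s‖ + ((‖ρ' 0 0 s‖ + ‖ρ' 0 1 s‖) +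
    (‖ρ' 1 0 s‖ + ‖ρ' 1 1 s‖)) with hM
  have hMs : Continuous M := hρs.norm.add (((hρ's 0 0).norm.add (hρ's 0 1).norm).add
    ((hρ's 1 0).norm.add (hρ's 1 1).norm))
  have hMc : HasCompactSupport M := hρc.norm.add (((hρ'c 0 0).norm.add (hρ'c 0 1).norm).add
    ((hρ'c 1 0).norm.add (hρ'c 1 1).norm))
  have hM0 : ∀ s, 0 ≤ M s := fun s => by positivity
  have hle : ∀ (s : Plane) (c : ℝ), ‖c‖ ≤ M s → ‖c‖ₑ ≤ ‖M s‖ₑ := fun s c h => by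
    rw [enorm_le_iff_norm_le, Real.norm_of_nonneg (hM0 s)]
    exact h
  refine ⟨fun s => ‖M s‖ₑ, hMs.measurable.enorm,
    (hMs.integrable_of_hasCompactSupport hMc).2.ne, ?_, fun s => hle s _ ?_,
    fun j k s => hle s _ ?_⟩
  · have h1 : Continuous fun s : Plane => M s * ‖s‖ ^ 2 := by fun_prop
    have h2 : HasCompactSupport fun s : Plane => M s * ‖s‖ ^ 2 := hMc.mul_right
    refine ne_of_eq_of_ne (lintegral_congr fun s => ?_)
      (h1.integrable_of_hasCompactSupport h2).2.ne
    rw [enorm_mul, enorm_pow, enorm_norm]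
  · rw [hM]
    exact le_add_of_nonneg_right (by positivity)
  · have := norm_nonneg (ρ s)
    have := norm_nonneg (ρ' 0 0 s)
    have := norm_nonneg (ρ' 0 1 s)
    have := norm_nonneg (ρ' 1 0 s)
    have := norm_nonneg (ρ' 1 1 s)
    fin_cases j <;> fin_cases k <;> simp only [hM, Fin.zero_eta, Fin.mk_one] <;> linarith

/-- The part of a field in a boundary strip is controlled by second differences, since two steps
along the exit vectors leave the domain. -/
theorem lintegral_strip_le {Y : Finset Plane} {η : ℝ} {f : Plane → ℝ} (hf' : Measurable f)
    (hf : ∀ x, x ∉ Ω → f x = 0) {S : Set Plane}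
    (hY : ∀ x ∈ Ω, x ∉ S → ∃ y ∈ Y, x - η • y ∉ Ω ∧ x - (2 * η) • y ∉ Ω) :
    ∫⁻ x, ‖f x - S.indicator f x‖ₑ ^ 2 ≤ ∑ y ∈ Y, diff2 f (η • y) := by
  have hpt : ∀ x, ‖f x - S.indicator f x‖ₑ ^ 2 ≤ ∑ y ∈ Y,
      ‖f (x - η • y + η • y) + f (x - η • y - η • y) - 2 * f (x - η • y)‖ₑ ^ 2 := by
    intro x
    by_cases hx : x ∈ Ω ∧ x ∉ S
    · obtain ⟨y, hyY, hy1, hy2⟩ := hY x hx.1 hx.2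
      refine le_trans (le_of_eq ?_) (Finset.single_le_sum (f := fun y =>
        ‖f (x - η • y + η • y) + f (x - η • y - η • y) - 2 * f (x - η • y)‖ₑ ^ 2)
        (fun _ _ => by positivity) hyY)
      have e1 : S.indicator f x = 0 := by simp [hx.2]
      have e2 : f (x - η • y) = 0 := by simp [hf, hy1]
      have e3 : f (x - η • y - η • y) = 0 := by
        rw [sub_sub, ← two_smul ℝ, smul_smul]
        simp [hf, hy2]
      rw [e1, e2, e3, sub_add_cancel]
      simp
    · have : f x - S.indicator f x = 0 := by
        by_cases hxS : x ∈ S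
        · simp [hxS]
        · have hxΩ : x ∉ Ω := fun h => hx ⟨h, hxS⟩
          simp [hxS, hf, hxΩ]
      rw [this]; simp
  refine (lintegral_mono hpt).trans ?_
  rw [lintegral_finsetSum _ fun y _ => by fun_prop]
  refine Finset.sum_le_sum fun y _ => le_of_eq ?_
  exact lintegral_sub_right_eq_self
    (fun x => ‖f (x + η • y) + f (x - η • y) - 2 * f x‖ₑ ^ 2) (η • y)

/-- Approximation of a field at scale `η` by a field in `H₀¹ ∩ H²`: the field is set to zero near
the boundary and mollified. The error and the size of the second derivatives are controlled by
second differences of the zero extension, averaged over a fixed measure. -/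
theorem exists_smoothing (hΩ : IsOpen Ω) (hb : Bornology.IsBounded Ω)
    (hlip : IsLipschitzDomain Ω) :
    ∃ (ν : Measure Plane) (η₀ : ℝ), 0 < η₀ ∧ ∫⁻ s, ‖s‖ₑ ^ 2 ∂ν ≠ ⊤ ∧
      ∀ v : VField Ω, ∀ η : ℝ, 0 < η → η ≤ η₀ → ∃ p ∈ H2 Ω,
        ‖v.1 - p.1.1‖ₑ ^ 2 + ENNReal.ofReal (η ^ 4) * ‖p.2‖ₑ ^ 2 ≤
          5 * ∑ i, ∫⁻ s, diff2 (ext0 v i) (η • s) ∂ν := by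
  obtain ⟨Y, η₀, hη₀, hY⟩ := exists_exit_vectors hb hlip
  obtain ⟨ρ, hρs, hρc, hρe, hρ1, hρsupp⟩ := exists_even_kernel
  set ρ' : Fin 2 → Fin 2 → Plane → ℝ := fun j k => partialD k (partialD j ρ) with hρ'
  have hρ's : ∀ j k, ContDiff ℝ ∞ (ρ' j k) := fun j k => contDiff_partialD
      (contDiff_partialD hρs j) k
  have hρ'c : ∀ j k, HasCompactSupport (ρ' j k) := fun j k =>
    hasCompactSupport_partialD (hasCompactSupport_partialD hρc j) k
  have hρ'e : ∀ j k s, ρ' j k (-s) = ρ' j k s := by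
    intro j k s
    have h1 : ∀ s, partialD j ρ (-s) = (-1) * partialD j ρ s := fun s => by
      have := partialD_neg_arg hρs j 1 (fun s => by rw [hρe, one_mul]) s
      rw [this]; ring
    have := partialD_neg_arg (contDiff_partialD hρs j) k (-1) h1 s
    simp only [hρ']
    rw [this]; ring
  have hρ'0 : ∀ j k, ∫ s, ρ' j k s = 0 := fun j k =>
    integral_partialD_eq_zero (contDiff_partialD hρs j) (hasCompactSupport_partialD hρc j) k
  obtain ⟨m, hmm, hAfin, hm2, hρm, hρ'm⟩ := exists_dominating_density hρs.continuous hρc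
    (fun j k => (hρ's j k).continuous) hρ'c
  set A : ℝ≥0∞ := ∫⁻ s, m s with hA
  set ν : Measure Plane := (2 * A) • volume.withDensity m +
    (2 * A ^ 2) • ∑ y ∈ Y, Measure.dirac y with hν
  have hνint : ∀ Φ : Plane → ℝ≥0∞, Measurable Φ → ∫⁻ s, Φ s ∂ν =
      2 * A * (∫⁻ s, m s * Φ s) + 2 * A ^ 2 * ∑ y ∈ Y, Φ y := by
    intro Φ hΦ
    rw [hν, lintegral_add_measure, lintegral_smul_measure, lintegral_smul_measure,
      lintegral_withDensity_eq_lintegral_mul _ hmm hΦ, lintegral_finsetSum_measure]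
    simp_rw [lintegral_dirac' _ hΦ, smul_eq_mul, Pi.mul_apply]
  refine ⟨ν, η₀, hη₀, ?_, fun v η hη hηη => ?_⟩
  · rw [hνint _ (measurable_enorm.pow_const 2)]
    refine ENNReal.add_ne_top.2
        ⟨ENNReal.mul_ne_top (ENNReal.mul_ne_top ENNReal.ofNat_ne_top hAfin) hm2,
      ENNReal.mul_ne_top (ENNReal.mul_ne_top ENNReal.ofNat_ne_top (ENNReal.pow_ne_top hAfin)) ?_⟩
    exact ENNReal.sum_ne_top.2 fun y _ => ENNReal.pow_ne_top enorm_ne_top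
  -- the truncated field, supported at distance `2η` from the boundary
  set S : Set Plane := {x | 2 * η < Metric.infDist x Ωᶜ} with hS
  have hSm : MeasurableSet S := measurableSet_lt measurable_const
      (Metric.continuous_infDist_pt _).measurable
  set g : Fin 2 → Plane → ℝ := fun i => S.indicator (ext0 v i) with hg
  have hfm := fun i => measurable_ext0 hΩ v i
  have hfi := fun i => integrable_ext0 hΩ hb v i
  have hgm : ∀ i, Measurable (g i) := fun i => (hfm i).indicator hSm
  have hgi : ∀ i, Integrable (g i) := fun i => (hfi i).indicator hSm
  have hstrip : ∀ i, ∫⁻ x, ‖ext0 v i x - g i x‖ₑ ^ 2 ≤ ∑ y ∈ Y, diff2 (ext0 v i) (η • y) :=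
    fun i => lintegral_strip_le (hfm i) (fun x hx => by simp [ext0, hx])
      fun x hx hxS => hY η hη hηη x hx (not_lt.1 hxS)
  have hkernel : ∀ (i : Fin 2) (κ : Plane → ℝ), ContDiff ℝ ∞ κ → HasCompactSupport κ →
      (∀ s, κ (-s) = κ s) → (∀ s, ‖κ s‖ₑ ≤ m s) →
      ∫⁻ x, ‖moll (dil η κ) (g i) x - (∫ s, κ s) * ext0 v i x‖ₑ ^ 2 ≤
        ∫⁻ s, diff2 (ext0 v i) (η • s) ∂ν := by
    intro i κ h1 h2 h3 h4
    have hmeas : Measurable fun s => diff2 (ext0 v i) (η • s) :=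
      (measurable_diff2 (hfm i)).comp (measurable_const_smul η)
    refine (lintegral_moll_dil_le h1 h2 h3 (hfm i) (hfi i) (hgm i) (hgi i) hη).trans ?_
    rw [hνint _ hmeas, mul_assoc, mul_assoc]
    have h5 : ∫⁻ s, ‖κ s‖ₑ ≤ A := lintegral_mono h4
    refine add_le_add (mul_le_mul_right (mul_le_mul h5 ?_ (by positivity) (by positivity)) _)
      (mul_le_mul_right (mul_le_mul (pow_le_pow_left₀ (by positivity) h5 2) (hstrip i)
        (by positivity) (by positivity)) _)
    exact lintegral_mono fun s => mul_le_mul_left (h4 s) _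
  -- the mollified field
  set φ : Plane → Plane := fun x => WithLp.toLp 2 fun i => moll (dil η ρ) (g i) x with hφ
  have hφt : IsTest Ω φ := by
    set K : Set Plane := {x | η ≤ Metric.infDist x Ωᶜ} with hK
    have hKΩ : K ⊆ Ω := by
      intro x hx
      by_contra hxΩ
      have : Metric.infDist x Ωᶜ = 0 := Metric.infDist_zero_of_mem hxΩ
      simp only [hK, mem_ofPred_eq, this] at hx
      linarith
    have hKc : IsCompact K :=
      Metric.isCompact_of_isClosed_isBounded
        (isClosed_le continuous_const (Metric.continuous_infDist_pt _)) (hb.subset hKΩ)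
    have hsupp : Function.support φ ⊆ K := by
      intro x hx
      by_contra hxK
      refine hx ?_
      ext i
      simp only [hφ, PiLp.zero_apply, moll]
      refine integral_eq_zero_of_ae (Filter.Eventually.of_forall fun t => ?_)
      by_cases ht : t ∈ S
      · have h1 : Metric.infDist t Ωᶜ ≤ Metric.infDist x Ωᶜ + dist t x :=
          Metric.infDist_le_infDist_add_dist
        have h2 : η ≤ ‖x - t‖ := by
          rw [← dist_eq_norm, dist_comm]
          simp only [hK, mem_ofPred_eq, not_le] at hxK
          simp only [hS, mem_ofPred_eq] at ht
          linarith
        have h3 : ρ (η⁻¹ • (x - t)) = 0 := by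
          refine hρsupp _ ?_
          rw [norm_smul, norm_inv, Real.norm_of_nonneg hη.le, inv_mul_eq_div, one_le_div hη]
          exact h2
        simp [dil, h3]
      · simp [hg, ht]
    refine ⟨contDiff_euclidean.2 fun i => contDiff_moll (contDiff_dil hρs η)
      (hasCompactSupport_dil hρc hη) (hgi i).locallyIntegrable,
      HasCompactSupport.of_support_subset_isCompact hKc hsupp,
      (closure_minimal hsupp hKc.isClosed).trans hKΩ⟩
  obtain ⟨p, hp, hp1, hp2⟩ := exists_mem_H2_of_isTest hφt
  refine ⟨p, hp, ?_⟩
  have hvel : ‖v.1 - p.1.1‖ₑ ^ 2 ≤ ∑ i, ∫⁻ s, diff2 (ext0 v i) (η • s) ∂ν := by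
    rw [enorm_sq_eq_sum]
    refine Finset.sum_le_sum fun i _ => ?_
    refine le_trans ?_ (hkernel i ρ hρs hρc hρe hρm)
    refine le_trans (lintegral_mono_ae ?_) (setLIntegral_le_lintegral Ω _)
    filter_upwards [hp1, Lp.coeFn_sub v.1 p.1.1, ae_restrict_mem hΩ.measurableSet] with x h1 h2 h3
    rw [h2, hρ1, one_mul, Pi.sub_apply, h1, ← enorm_neg]
    simp [ext0, h3, hφ]
  have hhess : ENNReal.ofReal (η ^ 4) * ‖p.2‖ₑ ^ 2 ≤
      4 * ∑ i, ∫⁻ s, diff2 (ext0 v i) (η • s) ∂ν := by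
    have hq : ∀ i j k : Fin 2, ENNReal.ofReal (η ^ 4) *
        ∫⁻ x in Ω, ‖(p.2 : Plane → Ten) x ((i, j), k)‖ₑ ^ 2 ≤
        ∫⁻ s, diff2 (ext0 v i) (η • s) ∂ν := by
      intro i j k
      refine le_trans ?_ (hkernel i (ρ' j k) (hρ's j k) (hρ'c j k) (hρ'e j k) fun s => ?_)
      · rw [← lintegral_const_mul' _ _ ENNReal.ofReal_ne_top]
        refine le_trans (lintegral_mono_ae ?_) (setLIntegral_le_lintegral Ω _)
        filter_upwards [hp2 i j k] with x hx
        rw [hx, hρ'0, zero_mul, sub_zero]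
        have e : (fun y => φ y i) = moll (dil η ρ) (g i) := rfl
        rw [e, partialD_partialD_moll_dil hρs hρc (hgi i) hη]
        rw [enorm_sq_eq_ofReal, enorm_sq_eq_ofReal, ← ENNReal.ofReal_mul (by positivity)]
        refine le_of_eq (congrArg _ ?_)
        simp only [hρ']
        field_simp
      · exact hρ'm j k s
    rw [enorm_sq_eq_sum, Fintype.sum_prod_type, Fintype.sum_prod_type, Finset.mul_sum,
      Finset.mul_sum]
    refine Finset.sum_le_sum fun i _ => ?_
    simp only [Fin.sum_univ_two]
    have h00 := hq i 0 0
    have h01 := hq i 0 1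
    have h10 := hq i 1 0
    have h11 := hq i 1 1
    calc _ = ENNReal.ofReal (η ^ 4) * (∫⁻ x in Ω, ‖(p.2 : Plane → Ten) x ((i, 0), 0)‖ₑ ^ 2) +
          ENNReal.ofReal (η ^ 4) * (∫⁻ x in Ω, ‖(p.2 : Plane → Ten) x ((i, 0), 1)‖ₑ ^ 2) +
          (ENNReal.ofReal (η ^ 4) * (∫⁻ x in Ω, ‖(p.2 : Plane → Ten) x ((i, 1), 0)‖ₑ ^ 2) +
          ENNReal.ofReal (η ^ 4) * (∫⁻ x in Ω, ‖(p.2 : Plane → Ten) x ((i, 1), 1)‖ₑ ^ 2)) := by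
          ring
      _ ≤ _ := add_le_add (add_le_add h00 h01) (add_le_add h10 h11)
      _ = _ := by ring
  calc _ ≤ _ := add_le_add hvel hhess
    _ = _ := by ring

/-- The square summable form of the approximation of `H₀¹` by `H₀¹ ∩ H²` along dyadic scales. -/
theorem exists_dyadic_smoothing (hΩ : IsOpen Ω) (hb : Bornology.IsBounded Ω)
    (hlip : IsLipschitzDomain Ω) :
    ∃ C η₀ : ℝ, 0 < C ∧ 0 < η₀ ∧ ∀ w ∈ H01 Ω, ∀ η : ℝ, 0 < η → η ≤ η₀ →
      ∃ z : ℕ → VField Ω × L2 Ω Ten, (∀ k, z k ∈ H2 Ω) ∧ ∀ n : ℕ,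
        ∑ k ∈ Finset.range n, ((η * (1 / 2) ^ k)⁻¹ * ‖w.1 - (z k).1.1‖ +
          η * (1 / 2) ^ k * ‖(z k).2‖) ^ 2 ≤ C * ‖w.2‖ ^ 2 := by
  obtain ⟨ν, η₀, hη₀, hνfin, hν⟩ := exists_smoothing hΩ hb hlip
  set N := (∫⁻ s, ‖s‖ₑ ^ 2 ∂ν).toReal with hN
  have hN0 : 0 ≤ N := ENNReal.toReal_nonneg
  have hNe : ∫⁻ s, ‖s‖ₑ ^ 2 ∂ν = ENNReal.ofReal N := (ENNReal.ofReal_toReal hνfin).symm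
  refine ⟨80 * N + 1, η₀, by positivity, hη₀, fun w hw η hη hηη => ?_⟩
  have hpos : ∀ k : ℕ, 0 < η * (1 / 2 : ℝ) ^ k := fun k => by positivity
  have hle : ∀ k : ℕ, η * (1 / 2 : ℝ) ^ k ≤ η₀ := fun k =>
    (mul_le_of_le_one_right hη.le (pow_le_one₀ (by norm_num) (by norm_num))).trans hηη
  choose z hz hzb using fun k : ℕ => hν w _ (hpos k) (hle k)
  refine ⟨z, hz, fun n => ?_⟩
  have hterm : ∀ k : ℕ, ENNReal.ofReal (((η * (1 / 2) ^ k)⁻¹ * ‖w.1 - (z k).1.1‖ +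
      η * (1 / 2) ^ k * ‖(z k).2‖) ^ 2) ≤ ENNReal.ofReal (10 * (η⁻¹) ^ 2) *
        ∑ i, ∫⁻ s, 4 ^ k * diff2 (ext0 w i) ((1 / 2 : ℝ) ^ k • η • s) ∂ν := by
    intro k
    set e := η * (1 / 2 : ℝ) ^ k with he
    have he0 : 0 < e := hpos k
    set a := ‖w.1 - (z k).1.1‖
    set d := ‖(z k).2‖
    have h1 : (e⁻¹ * a + e * d) ^ 2 ≤ 2 * (e⁻¹) ^ 2 * (a ^ 2 + e ^ 4 * d ^ 2) := by
      have e1 : 2 * (e⁻¹) ^ 2 * (a ^ 2 + e ^ 4 * d ^ 2) = 2 * (e⁻¹ * a) ^ 2 + 2 * (e * d) ^ 2 := by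
        field_simp
      rw [e1]
      nlinarith [sq_nonneg (e⁻¹ * a - e * d)]
    refine (ENNReal.ofReal_le_ofReal h1).trans ?_
    have h2 : ENNReal.ofReal (a ^ 2 + e ^ 4 * d ^ 2) ≤
        5 * ∑ i, ∫⁻ s, diff2 (ext0 w i) (e • s) ∂ν := by
      refine le_trans (le_of_eq ?_) (hzb k)
      rw [ENNReal.ofReal_add (by positivity) (by positivity), ENNReal.ofReal_mul (by positivity),
        ENNReal.ofReal_pow (norm_nonneg _), ENNReal.ofReal_pow (norm_nonneg _), ofReal_norm,
        ofReal_norm]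
    rw [ENNReal.ofReal_mul (by positivity)]
    refine (mul_le_mul_right h2 _).trans (le_of_eq ?_)
    have h3 : ∀ (i : Fin 2) (s : Plane), diff2 (ext0 w i) (e • s) =
        diff2 (ext0 w i) ((1 / 2 : ℝ) ^ k • η • s) := by
      intro i s
      rw [smul_smul, he, mul_comm η]
    have h4 : ∀ i : Fin 2, ∫⁻ s, 4 ^ k * diff2 (ext0 w i) ((1 / 2 : ℝ) ^ k • η • s) ∂ν =
        4 ^ k * ∫⁻ s, diff2 (ext0 w i) ((1 / 2 : ℝ) ^ k • η • s) ∂ν := fun i =>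
      lintegral_const_mul' _ _ (by finiteness)
    simp_rw [h3, h4]
    rw [← Finset.mul_sum, ← mul_assoc, ← mul_assoc]
    congr 1
    rw [← ENNReal.ofReal_ofNat 5, ← ENNReal.ofReal_ofNat 4, ← ENNReal.ofReal_pow (by norm_num),
      ← ENNReal.ofReal_mul (by positivity), ← ENNReal.ofReal_mul (by positivity)]
    congr 1
    have h5 : (4 : ℝ) ^ k = ((1 / 2 : ℝ) ^ k)⁻¹ ^ 2 := by
      rw [inv_pow, ← pow_mul, mul_comm k 2, pow_mul, ← inv_pow]; norm_num
    rw [he, h5]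
    field_simp
    norm_num
  have hG : ∀ i : Fin 2, ∀ s : Plane, ∑ k ∈ Finset.range n,
      4 ^ k * diff2 (ext0 w i) ((1 / 2 : ℝ) ^ k • η • s) ≤ 4 * (‖η • s‖ₑ ^ 2 * ‖w.2‖ₑ ^ 2) :=
    fun i s => sum_diff2_le (measurable_ext0 hΩ w i) (fun y => diff1_ext0_le hΩ hw i y) _ n
  have hsum : ENNReal.ofReal (∑ k ∈ Finset.range n, ((η * (1 / 2) ^ k)⁻¹ * ‖w.1 - (z k).1.1‖ +
      η * (1 / 2) ^ k * ‖(z k).2‖) ^ 2) ≤ ENNReal.ofReal (80 * N * ‖w.2‖ ^ 2) := by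
    rw [ENNReal.ofReal_sum_of_nonneg fun k _ => sq_nonneg _]
    refine (Finset.sum_le_sum fun k _ => hterm k).trans ?_
    rw [← Finset.mul_sum, Finset.sum_comm]
    have hi : ∀ i : Fin 2, ∑ k ∈ Finset.range n,
        ∫⁻ s, 4 ^ k * diff2 (ext0 w i) ((1 / 2 : ℝ) ^ k • η • s) ∂ν ≤
        ENNReal.ofReal (4 * η ^ 2 * ‖w.2‖ ^ 2 * N) := by
      intro i
      have hms : ∀ k : ℕ, Measurable fun s =>
          4 ^ k * diff2 (ext0 w i) ((1 / 2 : ℝ) ^ k • η • s) := fun k =>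
        ((measurable_diff2 (measurable_ext0 hΩ w i)).comp
          ((measurable_const_smul η).const_smul ((1 / 2 : ℝ) ^ k))).const_mul _
      rw [← lintegral_finsetSum _ fun k _ => hms k]
      refine (lintegral_mono (hG i)).trans (le_of_eq ?_)
      have e : ∀ s : Plane, 4 * (‖η • s‖ₑ ^ 2 * ‖w.2‖ₑ ^ 2) =
          ENNReal.ofReal (4 * η ^ 2 * ‖w.2‖ ^ 2) * ‖s‖ₑ ^ 2 := by
        intro s
        simp only [← ofReal_norm, norm_smul]
        rw [← ENNReal.ofReal_pow (by positivity), ← ENNReal.ofReal_pow (by positivity),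
          ← ENNReal.ofReal_pow (by positivity), ← ENNReal.ofReal_mul (by positivity),
          ← ENNReal.ofReal_mul (by positivity)]
        have e4 : (4 : ℝ≥0∞) = ENNReal.ofReal 4 := by norm_num
        rw [e4, ← ENNReal.ofReal_mul (by norm_num)]
        congr 1
        rw [mul_pow, Real.norm_eq_abs, sq_abs]
        ring
      simp_rw [e]
      rw [lintegral_const_mul' _ _ ENNReal.ofReal_ne_top, hNe,
        ← ENNReal.ofReal_mul (by positivity)]
    refine (mul_le_mul_right (Finset.sum_le_sum fun i _ => hi i) _).trans (le_of_eq ?_)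
    rw [Fin.sum_univ_two, ← ENNReal.ofReal_add (by positivity) (by positivity),
      ← ENNReal.ofReal_mul (by positivity)]
    congr 1
    field_simp
    ring
  have := (ENNReal.ofReal_le_ofReal_iff (by positivity)).1 hsum
  nlinarith [sq_nonneg ‖w.2‖]

end

/-! ### Pointwise bounds for finite element functions -/

/-- A sequence whose square tails are controlled by their first term decays geometrically on
average; in particular its partial sums are controlled by its first term. -/
theorem sum_le_of_sq_tail_le {κ : ℕ → ℝ} (hκ : ∀ k, 0 ≤ κ k) {C : ℝ} (hC : 1 ≤ C)
    (h : ∀ k n, ∑ j ∈ Finset.range n, κ (k + j) ^ 2 ≤ C * κ k ^ 2) (n : ℕ) :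
    ∑ k ∈ Finset.range n, κ k ≤ 2 * C * κ 0 := by
  set S : ℕ → ℝ := fun k => ∑ j ∈ Finset.range (n - k), κ (k + j) ^ 2 with hS
  have hS0 : ∀ k, 0 ≤ S k := fun k => Finset.sum_nonneg fun j _ => sq_nonneg _
  have hstep : ∀ k, k < n → S k = S (k + 1) + κ k ^ 2 := by
    intro k hk
    have e : n - k = (n - (k + 1)) + 1 := by omega
    simp only [hS]
    rw [e, Finset.sum_range_succ']
    simp only [add_zero]
    congr 1
    exact Finset.sum_congr rfl fun j _ => by rw [add_assoc, add_comm 1 j]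
  set D := √C with hD
  have hD1 : 1 ≤ D := Real.one_le_sqrt.2 hC
  have hDC : D ^ 2 = C := Real.sq_sqrt (by linarith)
  have hterm : ∀ k, k < n → κ k ≤ 2 * D * (√(S k) - √(S (k + 1))) := by
    intro k hk
    have h1 : √(S k) ≤ D * κ k := by
      refine Real.sqrt_le_iff.2 ⟨mul_nonneg (by linarith) (hκ k), ?_⟩
      rw [mul_pow, hDC]
      exact h k _
    have h2 := hstep k hk
    have h3 : √(S (k + 1)) ≤ √(S k) := Real.sqrt_le_sqrt (by nlinarith [sq_nonneg (κ k)])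
    have h4 := Real.sq_sqrt (hS0 k)
    have h5 := Real.sq_sqrt (hS0 (k + 1))
    rcases (hκ k).eq_or_lt with h0 | h0
    · rw [← h0]
      exact mul_nonneg (by linarith) (by linarith)
    · have h6 : κ k * κ k ≤ κ k * (2 * D * (√(S k) - √(S (k + 1)))) := by
        have h7 : κ k * κ k = (√(S k) - √(S (k + 1))) * (√(S k) + √(S (k + 1))) := by
          linear_combination -h4 + h5 - h2
        rw [h7]
        have h8 : √(S k) + √(S (k + 1)) ≤ 2 * D * κ k := by linarith
        have := mul_le_mul_of_nonneg_left h8 (sub_nonneg.2 h3)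
        linarith
      exact le_of_mul_le_mul_left h6 h0
  calc ∑ k ∈ Finset.range n, κ k
      ≤ ∑ k ∈ Finset.range n, 2 * D * (√(S k) - √(S (k + 1))) :=
        Finset.sum_le_sum fun k hk => hterm k (Finset.mem_range.1 hk)
    _ = 2 * D * (√(S 0) - √(S n)) := by
        rw [← Finset.mul_sum, Finset.sum_range_sub' (fun k => √(S k))]
    _ ≤ 2 * D * (D * κ 0) := by
        refine mul_le_mul_of_nonneg_left ?_ (by linarith)
        have h1 : √(S 0) ≤ D * κ 0 := by
          refine Real.sqrt_le_iff.2 ⟨mul_nonneg (by linarith) (hκ 0), ?_⟩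
          rw [mul_pow, hDC]
          exact h 0 _
        linarith [Real.sqrt_nonneg (S n)]
    _ = 2 * C * κ 0 := by rw [← hDC]; ring

/-- The error, at scale `s`, of the approximation of `u` by the field `p.1` with Hessian `p.2`. -/
noncomputable def scaleErr (s : ℝ) (u : VField Ω) (p : VField Ω × L2 Ω Ten) : ℝ :=
  s⁻¹ * ‖u.1 - p.1.1‖ + s * ‖p.2‖

/-- The `K`-functional of the pair `L²`, `H₀¹ ∩ H²` at `u`, normalized at scale `s`. -/
noncomputable def scaleK (s : ℝ) (u : VField Ω) : ℝ :=
  ⨅ p : H2 Ω, scaleErr s u p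

theorem scaleErr_nonneg {s : ℝ} (hs : 0 < s) (u : VField Ω) (p : VField Ω × L2 Ω Ten) :
    0 ≤ scaleErr s u p := by
  unfold scaleErr; positivity

theorem scaleK_nonneg {s : ℝ} (hs : 0 < s) (u : VField Ω) : 0 ≤ scaleK s u :=
  Real.iInf_nonneg fun p => scaleErr_nonneg hs u p

theorem scaleK_le {s : ℝ} (hs : 0 < s) (u : VField Ω) {p : VField Ω × L2 Ω Ten}
    (hp : p ∈ H2 Ω) : scaleK s u ≤ scaleErr s u p :=
  ciInf_le ⟨0, by rintro _ ⟨q, rfl⟩; exact scaleErr_nonneg hs u q⟩ (⟨p, hp⟩ : H2 Ω)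

theorem exists_scaleErr_lt {s : ℝ} (u : VField Ω) {ε : ℝ} (hε : 0 < ε) :
    ∃ p ∈ H2 Ω, scaleErr s u p < scaleK s u + ε := by
  obtain ⟨p, hp⟩ := exists_lt_of_ciInf_lt (lt_add_of_pos_right (scaleK s u) hε)
  exact ⟨p, p.2, hp⟩

/-- Inverse inequality relative to smooth fields: at scales below the mesh size, the gradient
distance of a finite element function from `H₀¹ ∩ H²` is controlled by the scaled error. -/
theorem exists_norm_grad_sub_le (hΩ : IsOpen Ω) (hb : Bornology.IsBounded Ω) {C : ℝ} (hC : 0 < C) :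
    ∃ c : ℝ, 0 < c ∧ ∀ V L, IsFEFamily Ω C V L → ∀ H, 0 < H → H < 1 → ∀ u ∈ V H,
      ∀ s, 0 < s → s ≤ H → ∀ p ∈ H2 Ω, ‖u.2 - p.1.2‖ ≤ c * scaleErr s u p := by
  obtain ⟨c, hc1, hc⟩ := exists_h2norm_le hΩ hb
  refine ⟨C + C ^ 2 * c + C * c, by positivity, fun V L hF H hH0 hH1 u hu s hs hsH p hp => ?_⟩
  have hs1 : s < 1 := by linarith
  have hus : u ∈ V s := by
    rcases hsH.eq_or_lt with rfl | h
    · exact hu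
    · exact hF.nested_vel s H hs h hH1 hu
  obtain ⟨v, hv, hvb⟩ := hF.approx_vel s hs hs1 p.1 hp.1 p.2 hp.2
  have hD := hc p.1 hp.1 p.2 hp.2
  set d := ‖p.2‖
  set a := ‖u.1 - p.1.1‖ with ha
  have hd0 : 0 ≤ d := norm_nonneg _
  have ha0 : 0 ≤ a := norm_nonneg _
  have h1 : ‖p.1.1 - v.1‖ + s * ‖p.1.2 - v.2‖ ≤ C * s ^ 2 * (c * d) :=
    hvb.trans (mul_le_mul_of_nonneg_left hD (by positivity))
  have h2 : ‖p.1.1 - v.1‖ ≤ C * s ^ 2 * (c * d) := by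
    have : 0 ≤ s * ‖p.1.2 - v.2‖ := by positivity
    linarith
  have h3 : ‖p.1.2 - v.2‖ ≤ C * s * (c * d) := by
    have : s * ‖p.1.2 - v.2‖ ≤ s * (C * s * (c * d)) := by
      have := norm_nonneg (p.1.1 - v.1)
      nlinarith
    exact le_of_mul_le_mul_left this hs
  have h4 : ‖u.2 - v.2‖ ≤ C * s⁻¹ * ‖u.1 - v.1‖ :=
    hF.inverse s hs hs1 (u - v) (sub_mem hus hv)
  have h5 : ‖u.1 - v.1‖ ≤ a + C * s ^ 2 * (c * d) :=
    (norm_sub_le_norm_sub_add_norm_sub _ p.1.1 _).trans (by linarith)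
  have h6 : ‖u.2 - p.1.2‖ ≤ ‖u.2 - v.2‖ + ‖p.1.2 - v.2‖ := by
    rw [norm_sub_rev p.1.2]
    exact norm_sub_le_norm_sub_add_norm_sub _ _ _
  have h7 : C * s⁻¹ * ‖u.1 - v.1‖ ≤ C * s⁻¹ * a + C ^ 2 * c * (s * d) := by
    refine (mul_le_mul_of_nonneg_left h5 (by positivity)).trans (le_of_eq ?_)
    field_simp
  have h8 : 0 ≤ s⁻¹ * a := by positivity
  have h9 : 0 ≤ s * d := by positivity
  have e : scaleErr s u p = s⁻¹ * a + s * d := rfl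
  rw [e]
  have hc0 : 0 < c := by linarith
  calc ‖u.2 - p.1.2‖ ≤ C * s⁻¹ * a + C ^ 2 * c * (s * d) + C * s * (c * d) := by linarith
    _ = C * (s⁻¹ * a) + (C ^ 2 * c + C * c) * (s * d) := by ring
    _ ≤ (C + C ^ 2 * c + C * c) * (s⁻¹ * a) + (C + C ^ 2 * c + C * c) * (s * d) := by
        gcongr
        · have : 0 < C ^ 2 * c := by positivity
          have : 0 < C * c := by positivity
          linarith
        · linarith
    _ = _ := by ring

/-- The `K`-functional of a finite element function decays along dyadic scales below the mesh
size: its square tails are controlled by their first term. -/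
theorem exists_sum_scaleK_sq_le (hΩ : IsOpen Ω) (hb : Bornology.IsBounded Ω)
    (hlip : IsLipschitzDomain Ω) {C : ℝ} (hC : 0 < C) :
    ∃ c η₀ : ℝ, 1 ≤ c ∧ 0 < η₀ ∧ ∀ V L, IsFEFamily Ω C V L → ∀ H, 0 < H → H < 1 → ∀ u ∈ V H,
      ∀ s, 0 < s → s ≤ H → s ≤ η₀ → ∀ n : ℕ,
        ∑ j ∈ Finset.range n, scaleK (s * (1 / 2) ^ j) u ^ 2 ≤ c * scaleK s u ^ 2 := by
  obtain ⟨B, hB0, hB⟩ := exists_norm_grad_sub_le hΩ hb hC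
  obtain ⟨A, η₀, hA, hη₀, hsm⟩ := exists_dyadic_smoothing hΩ hb hlip
  refine ⟨2 * (A * B ^ 2) + 4, η₀, by nlinarith [mul_pos hA (pow_pos hB0 2)], hη₀,
    fun V L hF H hH0 hH1 u hu s hs hsH hsη n => ?_⟩
  have key : ∀ ε : ℝ, 0 < ε → ∑ j ∈ Finset.range n, scaleK (s * (1 / 2) ^ j) u ^ 2 ≤
      (2 * (A * B ^ 2) + 4) * (scaleK s u + ε) ^ 2 := by
    intro ε hε
    obtain ⟨p, hp, hpε⟩ := exists_scaleErr_lt (s := s) u hε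
    set e := scaleK s u + ε with he
    -- `u - p` is smoothed at all dyadic scales below `s`; its gradient is at most `B e`, and the
    -- fixed term `p` contributes a geometric series
    have hw : u - p.1 ∈ H01 Ω := sub_mem (hF.conforming H hH0 hH1 hu) hp.1
    obtain ⟨z, hz, hzn⟩ := hsm _ hw s hs hsη
    have hgrad : ‖(u - p.1).2‖ ≤ B * e :=
      (hB V L hF H hH0 hH1 u hu s hs hsH p hp).trans
        (mul_le_mul_of_nonneg_left hpε.le hB0.le)
    have hD : s * ‖p.2‖ ≤ e := by
      have : 0 ≤ s⁻¹ * ‖u.1 - p.1.1‖ := by positivity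
      unfold scaleErr at hpε
      linarith
    have he0 : 0 ≤ e := le_trans (by positivity) hD
    have hterm : ∀ j : ℕ, scaleK (s * (1 / 2) ^ j) u ^ 2 ≤
        2 * ((s * (1 / 2) ^ j)⁻¹ * ‖(u - p.1).1 - (z j).1.1‖ +
          s * (1 / 2) ^ j * ‖(z j).2‖) ^ 2 + 2 * e ^ 2 * (1 / 4) ^ j := by
      intro j
      set r := s * (1 / 2 : ℝ) ^ j with hr
      have hr0 : 0 < r := by positivity
      have h1 := scaleK_le hr0 u (add_mem hp (hz j))
      set x := r⁻¹ * ‖(u - p.1).1 - (z j).1.1‖ + r * ‖(z j).2‖ with hx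
      have h2 : scaleErr r u (p + z j) ≤ x + e * (1 / 2) ^ j := by
        unfold scaleErr
        have e1 : u.1 - (p + z j).1.1 = (u - p.1).1 - (z j).1.1 := by
          simp only [Prod.fst_add, Prod.fst_sub]; abel
        have e2 : r * ‖(p + z j).2‖ ≤ r * ‖(z j).2‖ + r * ‖p.2‖ := by
          rw [← mul_add, add_comm ‖(z j).2‖]
          exact mul_le_mul_of_nonneg_left (norm_add_le _ _) hr0.le
        have e3 : r * ‖p.2‖ ≤ e * (1 / 2) ^ j := by
          have := mul_le_mul_of_nonneg_right hD (by positivity : (0 : ℝ) ≤ (1 / 2) ^ j)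
          rw [hr]; linarith
        rw [e1]; linarith
      have h3 := scaleK_nonneg hr0 u
      have h4 : scaleK r u ≤ x + e * (1 / 2) ^ j := h1.trans h2
      have h5 : ((1 / 2 : ℝ) ^ j) ^ 2 = (1 / 4) ^ j := by
        rw [← pow_mul, mul_comm, pow_mul]; norm_num
      calc scaleK r u ^ 2 ≤ (x + e * (1 / 2) ^ j) ^ 2 := pow_le_pow_left₀ h3 h4 2
        _ ≤ 2 * x ^ 2 + 2 * (e * (1 / 2) ^ j) ^ 2 := by
            nlinarith [sq_nonneg (x - e * (1 / 2) ^ j)]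
        _ = _ := by rw [mul_pow, h5]; ring
    refine (Finset.sum_le_sum fun j _ => hterm j).trans ?_
    rw [Finset.sum_add_distrib, ← Finset.mul_sum, ← Finset.mul_sum]
    have hg : ∑ j ∈ Finset.range n, (1 / 4 : ℝ) ^ j ≤ 2 := by
      have := geom_sum_mul (1 / 4 : ℝ) n
      have : (0 : ℝ) ≤ (1 / 4) ^ n := by positivity
      linarith
    have h1 := hzn n
    have h2 : A * ‖(u - p.1).2‖ ^ 2 ≤ A * (B * e) ^ 2 := by gcongr
    have h3 : 2 * e ^ 2 * ∑ j ∈ Finset.range n, (1 / 4 : ℝ) ^ j ≤ 2 * e ^ 2 * 2 := by gcongr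
    nlinarith
  have hlim : Filter.Tendsto (fun ε : ℝ => (2 * (A * B ^ 2) + 4) * (scaleK s u + ε) ^ 2)
      (nhdsWithin 0 (Ioi 0)) (nhds ((2 * (A * B ^ 2) + 4) * (scaleK s u + 0) ^ 2)) :=
    (Continuous.tendsto (by fun_prop) _).mono_left nhdsWithin_le_nhds
  rw [add_zero] at hlim
  exact ge_of_tendsto hlim (by filter_upwards [self_mem_nhdsWithin] with ε hε using key ε hε)

/-- Pointwise almost everywhere bounds pass to limits in `L²`. -/
theorem ae_norm_le_of_tendsto {F : Type} [NormedAddCommGroup F] {f : ℕ → L2 Ω F} {g : L2 Ω F}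
    {B : Plane → ℝ} (hf : ∀ n, ∀ᵐ x ∂(volume.restrict Ω), ‖(f n : Plane → F) x‖ ≤ B x)
    (h : Filter.Tendsto f Filter.atTop (nhds g)) :
    ∀ᵐ x ∂(volume.restrict Ω), ‖(g : Plane → F) x‖ ≤ B x := by
  obtain ⟨ns, -, hns⟩ := (tendstoInMeasure_of_tendsto_Lp h).exists_seq_tendsto_ae
  filter_upwards [hns, ae_all_iff.2 hf] with x h1 h2
  exact le_of_tendsto h1.norm (Filter.Eventually.of_forall fun n => h2 (ns n))

/-- Finite element functions obey a pointwise bound without logarithmic loss: they are bounded by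
any field in `H₀¹ ∩ H²` up to the scaled approximation error at the mesh size. -/
theorem exists_sup_bound (hΩ : IsOpen Ω) (hb : Bornology.IsBounded Ω)
    (hlip : IsLipschitzDomain Ω) {C : ℝ} (hC : 0 < C) :
    ∃ c : ℝ, 0 < c ∧ ∀ V L, IsFEFamily Ω C V L → ∀ H, 0 < H → H < 1 → ∀ u ∈ V H,
      ∀ p ∈ H2 Ω, ∀ᵐ x ∂(volume.restrict Ω),
        ‖(u.1 : Plane → Plane) x‖ ≤ ‖(p.1.1 : Plane → Plane) x‖ + c * scaleErr H u p := by
  obtain ⟨A, η₀, hA, hη₀, hsum⟩ := exists_sum_scaleK_sq_le hΩ hb hlip hC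
  set θ := min 1 η₀ with hθ
  have hθ0 : 0 < θ := by positivity
  have hθ1 : θ ≤ 1 := min_le_left _ _
  refine ⟨20 * (2 * A + 4) * θ⁻¹, by positivity, fun V L hF H hH0 hH1 u hu p hp => ?_⟩
  set s := θ * H with hs
  have hs0 : 0 < s := by positivity
  have hsH : s ≤ H := mul_le_of_le_one_left hH0.le hθ1
  have hsη : s ≤ η₀ := by
    have : θ ≤ η₀ := min_le_right _ _
    nlinarith
  set r := scaleErr s u p with hr
  have hrH : r ≤ θ⁻¹ * scaleErr H u p := by
    rw [hr]
    unfold scaleErr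
    have h1 : s⁻¹ * ‖u.1 - p.1.1‖ = θ⁻¹ * (H⁻¹ * ‖u.1 - p.1.1‖) := by
      rw [hs, mul_inv, mul_assoc]
    have h2 : s * ‖p.2‖ ≤ θ⁻¹ * (H * ‖p.2‖) := by
      have : 1 ≤ θ⁻¹ := (one_le_inv₀ hθ0).2 hθ1
      have h3 : 0 ≤ H * ‖p.2‖ := by positivity
      have : s * ‖p.2‖ ≤ H * ‖p.2‖ := mul_le_mul_of_nonneg_right hsH (norm_nonneg _)
      nlinarith
    rw [mul_add]; linarith
  suffices h : ∀ᵐ x ∂(volume.restrict Ω),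
      ‖(u.1 : Plane → Plane) x‖ ≤ ‖(p.1.1 : Plane → Plane) x‖ + 20 * (2 * A + 4) * r by
    filter_upwards [h] with x hx
    refine hx.trans (add_le_add le_rfl ?_)
    rw [mul_assoc (20 * (2 * A + 4))]
    exact mul_le_mul_of_nonneg_left hrH (by positivity)
  have hr0 : 0 ≤ r := scaleErr_nonneg hs0 u p
  rcases hr0.eq_or_lt with h0 | h0
  · have h1 : ‖u.1 - p.1.1‖ = 0 := by
      have h2 : 0 ≤ s * ‖p.2‖ := by positivity
      have h3 : s⁻¹ * ‖u.1 - p.1.1‖ ≤ 0 := by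
        have : r = s⁻¹ * ‖u.1 - p.1.1‖ + s * ‖p.2‖ := rfl
        linarith
      have h4 : 0 < s⁻¹ := by positivity
      have := norm_nonneg (u.1 - p.1.1)
      nlinarith
    rw [← h0, sub_eq_zero.1 (norm_eq_zero.1 h1)]
    exact Filter.Eventually.of_forall fun x => by simp
  -- near-optimal approximations at the scales `s / 2 ^ k`, starting from `p`
  set η : ℕ → ℝ := fun k => s * (1 / 2) ^ k with hη
  have hη0 : ∀ k, 0 < η k := fun k => by positivity
  have hηs : ∀ k, η (k + 1) = η k / 2 := fun k => by simp only [hη]; rw [pow_succ]; ring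
  set κ : ℕ → ℝ := fun k => scaleK (η k) u with hκ
  have hκsum : ∀ n, ∑ k ∈ Finset.range n, κ k ≤ 2 * A * κ 0 := by
    refine sum_le_of_sq_tail_le (fun k => scaleK_nonneg (hη0 k) u) hA fun k n => ?_
    have h1 : η k ≤ s := mul_le_of_le_one_right hs0.le (pow_le_one₀ (by norm_num) (by norm_num))
    have := hsum V L hF H hH0 hH1 u hu (η k) (hη0 k) (h1.trans hsH) (h1.trans hsη) n
    refine le_trans (le_of_eq (Finset.sum_congr rfl fun j _ => ?_)) this
    simp only [hη]
    rw [pow_add, ← mul_assoc]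
  have hex : ∀ k, ∃ q ∈ H2 Ω, scaleErr (η k) u q ≤ κ k + r * (1 / 2) ^ k := fun k => by
    obtain ⟨q, hq, h⟩ := exists_scaleErr_lt (s := η k) u (ε := r * (1 / 2) ^ k) (by positivity)
    exact ⟨q, hq, h.le⟩
  choose q hq hqb using hex
  set z : ℕ → VField Ω × L2 Ω Ten := fun k => Nat.casesOn k p fun k => q (k + 1) with hz
  have hz0 : z 0 = p := rfl
  have hzm : ∀ k, z k ∈ H2 Ω := fun k => by
    cases k with
    | zero => exact hp
    | succ k => exact hq (k + 1)
  set R : ℕ → ℝ := fun k => scaleErr (η k) u (z k) with hR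
  have hR0 : ∀ k, 0 ≤ R k := fun k => scaleErr_nonneg (hη0 k) u _
  have hη00 : η 0 = s := by simp [hη]
  have hRle : ∀ k, R (k + 1) ≤ κ (k + 1) + r * (1 / 2) ^ (k + 1) := fun k => hqb (k + 1)
  have hR00 : R 0 = r := by simp only [hR, hη00, hz0, hr]
  have hκ0 : κ 0 ≤ r := by
    simp only [hκ, hη00]
    exact scaleK_le hs0 u hp
  have hRsum : ∀ n, ∑ k ∈ Finset.range n, R k ≤ (2 * A + 3) * r := by
    intro n
    have h1 : ∀ k, R k ≤ (κ k + r * (1 / 2) ^ k) + if k = 0 then r else 0 := by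
      intro k
      cases k with
      | zero =>
        have := scaleK_nonneg (hη0 0) u
        simp only [hR00, if_true, pow_zero, mul_one]
        linarith
      | succ k => simpa using hRle k
    refine (Finset.sum_le_sum fun k _ => h1 k).trans ?_
    rw [Finset.sum_add_distrib, Finset.sum_add_distrib, ← Finset.mul_sum]
    have h2 : ∑ k ∈ Finset.range n, (1 / 2 : ℝ) ^ k ≤ 2 := by
      have := geom_sum_mul (1 / 2 : ℝ) n
      have : (0 : ℝ) ≤ (1 / 2) ^ n := by positivity
      linarith
    have h3 : ∑ k ∈ Finset.range n, (if k = 0 then r else 0) ≤ r := by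
      rw [Finset.sum_ite_eq' (Finset.range n) 0 fun _ => r]
      split_ifs <;> linarith
    have h4 := hκsum n
    have h5 : 2 * A * κ 0 ≤ 2 * A * r := by gcongr
    nlinarith
  have hvelb : ∀ k, ‖u.1 - (z k).1.1‖ ≤ η k * R k := by
    intro k
    have h1 : 0 ≤ η k * ‖(z k).2‖ := mul_nonneg (hη0 k).le (norm_nonneg _)
    have h2 : (η k)⁻¹ * ‖u.1 - (z k).1.1‖ ≤ R k := by simp only [hR, scaleErr]; linarith
    rwa [inv_mul_le_iff₀ (hη0 k)] at h2
  have hhessb : ∀ k, η k * ‖(z k).2‖ ≤ R k := by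
    intro k
    have h1 : 0 ≤ (η k)⁻¹ * ‖u.1 - (z k).1.1‖ :=
      mul_nonneg (inv_nonneg.2 (hη0 k).le) (norm_nonneg _)
    simp only [hR, scaleErr]
    linarith
  -- Agmon's inequality at scale `η k`, whose powers cancel between the field and its Hessian
  have hdiff : ∀ k, ∀ᵐ x ∂(volume.restrict Ω),
      ‖((z (k + 1)).1.1 : Plane → Plane) x - ((z k).1.1 : Plane → Plane) x‖ ≤
        10 * (R k + R (k + 1)) := by
    intro k
    have hm := sub_mem (hzm (k + 1)) (hzm k)
    filter_upwards [agmon hΩ hb hm.1 hm.2, Lp.coeFn_sub (z (k + 1)).1.1 (z k).1.1] with x h1 h2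
    have e : ((z (k + 1) - z k).1.1 : Plane → Plane) x =
        ((z (k + 1)).1.1 : Plane → Plane) x - ((z k).1.1 : Plane → Plane) x := h2
    rw [e] at h1
    have h3 : ‖(z (k + 1) - z k).1.1‖ ≤ η k * (R k + R (k + 1)) := by
      have e1 : (z (k + 1) - z k).1.1 = (u.1 - (z k).1.1) - (u.1 - (z (k + 1)).1.1) := by
        simp only [Prod.fst_sub]; abel
      rw [e1]
      refine (norm_sub_le _ _).trans ?_
      have h4 := hvelb k
      have h5 := hvelb (k + 1)
      rw [hηs] at h5
      have := mul_nonneg (hη0 k).le (hR0 (k + 1))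
      linarith
    have h4 : η k * ‖(z (k + 1) - z k).2‖ ≤ 2 * (R k + R (k + 1)) := by
      have h5 := hhessb k
      have h6 := hhessb (k + 1)
      rw [hηs] at h6
      have h7 : ‖(z (k + 1) - z k).2‖ ≤ ‖(z (k + 1)).2‖ + ‖(z k).2‖ := norm_sub_le _ _
      have h8 := mul_le_mul_of_nonneg_left h7 (hη0 k).le
      have h9 := hR0 k
      linarith
    set a := ‖(z (k + 1) - z k).1.1‖
    set d := ‖(z (k + 1) - z k).2‖
    set S := R k + R (k + 1) with hSdef
    have hS0 : 0 ≤ S := add_nonneg (hR0 k) (hR0 (k + 1))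
    have h5 : a * d ≤ S * (2 * S) := by
      have h6 : a * d ≤ η k * S * d := mul_le_mul_of_nonneg_right h3 (norm_nonneg _)
      have h7 := mul_le_mul_of_nonneg_left h4 hS0
      linarith
    refine abs_le_of_sq_le_sq' (a := ‖((z (k + 1)).1.1 : Plane → Plane) x -
      ((z k).1.1 : Plane → Plane) x‖) ?_ (by positivity) |>.2
    nlinarith
  have hbd : ∀ n, ∀ᵐ x ∂(volume.restrict Ω), ‖((z n).1.1 : Plane → Plane) x‖ ≤
      ‖(p.1.1 : Plane → Plane) x‖ + 20 * (2 * A + 4) * r := by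
    intro n
    filter_upwards [ae_all_iff.2 hdiff] with x hx
    have h1 : ∀ n, ‖((z n).1.1 : Plane → Plane) x‖ ≤
        ‖(p.1.1 : Plane → Plane) x‖ + ∑ k ∈ Finset.range n, 10 * (R k + R (k + 1)) := by
      intro n
      induction n with
      | zero => simp [hz0]
      | succ n ih =>
        rw [Finset.sum_range_succ]
        have h2 := norm_le_norm_add_norm_sub' (((z (n + 1)).1.1 : Plane → Plane) x)
          (((z n).1.1 : Plane → Plane) x)
        linarith [hx n]
    refine (h1 n).trans (add_le_add le_rfl ?_)
    rw [← Finset.mul_sum, Finset.sum_add_distrib]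
    have h2 := hRsum n
    have h3 := hRsum (n + 1)
    rw [Finset.sum_range_succ'] at h3
    have h4 := hR0 0
    nlinarith
  refine ae_norm_le_of_tendsto (f := fun n => (z n).1.1) hbd ?_
  refine tendsto_iff_norm_sub_tendsto_zero.2 ?_
  refine squeeze_zero (fun n => norm_nonneg _) (g := fun n => s * (1 / 2) ^ n * ((2 * A + 3) * r))
    (fun n => ?_) ?_
  · rw [norm_sub_rev]
    refine (hvelb n).trans (mul_le_mul_of_nonneg_left ?_ (hη0 n).le)
    refine le_trans ?_ (hRsum (n + 1))
    exact Finset.single_le_sum (f := R) (fun k _ => hR0 k) (Finset.mem_range.2 (Nat.lt_succ_self n))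
  · have h1 := tendsto_pow_atTop_nhds_zero_of_lt_one (r := (1 / 2 : ℝ)) (by norm_num) (by norm_num)
    have h2 := (h1.const_mul s).mul_const ((2 * A + 3) * r)
    simpa using h2

/-! ### The discrete Stokes operator -/

theorem discJ_le (V : Submodule ℝ (VField Ω)) (L : Submodule ℝ (L2 Ω ℝ)) : discJ V L ≤ V :=
  inf_le_left

theorem inner_divL_eq_zero {V : Submodule ℝ (VField Ω)} {L : Submodule ℝ (L2 Ω ℝ)} {v : VField Ω}
    (hv : v ∈ discJ V L) {χ : L2 Ω ℝ} (hχ : χ ∈ L) : ⟪χ, divL Ω v⟫_ℝ = 0 :=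
  (Submodule.mem_orthogonal _ _).1 hv.2 χ hχ

theorem divL_eq_zero {v : VField Ω} (hv : v ∈ J1 Ω) : divL Ω v = 0 := hv.2

theorem norm_divL_le (v : VField Ω) : ‖divL Ω v‖ ≤ ‖divL Ω‖ * ‖v.2‖ := by
  have h1 : divL Ω v = divL Ω ((0 : L2 Ω Plane), v.2) := rfl
  have h2 : ‖((0 : L2 Ω Plane), v.2)‖ = ‖v.2‖ := by simp [Prod.norm_def]
  rw [h1, ← h2]
  exact (divL Ω).le_opNorm _

section

variable {C : ℝ} {V : ℝ → Submodule ℝ (VField Ω)} {L : ℝ → Submodule ℝ (L2 Ω ℝ)}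

theorem IsFEFamily.finiteDimensional_discJ (hF : IsFEFamily Ω C V L) {h : ℝ} (h0 : 0 < h)
    (h1 : h < 1) : FiniteDimensional ℝ (discJ (V h) (L h)) := by
  have := hF.finite_vel h h0 h1
  exact Submodule.finiteDimensional_of_le (discJ_le _ _)

theorem IsFEFamily.discJ_le_H01 (hF : IsFEFamily Ω C V L) {h : ℝ} (h0 : 0 < h)
    (h1 : h < 1) : discJ (V h) (L h) ≤ H01 Ω :=
  (discJ_le _ _).trans (hF.conforming h h0 h1)

theorem IsFEFamily.l2Proj_spec (hΩ : IsOpen Ω) (hF : IsFEFamily Ω C V L) {h : ℝ} (h0 : 0 < h)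
    (h1 : h < 1) (g : L2 Ω Plane) : l2Proj (discJ (V h) (L h)) g ∈ discJ (V h) (L h) ∧
      ∀ φ ∈ discJ (V h) (L h), ⟪(l2Proj (discJ (V h) (L h)) g).1, φ.1⟫_ℝ = ⟪g, φ.1⟫_ℝ := by
  have := hF.finiteDimensional_discJ h0 h1
  exact l2Riesz_spec hΩ (discJ (V h) (L h)) (hF.discJ_le_H01 h0 h1)
    ((innerₛₗ ℝ g).comp (LinearMap.fst ℝ (L2 Ω Plane) (L2 Ω Mat)))

theorem IsFEFamily.discStokes_spec (hΩ : IsOpen Ω) (hF : IsFEFamily Ω C V L) {h : ℝ} (h0 : 0 < h)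
    (h1 : h < 1) (v : VField Ω) : discStokes (V h) (L h) v ∈ discJ (V h) (L h) ∧
      ∀ φ ∈ discJ (V h) (L h), ⟪(discStokes (V h) (L h) v).1, φ.1⟫_ℝ = ⟪v.2, φ.2⟫_ℝ := by
  have hfin := hF.finite_vel h h0 h1
  have h2 := l2Riesz_spec hΩ (V h) (hF.conforming h h0 h1)
    ((innerₛₗ ℝ v.2).comp (LinearMap.snd ℝ (L2 Ω Plane) (L2 Ω Mat)))
  have h3 := hF.l2Proj_spec hΩ h0 h1 (discNegLaplacian (V h) v).1
  exact ⟨h3.1, fun φ hφ => (h3.2 φ hφ).trans (h2.2 φ hφ.1)⟩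

/-- The discrete Stokes operator is linear and bounded. -/
theorem IsFEFamily.exists_discStokesL (hΩ : IsOpen Ω) (hF : IsFEFamily Ω C V L) (hC : 0 < C)
    {h : ℝ} (h0 : 0 < h) (h1 : h < 1) :
    ∃ A : VField Ω →L[ℝ] L2 Ω Plane, ∀ v, A v = (discStokes (V h) (L h) v).1 := by
  have hs := hF.discStokes_spec hΩ h0 h1
  have huniq : ∀ w ∈ discJ (V h) (L h), (∀ φ ∈ discJ (V h) (L h), ⟪w.1, φ.1⟫_ℝ = 0) → w = 0 :=
    fun w hw hwφ => H01.eq_zero hΩ (hF.discJ_le_H01 h0 h1 hw) (inner_self_eq_zero.1 (hwφ w hw))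
  let A : VField Ω →ₗ[ℝ] L2 Ω Plane :=
    { toFun := fun v => (discStokes (V h) (L h) v).1
      map_add' := fun v w => by
        have := huniq (discStokes (V h) (L h) (v + w) -
          (discStokes (V h) (L h) v + discStokes (V h) (L h) w))
          (sub_mem (hs _).1 (add_mem (hs _).1 (hs _).1)) fun φ hφ => by
            simp only [Prod.fst_sub, Prod.fst_add, inner_sub_left, inner_add_left]
            rw [(hs _).2 φ hφ, (hs _).2 φ hφ, (hs _).2 φ hφ]
            simp [inner_add_left]
        rw [sub_eq_zero.1 this]
        rfl
      map_smul' := fun r v => by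
        have := huniq (discStokes (V h) (L h) (r • v) - r • discStokes (V h) (L h) v)
          (sub_mem (hs _).1 (Submodule.smul_mem _ _ (hs _).1)) fun φ hφ => by
            simp only [Prod.fst_sub, Prod.smul_fst, inner_sub_left, real_inner_smul_left]
            rw [(hs _).2 φ hφ, (hs _).2 φ hφ]
            simp [real_inner_smul_left]
        rw [sub_eq_zero.1 this]
        rfl }
  refine ⟨A.mkContinuous (C * h⁻¹) fun v => ?_, fun v => rfl⟩
  have e1 := (hs v).2 _ (hs v).1
  have e2 := hF.inverse h h0 h1 _ (discJ_le _ _ (hs v).1)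
  set a := discStokes (V h) (L h) v with ha
  have e3 : A v = a.1 := rfl
  have e4 : ⟪v.2, a.2⟫_ℝ ≤ ‖v‖ * (C * h⁻¹ * ‖a.1‖) :=
    (real_inner_le_norm _ _).trans (mul_le_mul (norm_snd_le v) e2 (norm_nonneg _) (norm_nonneg _))
  rw [real_inner_self_eq_norm_sq] at e1
  rw [e3]
  rcases (norm_nonneg a.1).eq_or_lt with h | h
  · rw [← h]; positivity
  · refine le_of_mul_le_mul_left ?_ h
    nlinarith

/-- The discrete Stokes operator costs at most two powers of the mesh size. -/
theorem IsFEFamily.sq_mul_norm_discStokes_le (hΩ : IsOpen Ω) (hF : IsFEFamily Ω C V L) (hC : 0 < C)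
    {h : ℝ} (h0 : 0 < h) (h1 : h < 1) {u : VField Ω} (hu : u ∈ discJ (V h) (L h)) :
    h ^ 2 * ‖(discStokes (V h) (L h) u).1‖ ≤ C ^ 2 * ‖u.1‖ := by
  have hs := hF.discStokes_spec hΩ h0 h1 u
  have e1 := hs.2 _ hs.1
  have e2 := hF.inverse h h0 h1 _ (discJ_le _ _ hs.1)
  have e3 := hF.inverse h h0 h1 _ (discJ_le _ _ hu)
  set a := discStokes (V h) (L h) u with ha
  have e4 : ⟪u.2, a.2⟫_ℝ ≤ (C * h⁻¹ * ‖u.1‖) * (C * h⁻¹ * ‖a.1‖) :=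
    (real_inner_le_norm _ _).trans (mul_le_mul e3 e2 (norm_nonneg _) (by positivity))
  rw [real_inner_self_eq_norm_sq] at e1
  rcases (norm_nonneg a.1).eq_or_lt with h' | h'
  · rw [← h']
    simpa using mul_nonneg (sq_nonneg C) (norm_nonneg u.1)
  · refine le_of_mul_le_mul_left ?_ h'
    have e5 : ‖a.1‖ * (h ^ 2 * ‖a.1‖) = h ^ 2 * ‖a.1‖ ^ 2 := by ring
    have e6 : ‖a.1‖ * (C ^ 2 * ‖u.1‖) = h ^ 2 * ((C * h⁻¹ * ‖u.1‖) * (C * h⁻¹ * ‖a.1‖)) := by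
      field_simp
    rw [e5, e6]
    exact mul_le_mul_of_nonneg_left (e1.trans_le e4) (sq_nonneg h)

end

theorem norm_grad_le_discStokes (hΩ : IsOpen Ω) (hb : Bornology.IsBounded Ω) (C : ℝ) :
    ∃ c : ℝ, 0 < c ∧ ∀ V L, IsFEFamily Ω C V L → ∀ h, 0 < h → h < 1 →
      ∀ u ∈ discJ (V h) (L h), ‖u.2‖ ≤ c * ‖(discStokes (V h) (L h) u).1‖ := by
  obtain ⟨c, hc, hP⟩ := exists_poincare hΩ hb
  refine ⟨c, hc, fun V L hF h h0 h1 u hu => ?_⟩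
  have e1 := (hF.discStokes_spec hΩ h0 h1 u).2 u hu
  have e2 := hP u (hF.discJ_le_H01 h0 h1 hu)
  rw [real_inner_self_eq_norm_sq] at e1
  have e3 := real_inner_le_norm (discStokes (V h) (L h) u).1 u.1
  have e4 := mul_le_mul_of_nonneg_left e2 (norm_nonneg (discStokes (V h) (L h) u).1)
  rcases (norm_nonneg u.2).eq_or_lt with h' | h'
  · rw [← h']; positivity
  · refine le_of_mul_le_mul_left ?_ h'
    nlinarith

theorem h2norm_nonneg (v : VField Ω) (D : L2 Ω Ten) : 0 ≤ h2norm v D := Real.sqrt_nonneg _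

theorem h1norm_nonneg (q : L2 Ω ℝ) (g : L2 Ω Plane) : 0 ≤ h1norm q g := Real.sqrt_nonneg _

/-- What the Stokes regularity and the approximation properties give together: the solution of the
Stokes problem and its pressure are approximated to first order in the energy norm. -/
theorem IsFEFamily.exists_stokes_approx {C : ℝ} (hC : 0 < C) (hstokes : StokesRegular Ω C)
    {V : ℝ → Submodule ℝ (VField Ω)} {L : ℝ → Submodule ℝ (L2 Ω ℝ)} (hF : IsFEFamily Ω C V L)
    {h : ℝ} (h0 : 0 < h) (h1 : h < 1) (g : L2 Ω Plane) :
    ∃ v ∈ J1 Ω, ∃ (D : L2 Ω Ten) (q χ : L2 Ω ℝ), ∃ w ∈ discJ (V h) (L h),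
      (∀ φ ∈ H01 Ω, ⟪v.2, φ.2⟫_ℝ - ⟪q, divL Ω φ⟫_ℝ = ⟪g, φ.1⟫_ℝ) ∧ IsHessian v D ∧ χ ∈ L h ∧
      ‖D‖ ≤ C * ‖g‖ ∧ ‖q - χ‖ ≤ C ^ 2 * h * ‖g‖ ∧ ‖v.2 - w.2‖ ≤ C ^ 2 * h * ‖g‖ := by
  obtain ⟨v, hv, D, q, q', heq, hD, hq, hq0, hle⟩ := hstokes g
  obtain ⟨w, hw, hwb⟩ := hF.approx_div h h0 h1 v hv D hD
  obtain ⟨χ, hχ, hχb⟩ := hF.approx_pres h h0 h1 q q' hq hq0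
  have h2 := h2norm_nonneg v D
  have h3 := h1norm_nonneg q q'
  refine ⟨v, hv, D, q, χ, w, hw, heq, hD, hχ, ?_, ?_, ?_⟩
  · linarith [norm_hess_le_h2norm (v := v) (D := D)]
  · calc _ ≤ _ := hχb
      _ ≤ C * h * (C * ‖g‖) := by gcongr; linarith
      _ = _ := by ring
  · have h4 : h * ‖v.2 - w.2‖ ≤ h * (C ^ 2 * h * ‖g‖) := by
      calc h * ‖v.2 - w.2‖ ≤ C * h ^ 2 * h2norm v D := by linarith [norm_nonneg (v.1 - w.1)]
        _ ≤ C * h ^ 2 * (C * ‖g‖) := by gcongr; linarith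
        _ = _ := by ring
    exact le_of_mul_le_mul_left h4 h0

/-- The duality argument of Aubin and Nitsche for the Stokes problem. -/
theorem exists_duality {C : ℝ} (hC : 0 < C) (hstokes : StokesRegular Ω C) :
    ∃ c : ℝ, 0 < c ∧ ∀ V L, IsFEFamily Ω C V L → ∀ h, 0 < h → h < 1 → ∀ e ∈ H01 Ω, ∀ G : ℝ,
      ‖e.2‖ ≤ G → (∀ χ ∈ L h, ⟪χ, divL Ω e⟫_ℝ = 0) →
      (∀ φ ∈ discJ (V h) (L h), |⟪e.2, φ.2⟫_ℝ| ≤ G * ‖divL Ω φ‖) → ‖e.1‖ ≤ c * h * G := by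
  set d := ‖divL Ω‖ with hd
  have hd0 : 0 ≤ d := norm_nonneg _
  refine ⟨C ^ 2 * (2 * d + 1), by positivity, fun V L hF h h0 h1 e he G hG hdiv horth => ?_⟩
  obtain ⟨z, hz, -, r, χ, w, hw, heq, -, hχ, -, hrχ, hzw⟩ :=
    hF.exists_stokes_approx hC hstokes h0 h1 e.1
  set E := ‖e.1‖ with hE
  have hG0 : 0 ≤ G := (norm_nonneg _).trans hG
  have e1 := heq e he
  rw [real_inner_self_eq_norm_sq] at e1
  have e2 : ⟪r, divL Ω e⟫_ℝ = ⟪r - χ, divL Ω e⟫_ℝ := by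
    rw [inner_sub_left, hdiv χ hχ, sub_zero]
  have e3 : |⟪r - χ, divL Ω e⟫_ℝ| ≤ C ^ 2 * h * E * (d * G) :=
    (abs_real_inner_le_norm _ _).trans (mul_le_mul hrχ
      ((norm_divL_le e).trans (mul_le_mul_of_nonneg_left hG hd0)) (norm_nonneg _)
      (by positivity))
  have e4 : ⟪z.2, e.2⟫_ℝ = ⟪z.2 - w.2, e.2⟫_ℝ + ⟪e.2, w.2⟫_ℝ := by
    rw [inner_sub_left, real_inner_comm e.2 w.2]; ring
  have e5 : |⟪z.2 - w.2, e.2⟫_ℝ| ≤ C ^ 2 * h * E * G :=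
    (abs_real_inner_le_norm _ _).trans (mul_le_mul hzw hG (norm_nonneg _) (by positivity))
  have e6 : |⟪e.2, w.2⟫_ℝ| ≤ G * (d * (C ^ 2 * h * E)) := by
    refine (horth w hw).trans (mul_le_mul_of_nonneg_left ?_ hG0)
    -- `z` is divergence free, so the divergence of `w` is of the size of the approximation error
    have h2 : divL Ω w = divL Ω (w - z) := by rw [map_sub, divL_eq_zero hz, sub_zero]
    rw [h2]
    refine (norm_divL_le _).trans (mul_le_mul_of_nonneg_left ?_ hd0)
    rw [Prod.snd_sub, norm_sub_rev]
    exact hzw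
  have e7 : E * E ≤ E * (C ^ 2 * (2 * d + 1) * h * G) := by
    have h3 := le_abs_self ⟪z.2 - w.2, e.2⟫_ℝ
    have h4 := le_abs_self ⟪e.2, w.2⟫_ℝ
    have h5 := neg_abs_le ⟪r - χ, divL Ω e⟫_ℝ
    nlinarith
  rcases (norm_nonneg e.1).eq_or_lt with h' | h'
  · rw [hE, ← h']; positivity
  · exact le_of_mul_le_mul_left e7 h'

/-- A discrete field `u` is close, relative to the discrete Stokes operator, to the solution of the
continuous Stokes problem with the same right-hand side. -/
theorem exists_stokes_lift {C : ℝ} (hC : 0 < C) (hΩ : IsOpen Ω) (hstokes : StokesRegular Ω C) :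
    ∃ c : ℝ, 0 < c ∧ ∀ V L, IsFEFamily Ω C V L → ∀ h, 0 < h → h < 1 →
      ∀ u ∈ discJ (V h) (L h), ∃ p ∈ H2 Ω,
        ‖u.1 - p.1.1‖ ≤ c * h ^ 2 * ‖(discStokes (V h) (L h) u).1‖ ∧
        ‖p.2‖ ≤ c * ‖(discStokes (V h) (L h) u).1‖ := by
  obtain ⟨c, hc, hdual⟩ := exists_duality hC hstokes
  set d := ‖divL Ω‖ with hd
  have hd0 : 0 ≤ d := norm_nonneg _
  refine ⟨c * (C ^ 2 * (d + 2)) + C, by positivity, fun V L hF h h0 h1 u hu => ?_⟩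
  have hA := hF.discStokes_spec hΩ h0 h1 u
  set g := (discStokes (V h) (L h) u).1 with hg
  obtain ⟨v, hv, D, q, χ, w, hw, heq, hD, hχ, hDb, hqχ, hvw⟩ :=
    hF.exists_stokes_approx hC hstokes h0 h1 g
  have hH := hF.discJ_le_H01 h0 h1
  have horth : ∀ φ ∈ discJ (V h) (L h), |⟪(u - v).2, φ.2⟫_ℝ| ≤ C ^ 2 * h * ‖g‖ * ‖divL Ω φ‖ := by
    intro φ hφ
    have h2 := heq φ (hH hφ)
    have h3 := hA.2 φ hφ
    have h4 : ⟪(u - v).2, φ.2⟫_ℝ = -⟪q - χ, divL Ω φ⟫_ℝ := by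
      rw [Prod.snd_sub, inner_sub_left, inner_sub_left, inner_divL_eq_zero hφ hχ, ← h3, ← h2]
      ring
    rw [h4, abs_neg]
    exact (abs_real_inner_le_norm _ _).trans (mul_le_mul_of_nonneg_right hqχ (norm_nonneg _))
  have hgrad : ‖(u - v).2‖ ≤ C ^ 2 * (d + 2) * h * ‖g‖ := by
    have hφ : u - w ∈ discJ (V h) (L h) := sub_mem hu hw
    set φ := u - w with hφd
    have h2 : ⟪φ.2, φ.2⟫_ℝ = ⟪(u - v).2, φ.2⟫_ℝ + ⟪v.2 - w.2, φ.2⟫_ℝ := by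
      rw [← inner_add_left]
      congr 1
      simp only [hφd, Prod.snd_sub]
      abel
    have h3 := (le_abs_self _).trans (horth φ hφ)
    have h4 : ⟪v.2 - w.2, φ.2⟫_ℝ ≤ C ^ 2 * h * ‖g‖ * ‖φ.2‖ :=
      (real_inner_le_norm _ _).trans (mul_le_mul_of_nonneg_right hvw (norm_nonneg _))
    have h5 : C ^ 2 * h * ‖g‖ * ‖divL Ω φ‖ ≤ C ^ 2 * h * ‖g‖ * (d * ‖φ.2‖) :=
      mul_le_mul_of_nonneg_left (norm_divL_le φ) (by positivity)
    rw [real_inner_self_eq_norm_sq] at h2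
    have h6 : ‖φ.2‖ ≤ C ^ 2 * (d + 1) * h * ‖g‖ := by
      rcases (norm_nonneg φ.2).eq_or_lt with h' | h'
      · rw [← h']; positivity
      · refine le_of_mul_le_mul_left ?_ h'
        nlinarith
    have h7 : (u - v).2 = φ.2 - (v.2 - w.2) := by
      simp only [hφd, Prod.snd_sub]
      abel
    rw [h7]
    refine (norm_sub_le _ _).trans ?_
    nlinarith
  set G := C ^ 2 * (d + 2) * h * ‖g‖ with hG
  have hCG : C ^ 2 * h * ‖g‖ ≤ G := by
    have : 0 ≤ C ^ 2 * h * ‖g‖ := by positivity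
    rw [hG]
    nlinarith
  have hvel := hdual V L hF h h0 h1 (u - v) (sub_mem (hH hu) hv.1) G hgrad
    (fun χ hχ => by rw [map_sub, divL_eq_zero hv, sub_zero]; exact inner_divL_eq_zero hu hχ)
    (fun φ hφ => (horth φ hφ).trans (mul_le_mul_of_nonneg_right hCG (norm_nonneg _)))
  refine ⟨(v, D), ⟨hv.1, hD⟩, ?_, ?_⟩
  · rw [Prod.fst_sub] at hvel
    refine hvel.trans ?_
    have : 0 ≤ C * (h ^ 2 * ‖g‖) := by positivity
    rw [hG]
    nlinarith
  · refine hDb.trans (mul_le_mul_of_nonneg_right ?_ (norm_nonneg _))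
    have : 0 ≤ c * (C ^ 2 * (d + 2)) := by positivity
    linarith

/-- The discrete Agmon inequality. -/
theorem exists_discrete_agmon {C : ℝ} (hC : 0 < C) (hΩ : IsOpen Ω) (hb : Bornology.IsBounded Ω)
    (hlip : IsLipschitzDomain Ω) (hstokes : StokesRegular Ω C) :
    ∃ c : ℝ, 0 < c ∧ ∀ V L, IsFEFamily Ω C V L → ∀ h, 0 < h → h < 1 →
      ∀ u ∈ discJ (V h) (L h), ∀ᵐ x ∂(volume.restrict Ω),
        ‖(u.1 : Plane → Plane) x‖ ^ 2 ≤ c * (‖u.1‖ * ‖(discStokes (V h) (L h) u).1‖) := by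
  obtain ⟨c, hc, hlift⟩ := exists_stokes_lift hC hΩ hstokes
  obtain ⟨B, hB, hsup⟩ := exists_sup_bound hΩ hb hlip hC
  refine ⟨2 * (20 * (1 + c * C ^ 2) * c) + 2 * (B * (2 * c)) ^ 2 * C ^ 2, by positivity,
    fun V L hF h h0 h1 u hu => ?_⟩
  obtain ⟨p, hp, hp1, hp2⟩ := hlift V L hF h h0 h1 u hu
  have hinv := hF.sq_mul_norm_discStokes_le hΩ hC h0 h1 hu
  filter_upwards [hsup V L hF h h0 h1 u (discJ_le _ _ hu) p hp, agmon hΩ hb hp.1 hp.2]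
    with x hx1 hx2
  set a := ‖(discStokes (V h) (L h) u).1‖ with ha
  have ha0 : 0 ≤ a := norm_nonneg _
  set y := ‖u.1‖ with hy
  have hy0 : 0 ≤ y := norm_nonneg _
  have h2 : scaleErr h u p ≤ 2 * c * (h * a) := by
    have e1 : h⁻¹ * ‖u.1 - p.1.1‖ ≤ c * (h * a) := by
      rw [inv_mul_le_iff₀ h0]
      linarith
    have e2 : h * ‖p.2‖ ≤ h * (c * a) := mul_le_mul_of_nonneg_left hp2 h0.le
    unfold scaleErr
    linarith
  have h3 : ‖p.1.1‖ ≤ (1 + c * C ^ 2) * y := by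
    have e1 : ‖p.1.1‖ ≤ y + ‖u.1 - p.1.1‖ := by
      rw [norm_sub_rev]; exact norm_le_norm_add_norm_sub' _ _
    have e2 := mul_le_mul_of_nonneg_left hinv hc.le
    linarith
  have h4 : ‖p.1.1‖ * ‖p.2‖ ≤ (1 + c * C ^ 2) * y * (c * a) :=
    mul_le_mul h3 hp2 (norm_nonneg _) (by positivity)
  -- by the inverse inequality `h² ‖Au‖ ≤ C² ‖u‖`, so the squared error `(h ‖Au‖)²` is absorbed
  -- in the product `‖u‖ ‖Au‖`
  have h5 : (B * scaleErr h u p) ^ 2 ≤ (B * (2 * c)) ^ 2 * C ^ 2 * (y * a) := by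
    have e1 : B * scaleErr h u p ≤ B * (2 * c * (h * a)) := mul_le_mul_of_nonneg_left h2 hB.le
    have e0 : 0 ≤ B * scaleErr h u p := mul_nonneg hB.le (scaleErr_nonneg h0 u p)
    refine (pow_le_pow_left₀ e0 e1 2).trans ?_
    have e2 : (B * (2 * c * (h * a))) ^ 2 = (B * (2 * c)) ^ 2 * ((h ^ 2 * a) * a) := by ring
    have e3 : (h ^ 2 * a) * a ≤ C ^ 2 * y * a := mul_le_mul_of_nonneg_right hinv ha0
    rw [e2]
    have := mul_le_mul_of_nonneg_left e3 (sq_nonneg (B * (2 * c)))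
    linarith
  have h6 := pow_le_pow_left₀ (norm_nonneg _) hx1 2
  set X := ‖(p.1.1 : Plane → Plane) x‖
  nlinarith [sq_nonneg (X - B * scaleErr h u p)]

/-- The `L²` projection onto the discrete divergence free fields is stable in `H¹` on `J₁`. -/
theorem exists_norm_grad_l2Proj_le {C : ℝ} (hC : 0 < C) (hΩ : IsOpen Ω)
    (hstokes : StokesRegular Ω C) :
    ∃ c : ℝ, 0 < c ∧ ∀ V L, IsFEFamily Ω C V L → ∀ h, 0 < h → h < 1 →
      ∀ u ∈ J1 Ω, ‖(l2Proj (discJ (V h) (L h)) u.1).2‖ ≤ c * ‖u.2‖ := by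
  obtain ⟨c, hc, hdual⟩ := exists_duality hC hstokes
  refine ⟨1 + C * c, by positivity, fun V L hF h h0 h1 u hu => ?_⟩
  have hfin := hF.finiteDimensional_discJ h0 h1
  have hP := hF.l2Proj_spec hΩ h0 h1 u.1
  set P := l2Proj (discJ (V h) (L h)) u.1 with hPd
  -- the Ritz projection of `u`
  obtain ⟨y, hy, z, hz, hyz⟩ := Submodule.exists_add_mem_mem_orthogonal (K :=
    (discJ (V h) (L h)).map (LinearMap.snd ℝ (L2 Ω Plane) (L2 Ω Mat))) u.2
  obtain ⟨R, hR, rfl⟩ := hy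
  have hRz : (u - R).2 = z := by
    rw [Prod.snd_sub, hyz]
    simp
  have horth : ∀ φ ∈ discJ (V h) (L h), ⟪(u - R).2, φ.2⟫_ℝ = 0 := fun φ hφ => by
    rw [hRz, real_inner_comm]
    exact (Submodule.mem_orthogonal _ _).1 hz _ ⟨φ, hφ, rfl⟩
  have hsplit : ‖u.2‖ ^ 2 = ‖R.2‖ ^ 2 + ‖(u - R).2‖ ^ 2 := by
    have e1 : u.2 = R.2 + (u - R).2 := by simp
    rw [e1, norm_add_sq_real, real_inner_comm, horth R hR]
    simp
  have h2 : ‖R.2‖ ≤ ‖u.2‖ := by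
    refine abs_le_of_sq_le_sq' ?_ (norm_nonneg _) |>.2
    nlinarith [sq_nonneg ‖(u - R).2‖]
  have h3 : ‖(u - R).2‖ ≤ ‖u.2‖ := by
    refine abs_le_of_sq_le_sq' ?_ (norm_nonneg _) |>.2
    nlinarith [sq_nonneg ‖R.2‖]
  have h4 := hdual V L hF h h0 h1 (u - R) (sub_mem hu.1 (hF.discJ_le_H01 h0 h1 hR)) ‖u.2‖ h3
    (fun χ hχ => by
      rw [map_sub, divL_eq_zero hu, zero_sub, inner_neg_right, inner_divL_eq_zero hR hχ, neg_zero])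
    (fun φ hφ => by rw [horth φ hφ, abs_zero]; positivity)
  have h5 : ‖(P - R).1‖ ≤ ‖(u - R).1‖ := by
    have e1 := hP.2 (P - R) (sub_mem hP.1 hR)
    have e2 : ⟪(P - R).1, (P - R).1⟫_ℝ = ⟪(u - R).1, (P - R).1⟫_ℝ := by
      rw [Prod.fst_sub, Prod.fst_sub, inner_sub_left, inner_sub_left]
      rw [Prod.fst_sub] at e1
      rw [e1]
    rw [real_inner_self_eq_norm_sq] at e2
    have e3 := real_inner_le_norm (u - R).1 (P - R).1
    rcases (norm_nonneg (P - R).1).eq_or_lt with h' | h'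
    · rw [← h']; positivity
    · refine le_of_mul_le_mul_right ?_ h'
      nlinarith
  have h6 := hF.inverse h h0 h1 (P - R) (discJ_le _ _ (sub_mem hP.1 hR))
  have h7 : C * h⁻¹ * ‖(P - R).1‖ ≤ C * c * ‖u.2‖ := by
    refine (mul_le_mul_of_nonneg_left (h5.trans h4) (by positivity)).trans (le_of_eq ?_)
    field_simp
  have h8 : ‖P.2‖ ≤ ‖R.2‖ + ‖(P - R).2‖ := by
    rw [Prod.snd_sub]; exact norm_le_norm_add_norm_sub' _ _
  linarith

/-! ### The convection form -/

theorem memLp_bound_mul {a b : Plane → ℝ} {B : ℝ} (ha : MemLp a 2 (volume.restrict Ω))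
    (hb : MemLp b 2 (volume.restrict Ω)) (hB : ∀ᵐ x ∂(volume.restrict Ω), |a x| ≤ B) :
    MemLp (fun x => a x * b x) 2 (volume.restrict Ω) := by
  refine MemLp.of_le_mul (c := B) hb (ha.1.mul hb.1) ?_
  filter_upwards [hB] with x hx
  rw [norm_mul]
  exact mul_le_mul_of_nonneg_right hx (norm_nonneg _)

theorem abs_integral_bound_mul_mul_le {a b c : Plane → ℝ} {B M N : ℝ}
    (ha : MemLp a 2 (volume.restrict Ω)) (hb : MemLp b 2 (volume.restrict Ω))
    (hc : MemLp c 2 (volume.restrict Ω)) (hB : ∀ᵐ x ∂(volume.restrict Ω), |a x| ≤ B)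
    (hB0 : 0 ≤ B) (hM : 0 ≤ M) (hN : 0 ≤ N) (hbM : ∫ x in Ω, b x ^ 2 ≤ M ^ 2)
    (hcN : ∫ x in Ω, c x ^ 2 ≤ N ^ 2) : |∫ x in Ω, a x * b x * c x| ≤ B * M * N := by
  have hab := memLp_bound_mul ha hb hB
  refine abs_integral_mul_le hab hc (by positivity) hN ?_ hcN
  calc ∫ x in Ω, (a x * b x) ^ 2 ≤ ∫ x in Ω, B ^ 2 * b x ^ 2 := by
        refine integral_mono_ae hab.integrable_sq (hb.integrable_sq.const_mul _) ?_
        filter_upwards [hB] with x hx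
        rw [mul_pow]
        exact mul_le_mul_of_nonneg_right (sq_le_sq' (neg_le_of_abs_le hx) (le_of_abs_le hx))
          (sq_nonneg _)
    _ = B ^ 2 * ∫ x in Ω, b x ^ 2 := integral_const_mul _ _
    _ ≤ (B * M) ^ 2 := by rw [mul_pow]; gcongr

theorem exists_bound_of_isTest {ψ : Plane → ℝ} (hψ : IsTest Ω ψ) (j : Fin 2) :
    ∃ B : ℝ, (∀ x, |ψ x| ≤ B) ∧ ∀ x, |partialD j ψ x| ≤ B := by
  obtain ⟨B₁, h1⟩ := hψ.2.1.exists_bound_of_continuous hψ.1.continuous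
  obtain ⟨B₂, h2⟩ := (hasCompactSupport_partialD hψ.2.1 j).exists_bound_of_continuous
    (contDiff_partialD hψ.1 j).continuous
  exact ⟨max B₁ B₂, fun x => (h1 x).trans (le_max_left _ _),
    fun x => (h2 x).trans (le_max_right _ _)⟩

/-- The weak derivative of a product of components of a bounded `H₀¹` field. -/
theorem isWeakPartial_vel_mul_vel (hΩ : IsOpen Ω) {u : VField Ω} (hu : u ∈ H01 Ω) (i j k : Fin 2)
    {B : ℝ}
    (hB : ∀ i, ∀ᵐ x ∂(volume.restrict Ω), |(u.1 : Plane → Plane) x i| ≤ B) :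
    IsWeakPartial Ω j
      (fun x => (u.1 : Plane → Plane) x i * (u.1 : Plane → Plane) x k)
      (fun x => (u.1 : Plane → Plane) x i * (u.2 : Plane → Mat) x (k, j) +
        (u.1 : Plane → Plane) x k * (u.2 : Plane → Mat) x (i, j)) := by
  intro ψ hψ
  obtain ⟨A, hA1, hA2⟩ := exists_bound_of_isTest hψ j
  have h := integral_product_rule hΩ (memLp_vel i u) (memLp_grad i j u)
    (H01.isWeakPartial hu i j) hu k hψ.1 (fun x _ => hA1 x) (fun x _ => hA2 x)
  have i1 : Integrable (fun x => (u.1 : Plane → Plane) x i * (u.2 : Plane → Mat) x (k, j) * ψ x)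
      (volume.restrict Ω) :=
    (memLp_bound_mul (memLp_vel i u) (memLp_grad k j u) (hB i)).integrable_mul hψ.memLp
  have i2 : Integrable (fun x => (u.1 : Plane → Plane) x k * (u.2 : Plane → Mat) x (i, j) * ψ x)
      (volume.restrict Ω) :=
    (memLp_bound_mul (memLp_vel k u) (memLp_grad i j u) (hB k)).integrable_mul hψ.memLp
  have e : ∫ x in Ω, ((u.1 : Plane → Plane) x i * (u.2 : Plane → Mat) x (k, j) +
      (u.1 : Plane → Plane) x k * (u.2 : Plane → Mat) x (i, j)) * ψ x =
      (∫ x in Ω, (u.1 : Plane → Plane) x i * (u.2 : Plane → Mat) x (k, j) * ψ x) +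
      ∫ x in Ω, (u.1 : Plane → Plane) x k * (u.2 : Plane → Mat) x (i, j) * ψ x := by
    rw [← integral_add i1 i2]
    simp_rw [add_mul]
  rw [e]
  have e1 : (fun x => (u.1 : Plane → Plane) x i * (u.1 : Plane → Plane) x k * partialD j ψ x) =
      fun x => (u.1 : Plane → Plane) x i * partialD j ψ x * (u.1 : Plane → Plane) x k := by
    ext x; ring
  have e2 : (fun x => (u.1 : Plane → Plane) x i * (u.2 : Plane → Mat) x (k, j) * ψ x) =
      fun x => (u.1 : Plane → Plane) x i * ψ x * (u.2 : Plane → Mat) x (k, j) := by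
    ext x; ring
  have e3 : (fun x => (u.1 : Plane → Plane) x k * (u.2 : Plane → Mat) x (i, j) * ψ x) =
      fun x => (u.2 : Plane → Mat) x (i, j) * ψ x * (u.1 : Plane → Plane) x k := by
    ext x; ring
  rw [e1, e2, e3]
  linarith

/-- The convection form of a bounded field, with the derivative moved off the test field. -/
theorem abs_bForm_le (hΩ : IsOpen Ω) {u φ : VField Ω} (hu : u ∈ H01 Ω) (hφ : φ ∈ H01 Ω) {B : ℝ}
    (hB0 : 0 ≤ B) (hB : ∀ᵐ x ∂(volume.restrict Ω), ‖(u.1 : Plane → Plane) x‖ ≤ B) :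
    |bForm u u φ| ≤ 6 * (B * ‖u.2‖ * ‖φ.1‖) := by
  have hBi : ∀ i, ∀ᵐ x ∂(volume.restrict Ω), |(u.1 : Plane → Plane) x i| ≤ B := fun i => by
    filter_upwards [hB] with x hx
    exact (PiLp.norm_apply_le _ i).trans hx
  have muv : ∀ i k : Fin 2, MemLp (fun x => (u.1 : Plane → Plane) x i * (u.1 : Plane → Plane) x k)
      2 (volume.restrict Ω) := fun i k =>
    memLp_bound_mul (memLp_vel i u) (memLp_vel k u) (hBi i)
  have mug : ∀ k i j : Fin 2, MemLp
      (fun x => (u.1 : Plane → Plane) x k * (u.2 : Plane → Mat) x (i, j))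
      2 (volume.restrict Ω) := fun k i j =>
    memLp_bound_mul (memLp_vel k u) (memLp_grad i j u) (hBi k)
  have ib : ∀ k i j l : Fin 2, |∫ x in Ω, (u.1 : Plane → Plane) x k * (u.2 : Plane → Mat) x (i, j) *
      (φ.1 : Plane → Plane) x l| ≤ B * ‖u.2‖ * ‖φ.1‖ := fun k i j l =>
    abs_integral_bound_mul_mul_le (memLp_vel k u) (memLp_grad i j u) (memLp_vel l φ) (hBi k) hB0
      (norm_nonneg _) (norm_nonneg _) (integral_sq_le_norm_sq _ _) (integral_sq_le_norm_sq _ _)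
  have ii : ∀ k i j l : Fin 2, Integrable (fun x => (u.1 : Plane → Plane) x k *
      (u.2 : Plane → Mat) x (i, j) * (φ.1 : Plane → Plane) x l) (volume.restrict Ω) :=
    fun k i j l => (mug k i j).integrable_mul (memLp_vel l φ)
  set T := B * ‖u.2‖ * ‖φ.1‖ with hT
  have h1 : |convect u u φ| ≤ 4 * T := by
    have e : convect u u φ = ∑ i, ∑ j, ∫ x in Ω, (u.1 : Plane → Plane) x j *
        (u.2 : Plane → Mat) x (i, j) * (φ.1 : Plane → Plane) x i := by
      unfold convect
      rw [integral_finsetSum _ fun i _ => integrable_finsetSum _ fun j _ => ii j i j i]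
      exact Finset.sum_congr rfl fun i _ => integral_finsetSum _ fun j _ => ii j i j i
    rw [e]
    refine (Finset.abs_sum_le_sum_abs _ _).trans ((Finset.sum_le_sum fun i _ =>
      (Finset.abs_sum_le_sum_abs _ _).trans (Finset.sum_le_sum fun j _ => ib j i j i)).trans ?_)
    simp only [Fin.sum_univ_two]
    linarith
  have h2 : |convect u φ u| ≤ 8 * T := by
    have i3 : ∀ i j : Fin 2, Integrable (fun x => (u.1 : Plane → Plane) x j *
        (φ.2 : Plane → Mat) x (i, j) * (u.1 : Plane → Plane) x i) (volume.restrict Ω) :=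
      fun i j => (memLp_bound_mul (memLp_vel j u) (memLp_grad i j φ) (hBi j)).integrable_mul
        (memLp_vel i u)
    have hb3 : ∀ i j : Fin 2, |∫ x in Ω, (u.1 : Plane → Plane) x j *
        (φ.2 : Plane → Mat) x (i, j) * (u.1 : Plane → Plane) x i| ≤ 2 * T := by
      intro i j
      have hd : ∀ x, partialD j (fun _ : Plane => (1 : ℝ)) x = 0 := fun x => by simp [partialD]
      have h := integral_product_rule hΩ (muv i j) ((mug i j j).add (mug j i j))
        (isWeakPartial_vel_mul_vel hΩ hu i j j hBi) hφ i (ψ := fun _ => 1) contDiff_const (B := 1)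
        (fun x _ => by simp) (fun x _ => by rw [hd]; simp)
      simp only [hd, mul_zero, zero_mul, integral_zero, zero_add, mul_one, Pi.add_apply] at h
      have e1 : (fun x => (u.1 : Plane → Plane) x j * (φ.2 : Plane → Mat) x (i, j) *
          (u.1 : Plane → Plane) x i) = fun x => (u.1 : Plane → Plane) x i *
          (u.1 : Plane → Plane) x j * (φ.2 : Plane → Mat) x (i, j) := by
        ext x; ring
      simp_rw [add_mul] at h
      rw [integral_add (ii i j j i) (ii j i j i)] at h
      rw [e1]
      have h3 := abs_le.1 (ib i j j i)
      have h4 := abs_le.1 (ib j i j i)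
      rw [abs_le]
      constructor <;> linarith [h3.1, h3.2, h4.1, h4.2]
    have e : convect u φ u = ∑ i, ∑ j, ∫ x in Ω, (u.1 : Plane → Plane) x j *
        (φ.2 : Plane → Mat) x (i, j) * (u.1 : Plane → Plane) x i := by
      unfold convect
      rw [integral_finsetSum _ fun i _ => integrable_finsetSum _ fun j _ => i3 i j]
      exact Finset.sum_congr rfl fun i _ => integral_finsetSum _ fun j _ => i3 i j
    rw [e]
    refine (Finset.abs_sum_le_sum_abs _ _).trans ((Finset.sum_le_sum fun i _ =>
      (Finset.abs_sum_le_sum_abs _ _).trans (Finset.sum_le_sum fun j _ => hb3 i j)).trans ?_)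
    simp only [Fin.sum_univ_two]
    linarith
  have h3 := abs_le.1 h1
  have h4 := abs_le.1 h2
  unfold bForm
  rw [abs_le]
  constructor <;> linarith [h3.1, h3.2, h4.1, h4.2]

theorem bForm_self (v w : VField Ω) : bForm v w w = 0 := by
  unfold bForm; ring

/-- In two dimensions the discrete Agmon inequality controls the convection term by the discrete
Stokes operator. -/
theorem exists_abs_bForm_le {C : ℝ} (hC : 0 < C) (hΩ : IsOpen Ω) (hb : Bornology.IsBounded Ω)
    (hlip : IsLipschitzDomain Ω) (hstokes : StokesRegular Ω C) :
    ∃ c : ℝ, 0 < c ∧ ∀ V L, IsFEFamily Ω C V L → ∀ h, 0 < h → h < 1 →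
      ∀ u ∈ discJ (V h) (L h), ∀ φ ∈ H01 Ω,
        (bForm u u φ) ^ 2 ≤
          c * (‖u.1‖ * ‖(discStokes (V h) (L h) u).1‖) * ‖u.2‖ ^ 2 * ‖φ.1‖ ^ 2 := by
  obtain ⟨c, hc, hA⟩ := exists_discrete_agmon hC hΩ hb hlip hstokes
  refine ⟨36 * c, by positivity, fun V L hF h h0 h1 u hu φ hφ => ?_⟩
  set S := c * (‖u.1‖ * ‖(discStokes (V h) (L h) u).1‖) with hS
  have hS0 : 0 ≤ S := by positivity
  have hB : ∀ᵐ x ∂(volume.restrict Ω), ‖(u.1 : Plane → Plane) x‖ ≤ √S := by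
    filter_upwards [hA V L hF h h0 h1 u hu] with x hx
    exact Real.le_sqrt_of_sq_le hx
  have h2 := abs_bForm_le hΩ (hF.discJ_le_H01 h0 h1 hu) hφ (Real.sqrt_nonneg S) hB
  rw [← sq_abs]
  refine (pow_le_pow_left₀ (abs_nonneg _) h2 2).trans (le_of_eq ?_)
  rw [mul_pow, mul_pow, mul_pow, Real.sq_sqrt hS0, hS]
  ring

/-! ### Energy identities of the semidiscrete problems -/

/-- The derivative of a curve in a closed subspace lies in the subspace. -/
theorem deriv_mem_of_isClosed {E : Type*} [NormedAddCommGroup E] [NormedSpace ℝ E]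
    {J : Submodule ℝ E} (hJ : IsClosed (J : Set E)) {u : ℝ → E} {t : ℝ} {u' : E}
    (hu : ∀ᶠ s in nhds t, u s ∈ J) (hd : HasDerivAt u u' t) : u' ∈ J := by
  refine hJ.mem_of_tendsto (hasDerivAt_iff_tendsto_slope.1 hd) ?_
  filter_upwards [nhdsWithin_le_nhds hu] with s hs
  exact J.smul_mem _ (J.sub_mem hs hu.self_of_nhds)

/-- The memory term `w(t) = ∫₀ᵗ γ e^{-δ(t-s)} u(s) ds` solves `w' = γ u - δ w`. -/
theorem exists_memory {E : Type*} [NormedAddCommGroup E] [NormedSpace ℝ E] [CompleteSpace E]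
    (γ δ : ℝ) {u : ℝ → E} {τ : ℝ} (hτ : 0 ≤ τ) (hu : ContinuousOn u (Icc 0 τ)) :
    ∃ w : ℝ → E, w 0 = 0 ∧ ContinuousOn w (Icc 0 τ) ∧
      (∀ t ∈ Ioo 0 τ, HasDerivAt w (γ • u t - δ • w t) t) ∧
      ∀ ℓ : E →L[ℝ] ℝ, ∀ t ∈ Ioo 0 τ,
        ℓ (w t) = ∫ s in (0 : ℝ)..t, γ * Real.exp (-δ * (t - s)) * ℓ (u s) := by
  set g : ℝ → E := fun s => (γ * Real.exp (δ * s)) • u s with hg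
  have hgc : ContinuousOn g (Icc 0 τ) := ContinuousOn.smul (by fun_prop) hu
  have hgi : ∀ t ∈ Icc 0 τ, IntervalIntegrable g volume 0 t := fun t ht =>
    (hgc.mono (by rw [uIcc_of_le ht.1]; exact Icc_subset_Icc_right ht.2)).intervalIntegrable
  refine ⟨fun t => Real.exp (-δ * t) • ∫ s in (0 : ℝ)..t, g s, by simp, ?_, ?_, ?_⟩
  · refine ContinuousOn.smul (by fun_prop) ?_
    have := intervalIntegral.continuousOn_primitive_interval (a := 0) (b := τ) (f := g)
      (μ := volume) (by rw [uIcc_of_le hτ]; exact hgc.integrableOn_Icc)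
    rwa [uIcc_of_le hτ] at this
  · intro t ht
    have h1 : HasDerivAt (fun t => ∫ s in (0 : ℝ)..t, g s) (g t) t :=
      intervalIntegral.integral_hasDerivAt_right (hgi t ⟨ht.1.le, ht.2.le⟩)
        ((hgc.mono Ioo_subset_Icc_self).stronglyMeasurableAtFilter isOpen_Ioo t ht)
        (hgc.continuousAt (Icc_mem_nhds ht.1 ht.2))
    have h2 : HasDerivAt (fun t => Real.exp (-δ * t)) (Real.exp (-δ * t) * (-δ)) t := by
      have := ((hasDerivAt_id t).const_mul (-δ)).exp
      simpa using this
    refine (h2.smul h1).congr_deriv ?_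
    have e : Real.exp (-δ * t) * Real.exp (δ * t) = 1 := by
      rw [← Real.exp_add]; simp
    simp only [hg, smul_smul]
    rw [show Real.exp (-δ * t) * (γ * Real.exp (δ * t)) =
      γ * (Real.exp (-δ * t) * Real.exp (δ * t)) by ring, e, mul_one, sub_eq_add_neg, ← neg_smul]
    congr 2
    ring
  · intro ℓ t ht
    simp only [map_smul]
    rw [← ℓ.intervalIntegral_comp_comm (hgi t ⟨ht.1.le, ht.2.le⟩), smul_eq_mul,
      ← intervalIntegral.integral_const_mul]
    refine intervalIntegral.integral_congr fun s _ => ?_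
    simp only [hg, map_smul, smul_eq_mul]
    rw [show -δ * (t - s) = -δ * t + δ * s by ring, Real.exp_add]
    ring

theorem hasDerivAt_half_norm_sq {F : Type*} [NormedAddCommGroup F] [InnerProductSpace ℝ F]
    {u : ℝ → F} {u' : F} {t : ℝ} (h : HasDerivAt u u' t) (k : ℝ) :
    HasDerivAt (fun s => k * ‖u s‖ ^ 2) (2 * k * ⟪u t, u'⟫_ℝ) t := by
  refine (h.norm_sq.const_mul k).congr_deriv ?_
  ring

/-- The energy identities of a semidiscrete Oldroyd problem, obtained by testing with the solution
and with its discrete Stokes image `a u`. The functions `m` and `M` are the energies stored in the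
memory term. -/
theorem Solves.exists_energy {μ γ δ : ℝ} (hγ : 0 < γ) {T : EReal} {f : ℝ → L2 Ω Plane}
    {J : Submodule ℝ (VField Ω)} (hJ : IsClosed (J : Set (VField Ω))) {c u : ℝ → VField Ω}
    (hs : Solves μ γ δ T f J c u) {a : VField Ω → VField Ω} {A : VField Ω →L[ℝ] L2 Ω Plane}
    (hA : ∀ v, A v = (a v).1) (ha : ∀ v, a v ∈ J)
    (haφ : ∀ v, ∀ φ ∈ J, ⟪(a v).1, φ.1⟫_ℝ = ⟪v.2, φ.2⟫_ℝ) {τ : ℝ} (hτ : 0 ≤ τ)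
    (hτT : (τ : EReal) < T) :
    ∃ m M : ℝ → ℝ, (∀ t, 0 ≤ m t) ∧ (∀ t, 0 ≤ M t) ∧ m 0 = 0 ∧ M 0 = 0 ∧
      ContinuousOn m (Icc 0 τ) ∧ ContinuousOn M (Icc 0 τ) ∧ ∀ t ∈ Ioo 0 τ,
        HasDerivAt (fun s => 1 / 2 * ‖(u s).1‖ ^ 2 + m s)
          (-μ * ‖(u t).2‖ ^ 2 - 2 * δ * m t - bForm (c t) (c t) (u t) + ⟪f t, (u t).1⟫_ℝ) t ∧
        HasDerivAt (fun s => 1 / 2 * ‖(u s).2‖ ^ 2 + M s)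
          (-μ * ‖(a (u t)).1‖ ^ 2 - 2 * δ * M t - bForm (c t) (c t) (a (u t)) +
            ⟪f t, (a (u t)).1⟫_ℝ) t ∧
        ∃ x : ℝ, x ^ 2 ≤ 2 * γ * M t * ‖(a (u t)).1‖ ^ 2 ∧
          HasDerivAt (fun s => 1 / 2 * ‖(u s).2‖ ^ 2)
            (-μ * ‖(a (u t)).1‖ ^ 2 - x - bForm (c t) (c t) (a (u t)) +
              ⟪f t, (a (u t)).1⟫_ℝ) t := by
  have hlt : ∀ t, t ≤ τ → (t : EReal) < T := fun t ht =>
    lt_of_le_of_lt (EReal.coe_le_coe_iff.2 ht) hτT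
  have huc : ContinuousOn u (Icc 0 τ) := hs.cont.mono fun t ht => ⟨ht.1, hlt t ht.2⟩
  obtain ⟨w, hw0, hwc, hwd, hwℓ⟩ := exists_memory γ δ hτ huc
  refine ⟨fun t => 1 / (2 * γ) * ‖(w t).2‖ ^ 2, fun t => 1 / (2 * γ) * ‖A (w t)‖ ^ 2,
    fun t => by positivity, fun t => by positivity, by simp [hw0], by simp [hw0],
    (hwc.snd.norm.pow 2).const_mul _, ((A.continuous.comp_continuousOn hwc).norm.pow 2).const_mul _,
    fun t ht => ?_⟩
  have htT := hlt t ht.2.le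
  have hud : HasDerivAt u (deriv u t) t := (hs.diff t ht.1 htT).hasDerivAt
  set u' := deriv u t with hu'
  have hu'J : u' ∈ J := by
    refine deriv_mem_of_isClosed hJ ?_ hud
    filter_upwards [Icc_mem_nhds ht.1 ht.2] with s hs'
    exact hs.mem s hs'.1 (hlt s hs'.2)
  have huJ : u t ∈ J := hs.mem t ht.1.le htT
  have hd1 : HasDerivAt (fun s => (u s).1) u'.1 t := hud.fst
  have hd2 : HasDerivAt (fun s => (u s).2) u'.2 t := hud.snd
  have hwd2 : HasDerivAt (fun s => (w s).2) (γ • (u t).2 - δ • (w t).2) t := (hwd t ht).snd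
  have hwdA : HasDerivAt (fun s => A (w s)) (γ • A (u t) - δ • A (w t)) t := by
    have := A.hasFDerivAt.comp_hasDerivAt t (hwd t ht)
    rw [map_sub, map_smul, map_smul] at this
    exact this
  have heq : ∀ φ ∈ J, ⟪u'.1, φ.1⟫_ℝ + μ * ⟪(u t).2, φ.2⟫_ℝ + bForm (c t) (c t) φ +
      ⟪(w t).2, φ.2⟫_ℝ = ⟪f t, φ.1⟫_ℝ := by
    intro φ hφ
    have h1 := hs.eqn t ht.1 htT φ hφ
    have h2 := hwℓ ((innerSL ℝ φ.2).comp (ContinuousLinearMap.snd ℝ (L2 Ω Plane) (L2 Ω Mat))) t ht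
    simp only [ContinuousLinearMap.comp_apply, ContinuousLinearMap.coe_snd',
      innerSL_apply_apply] at h2
    rw [real_inner_comm φ.2 (w t).2, h2, ← h1]
    simp_rw [real_inner_comm φ.2]
    rfl
  have e1 := heq (u t) huJ
  have e2 := heq (a (u t)) (ha _)
  have e3 : ⟪u'.1, (a (u t)).1⟫_ℝ = ⟪(u t).2, u'.2⟫_ℝ := by
    rw [real_inner_comm, haφ _ _ hu'J]
  have e4 : ⟪(u t).2, (a (u t)).2⟫_ℝ = ‖(a (u t)).1‖ ^ 2 := by
    rw [← haφ _ _ (ha _), real_inner_self_eq_norm_sq]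
  have e5 : ⟪(w t).2, (a (u t)).2⟫_ℝ = ⟪A (w t), A (u t)⟫_ℝ := by
    rw [← haφ _ _ (ha _), hA, hA]
  rw [real_inner_self_eq_norm_sq] at e1
  rw [e3, e4, e5] at e2
  refine ⟨?_, ?_, ⟪A (w t), A (u t)⟫_ℝ, ?_, ?_⟩
  · refine ((hasDerivAt_half_norm_sq hd1 (1 / 2)).add
      (hasDerivAt_half_norm_sq hwd2 (1 / (2 * γ)))).congr_deriv ?_
    rw [inner_sub_right, real_inner_smul_right, real_inner_smul_right, real_inner_self_eq_norm_sq,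
      real_inner_comm u'.1]
    field_simp
    linear_combination γ * e1
  · refine ((hasDerivAt_half_norm_sq hd2 (1 / 2)).add
      (hasDerivAt_half_norm_sq hwdA (1 / (2 * γ)))).congr_deriv ?_
    rw [inner_sub_right, real_inner_smul_right, real_inner_smul_right, real_inner_self_eq_norm_sq]
    field_simp
    linear_combination γ * e2
  · have h1 := abs_real_inner_le_norm (A (w t)) (A (u t))
    rw [← sq_abs]
    refine (pow_le_pow_left₀ (abs_nonneg _) h1 2).trans (le_of_eq ?_)
    rw [← hA]
    field_simp
  · refine (hasDerivAt_half_norm_sq hd2 (1 / 2)).congr_deriv ?_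
    linear_combination e2

/-! ### Grönwall inequalities and an absorption argument -/

/-- The exponentially weighted memory `∫₀ᵗ e^{-κ(t-s)} g(s) ds`. -/
noncomputable def expMean (κ t : ℝ) (g : ℝ → ℝ) : ℝ :=
  ∫ s in (0 : ℝ)..t, Real.exp (-κ * (t - s)) * g s

theorem intervalIntegrable_exp_mul {κ t : ℝ} (ht : 0 ≤ t) {g : ℝ → ℝ}
    (hg : ContinuousOn g (Icc 0 t)) :
    IntervalIntegrable (fun s => Real.exp (-κ * (t - s)) * g s) volume 0 t := by
  refine ContinuousOn.intervalIntegrable ?_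
  rw [uIcc_of_le ht]
  exact ContinuousOn.mul (by fun_prop) hg

theorem exp_mul_integral_eq_expMean (κ t : ℝ) (g : ℝ → ℝ) :
    Real.exp (-κ * t) * ∫ s in (0 : ℝ)..t, Real.exp (κ * s) * g s = expMean κ t g := by
  unfold expMean
  rw [← intervalIntegral.integral_const_mul]
  refine intervalIntegral.integral_congr fun s _ => ?_
  rw [show -κ * (t - s) = -κ * t + κ * s by ring, Real.exp_add]
  ring

theorem expMean_nonneg {κ t : ℝ} (ht : 0 ≤ t) {g : ℝ → ℝ} (h : ∀ s ∈ Icc 0 t, 0 ≤ g s) :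
    0 ≤ expMean κ t g :=
  intervalIntegral.integral_nonneg ht fun s hs => mul_nonneg (Real.exp_pos _).le (h s hs)

theorem expMean_anti {κ κ' t : ℝ} (ht : 0 ≤ t) (hκ : κ ≤ κ') {g : ℝ → ℝ}
    (hg : ContinuousOn g (Icc 0 t)) (h : ∀ s ∈ Icc 0 t, 0 ≤ g s) :
    expMean κ' t g ≤ expMean κ t g := by
  refine intervalIntegral.integral_mono_on ht (intervalIntegrable_exp_mul ht hg)
    (intervalIntegrable_exp_mul ht hg) fun s hs => mul_le_mul_of_nonneg_right ?_ (h s hs)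
  refine Real.exp_le_exp.2 ?_
  nlinarith [hs.2]

theorem expMean_const_mul (κ t c : ℝ) (g : ℝ → ℝ) :
    expMean κ t (fun s => c * g s) = c * expMean κ t g := by
  unfold expMean
  rw [← intervalIntegral.integral_const_mul]
  refine intervalIntegral.integral_congr fun s _ => ?_
  simp only
  ring

theorem expMean_add {κ t : ℝ} (ht : 0 ≤ t) {g r : ℝ → ℝ} (hg : ContinuousOn g (Icc 0 t))
    (hr : ContinuousOn r (Icc 0 t)) :
    expMean κ t (fun s => g s + r s) = expMean κ t g + expMean κ t r := by
  unfold expMean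
  rw [← intervalIntegral.integral_add (intervalIntegrable_exp_mul ht hg)
    (intervalIntegrable_exp_mul ht hr)]
  simp_rw [mul_add]

/-- Grönwall's inequality with the dissipation kept: if `y' + κ y + q ≤ 0` then
`e^{κ x} y + ∫ e^{κ z} q` does not increase. -/
theorem gronwall_integral {y q : ℝ → ℝ} {κ s t : ℝ} (hst : s ≤ t) (hy : ContinuousOn y (Icc s t))
    (hq : ContinuousOn q (Icc s t))
    (h : ∀ x ∈ Ioo s t, ∃ e, HasDerivAt y e x ∧ e + κ * y x + q x ≤ 0) :
    Real.exp (κ * t) * y t + ∫ x in s..t, Real.exp (κ * x) * q x ≤ Real.exp (κ * s) * y s := by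
  set p : ℝ → ℝ := fun x => Real.exp (κ * x) * q x with hp
  have hpc : ContinuousOn p (Icc s t) := ContinuousOn.mul (by fun_prop) hq
  set Φ : ℝ → ℝ := fun x => Real.exp (κ * x) * y x + ∫ z in s..x, p z with hΦ
  have hΦc : ContinuousOn Φ (Icc s t) := by
    refine ContinuousOn.add (ContinuousOn.mul (by fun_prop) hy) ?_
    have := intervalIntegral.continuousOn_primitive_interval (a := s) (b := t) (f := p)
      (μ := volume) (by rw [uIcc_of_le hst]; exact hpc.integrableOn_Icc)
    rwa [uIcc_of_le hst] at this
  have hd : ∀ x ∈ Ioo s t, ∃ e, HasDerivAt Φ e x ∧ e ≤ 0 := by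
    intro x hx
    obtain ⟨e, he, hle⟩ := h x hx
    have h1 : HasDerivAt (fun x => ∫ z in s..x, p z) (p x) x := by
      refine intervalIntegral.integral_hasDerivAt_right
        (hpc.mono (by
          rw [uIcc_of_le hx.1.le]
          exact Icc_subset_Icc_right hx.2.le)).intervalIntegrable
        ((hpc.mono Ioo_subset_Icc_self).stronglyMeasurableAtFilter isOpen_Ioo x hx)
        (hpc.continuousAt (Icc_mem_nhds hx.1 hx.2))
    have h2 : HasDerivAt (fun x => Real.exp (κ * x)) (Real.exp (κ * x) * κ) x := by
      simpa using ((hasDerivAt_id x).const_mul κ).exp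
    refine ⟨_, (h2.mul he).add h1, ?_⟩
    have e1 : Real.exp (κ * x) * κ * y x + Real.exp (κ * x) * e + p x =
        Real.exp (κ * x) * (e + κ * y x + q x) := by simp only [hp]; ring
    rw [e1]
    exact mul_nonpos_of_nonneg_of_nonpos (Real.exp_pos _).le hle
  have hanti : AntitoneOn Φ (Icc s t) := by
    refine antitoneOn_of_deriv_nonpos (convex_Icc s t) hΦc ?_ ?_
    · rw [interior_Icc]
      intro x hx
      obtain ⟨e, he, -⟩ := hd x hx
      exact he.differentiableAt.differentiableWithinAt
    · rw [interior_Icc]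
      intro x hx
      obtain ⟨e, he, hle⟩ := hd x hx
      rwa [he.deriv]
  have := hanti (left_mem_Icc.2 hst) (right_mem_Icc.2 hst) hst
  simpa [hΦ] using this

theorem gronwall_expMean {y g r : ℝ → ℝ} {κ t : ℝ} (hκ : 0 ≤ κ) (ht : 0 ≤ t)
    (hy : ContinuousOn y (Icc 0 t)) (hg : ContinuousOn g (Icc 0 t))
    (hr : ContinuousOn r (Icc 0 t)) (hy0 : 0 ≤ y 0)
    (h : ∀ x ∈ Ioo 0 t, ∃ e, HasDerivAt y e x ∧ e + κ * y x + g x ≤ r x) :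
    y t + expMean κ t g ≤ y 0 + expMean κ t r := by
  have h1 := gronwall_integral (κ := κ) (q := fun x => g x + (-1) * r x) ht hy
    (hg.add (hr.const_mul _)) fun x hx => by
      obtain ⟨e, he, hle⟩ := h x hx
      exact ⟨e, he, by linarith⟩
  rw [mul_zero, Real.exp_zero, one_mul] at h1
  have h2 := mul_le_mul_of_nonneg_left h1 (Real.exp_pos (-κ * t)).le
  rw [mul_add, exp_mul_integral_eq_expMean, expMean_add ht hg (hr.const_mul _), expMean_const_mul,
    ← mul_assoc, ← Real.exp_add, show -κ * t + κ * t = 0 by ring, Real.exp_zero, one_mul] at h2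
  have h3 : Real.exp (-κ * t) ≤ 1 := Real.exp_le_one_iff.2 (by nlinarith)
  nlinarith

theorem expMean_const_le {κ t c : ℝ} (hκ : 0 < κ) (ht : 0 ≤ t) (hc : 0 ≤ c) :
    expMean κ t (fun _ => c) ≤ c / κ := by
  have h1 := gronwall_integral (y := fun _ => -(c / κ)) (q := fun _ => c) (κ := κ) ht
    continuousOn_const continuousOn_const fun x _ => ⟨0, hasDerivAt_const x _, by
      rw [mul_neg, mul_div_cancel₀ _ hκ.ne']; linarith⟩
  rw [mul_zero, Real.exp_zero, one_mul] at h1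
  have h2 := mul_le_mul_of_nonneg_left h1 (Real.exp_pos (-κ * t)).le
  rw [mul_add, exp_mul_integral_eq_expMean,
    ← mul_assoc, ← Real.exp_add, show -κ * t + κ * t = 0 by ring, Real.exp_zero, one_mul] at h2
  have h3 := Real.exp_pos (-κ * t)
  have h4 : 0 ≤ c / κ := by positivity
  nlinarith

/-- Grönwall's inequality with a variable coefficient. -/
theorem gronwall_variable {y p : ℝ → ℝ} {b s t : ℝ} (hst : s ≤ t) (hy : ContinuousOn y (Icc s t))
    (hp : ContinuousOn p (Icc s t)) (hp0 : ∀ x ∈ Icc s t, 0 ≤ p x) (hb : 0 ≤ b)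
    (h : ∀ x ∈ Ioo s t, ∃ e, HasDerivAt y e x ∧ e ≤ p x * y x + b) :
    y t ≤ Real.exp (∫ x in s..t, p x) * (y s + b * (t - s)) := by
  set P : ℝ → ℝ := fun x => ∫ z in s..x, p z with hP
  set Φ : ℝ → ℝ := fun x => Real.exp (-P x) * y x - b * (x - s) with hΦ
  have hPc : ContinuousOn P (Icc s t) := by
    have := intervalIntegral.continuousOn_primitive_interval (a := s) (b := t) (f := p)
      (μ := volume) (by rw [uIcc_of_le hst]; exact hp.integrableOn_Icc)
    rwa [uIcc_of_le hst] at this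
  have hΦc : ContinuousOn Φ (Icc s t) :=
    (hPc.neg.rexp.mul hy).sub (by fun_prop)
  have hd : ∀ x ∈ Ioo s t, ∃ e, HasDerivAt Φ e x ∧ e ≤ 0 := by
    intro x hx
    obtain ⟨e, he, hle⟩ := h x hx
    have h1 : HasDerivAt P (p x) x := by
      refine intervalIntegral.integral_hasDerivAt_right
        (hp.mono (by
          rw [uIcc_of_le hx.1.le]
          exact Icc_subset_Icc_right hx.2.le)).intervalIntegrable
        ((hp.mono Ioo_subset_Icc_self).stronglyMeasurableAtFilter isOpen_Ioo x hx)
        (hp.continuousAt (Icc_mem_nhds hx.1 hx.2))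
    have h2 : HasDerivAt (fun x => b * (x - s)) b x := by
      simpa using ((hasDerivAt_id x).sub_const s).const_mul b
    refine ⟨_, (h1.neg.exp.mul he).sub h2, ?_⟩
    have hPx : 0 ≤ P x := intervalIntegral.integral_nonneg hx.1.le fun z hz =>
      hp0 z ⟨hz.1, hz.2.trans hx.2.le⟩
    have h3 : Real.exp (-P x) ≤ 1 := Real.exp_le_one_iff.2 (by linarith)
    have h4 := Real.exp_pos (-P x)
    have h5 : Real.exp (-P x) * (e - p x * y x) ≤ Real.exp (-P x) * b :=
      mul_le_mul_of_nonneg_left (by linarith) h4.le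
    have h6 : Real.exp (-P x) * b ≤ 1 * b := mul_le_mul_of_nonneg_right h3 hb
    rw [Pi.neg_apply]
    linarith
  have hanti : AntitoneOn Φ (Icc s t) := by
    refine antitoneOn_of_deriv_nonpos (convex_Icc s t) hΦc ?_ ?_
    · rw [interior_Icc]
      intro x hx
      obtain ⟨e, he, -⟩ := hd x hx
      exact he.differentiableAt.differentiableWithinAt
    · rw [interior_Icc]
      intro x hx
      obtain ⟨e, he, hle⟩ := hd x hx
      rwa [he.deriv]
  have h1 := hanti (left_mem_Icc.2 hst) (right_mem_Icc.2 hst) hst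
  have e1 : Φ s = y s := by simp [hΦ, hP]
  rw [e1] at h1
  have h2 : Real.exp (-P t) * y t ≤ y s + b * (t - s) := by
    simp only [hΦ] at h1; linarith
  have h3 := mul_le_mul_of_nonneg_left h2 (Real.exp_pos (P t)).le
  rwa [← mul_assoc, ← Real.exp_add, add_neg_cancel, Real.exp_zero, one_mul] at h3

/-- A priori bound for an energy inequality with a quadratic right-hand side. The quadratic term is
linear in `Y` up to the factor `Y`, whose integral is bounded on unit intervals and in the weighted
mean. The stored energy `M` enters the growth of `Y` only over a short time `r`, so that it can be
absorbed. -/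
theorem exists_bound_of_energy {κ c K C₃ C₄ C₅ C₆ Y₀ : ℝ} (hκ : 0 < κ) (hc : 0 < c) (hK : 0 ≤ K)
    (hC₃ : 0 ≤ C₃) (hC₄ : 0 ≤ C₄) (hC₅ : 0 ≤ C₅) (hC₆ : 0 ≤ C₆) (hY₀ : 0 ≤ Y₀) :
    ∃ B : ℝ, 0 ≤ B ∧ ∀ τ : ℝ, 0 ≤ τ → ∀ Y M G : ℝ → ℝ, ContinuousOn Y (Icc 0 τ) →
      ContinuousOn M (Icc 0 τ) → ContinuousOn G (Icc 0 τ) → (∀ t, 0 ≤ Y t) → (∀ t, 0 ≤ M t) →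
      (∀ t, 0 ≤ G t) → M 0 = 0 → Y 0 ≤ Y₀ →
      (∀ t ∈ Ioo 0 τ, ∃ e, HasDerivAt (fun s => 1 / 2 * Y s + M s) e t ∧
        e + κ * (1 / 2 * Y t + M t) + c * G t ≤ K * Y t ^ 2 + C₃) →
      (∀ t ∈ Ioo 0 τ, ∃ e, HasDerivAt (fun s => 1 / 2 * Y s) e t ∧
        e ≤ K * Y t ^ 2 + C₄ * M t + C₃) →
      (∀ s t, 0 ≤ s → s ≤ t → t ≤ τ → ∫ x in s..t, Y x ≤ C₅ * (1 + (t - s))) →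
      (∀ t ∈ Icc 0 τ, expMean κ t Y ≤ C₆) →
      ∀ t ∈ Icc 0 τ, Y t ≤ B ∧ expMean κ t G ≤ B := by
  set E := Real.exp (4 * K * C₅) with hE
  have hE0 : 0 < E := Real.exp_pos _
  set D' := 2 * E * C₄ with hD'
  have hD'0 : 0 ≤ D' := by positivity
  -- over a time `r` the stored energy `S` raises `Y` by at most `D' r S`; in the final balance this
  -- costs `K C₆ D' r S ≤ S / 4`
  set r := 1 / (4 * (K * C₆ * D' + 1)) with hr
  have hr0 : 0 < r := by positivity
  have hKC : 0 ≤ K * C₆ * D' := by positivity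
  have hr1 : r ≤ 1 := by
    rw [hr, div_le_one (by positivity)]; linarith
  have hrK : K * C₆ * D' * r ≤ 1 / 4 := by
    rw [hr, mul_one_div, div_le_iff₀ (by positivity)]; linarith
  set D := E * (Y₀ + 2 * C₅ / r + 2 * C₃) with hD
  have hD0 : 0 ≤ D := by positivity
  set Q := 1 / 2 * Y₀ + C₃ / κ + K * D * C₆ with hQ
  have hQ0 : 0 ≤ Q := by positivity
  refine ⟨4 * Q + 2 * Q / c, by positivity, fun τ hτ Y M G hYc hMc hGc hY hM hG hM0 hY0 h1 h2 h3 h4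
      => ?_⟩
  obtain ⟨tm, htm, hmax⟩ := isCompact_Icc.exists_isMaxOn ⟨0, left_mem_Icc.2 hτ⟩ hMc
  set S := M tm with hS
  have hS0 : 0 ≤ S := hM tm
  have hMS : ∀ t ∈ Icc 0 τ, M t ≤ S := fun t ht => hmax ht
  have hYb : ∀ t ∈ Icc 0 τ, Y t ≤ D + D' * r * S := by
    intro t ht
    -- a starting time in `[t - r, t]` with controlled `Y`
    obtain ⟨s, hs0, hst, hsr, hYs⟩ : ∃ s, 0 ≤ s ∧ s ≤ t ∧ t - s ≤ r ∧ Y s ≤ Y₀ + 2 * C₅ / r := by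
      rcases le_total t r with htr | htr
      · refine ⟨0, le_rfl, ht.1, by linarith, hY0.trans ?_⟩
        have : 0 ≤ 2 * C₅ / r := by positivity
        linarith
      · have hsub : Icc (t - r) t ⊆ Icc 0 τ := Icc_subset_Icc (by linarith) ht.2
        have hle : t - r ≤ t := by linarith
        obtain ⟨s, hs, hmin⟩ := isCompact_Icc.exists_isMinOn ⟨t, right_mem_Icc.2 hle⟩
            (hYc.mono hsub)
        refine ⟨s, by linarith [hs.1], hs.2, by linarith [hs.1], ?_⟩
        have h5 : ∫ _ in (t - r)..t, Y s ≤ ∫ x in (t - r)..t, Y x := by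
          refine intervalIntegral.integral_mono_on hle intervalIntegrable_const ?_ fun x hx => hmin
              hx
          refine ContinuousOn.intervalIntegrable ?_
          rw [uIcc_of_le hle]
          exact hYc.mono hsub
        have h6 := h3 (t - r) t (by linarith) hle ht.2
        rw [intervalIntegral.integral_const, smul_eq_mul] at h5
        have h7 : C₅ * (1 + (t - (t - r))) ≤ C₅ * 2 := mul_le_mul_of_nonneg_left (by linarith) hC₅
        have h8 : Y s ≤ 2 * C₅ / r := by
          rw [le_div_iff₀ hr0]
          have : (t - (t - r)) * Y s = Y s * r := by ring
          linarith
        linarith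
    have hsub : Icc s t ⊆ Icc 0 τ := Icc_subset_Icc hs0 ht.2
    have hsub' : Ioo s t ⊆ Ioo 0 τ := Ioo_subset_Ioo hs0 ht.2
    have h5 := gronwall_variable (y := fun x => 1 / 2 * Y x) (p := fun x => 2 * K * Y x)
      (b := C₄ * S + C₃) hst ((hYc.mono hsub).const_mul _) ((hYc.mono hsub).const_mul _)
      (fun x _ => by have := hY x; positivity) (by positivity) fun x hx => by
        obtain ⟨e, he, hle⟩ := h2 x (hsub' hx)
        refine ⟨e, he, hle.trans ?_⟩
        have := mul_le_mul_of_nonneg_left (hMS x (Ioo_subset_Icc_self (hsub' hx))) hC₄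
        linarith
    rw [intervalIntegral.integral_const_mul] at h5
    have h6 : 2 * K * ∫ x in s..t, Y x ≤ 4 * K * C₅ := by
      have h7 := h3 s t hs0 hst ht.2
      have h8 : C₅ * (1 + (t - s)) ≤ C₅ * 2 := mul_le_mul_of_nonneg_left (by linarith) hC₅
      have h9 := mul_le_mul_of_nonneg_left (h7.trans h8) (by positivity : 0 ≤ 2 * K)
      linarith
    have h7 : 1 / 2 * Y s + (C₄ * S + C₃) * (t - s) ≤
        1 / 2 * (Y₀ + 2 * C₅ / r) + (C₄ * S * r + C₃) := by
      have h8 : (C₄ * S) * (t - s) ≤ C₄ * S * r := mul_le_mul_of_nonneg_left hsr (by positivity)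
      have h9 : C₃ * (t - s) ≤ C₃ * 1 := mul_le_mul_of_nonneg_left (by linarith) hC₃
      linarith
    have h8 : 0 ≤ 1 / 2 * Y s + (C₄ * S + C₃) * (t - s) :=
      add_nonneg (by have := hY s; positivity)
        (mul_nonneg (by positivity) (sub_nonneg.2 hst))
    have h9 : 1 / 2 * Y t ≤ E * (1 / 2 * (Y₀ + 2 * C₅ / r) + (C₄ * S * r + C₃)) :=
      h5.trans (mul_le_mul (Real.exp_le_exp.2 h6) h7 h8 hE0.le)
    rw [hD, hD']
    linarith
  have hbd : ∀ t ∈ Icc 0 τ, 1 / 2 * Y t + M t + c * expMean κ t G ≤ Q + 1 / 4 * S := by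
    intro t ht
    have hsub : Icc 0 t ⊆ Icc 0 τ := Icc_subset_Icc_right ht.2
    have hYt := hYc.mono hsub
    set A := D + D' * r * S with hA
    have hA0 : 0 ≤ A := by positivity
    have h5 := gronwall_expMean (y := fun s => 1 / 2 * Y s + M s) (g := fun s => c * G s)
      (r := fun s => K * A * Y s + C₃) hκ.le ht.1 ((hYt.const_mul _).add (hMc.mono hsub))
      ((hGc.mono hsub).const_mul _) ((hYt.const_mul _).add continuousOn_const)
      (by have := hY 0; have := hM 0; positivity) fun x hx => by
        have hx' : x ∈ Ioo 0 τ := ⟨hx.1, hx.2.trans_le ht.2⟩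
        obtain ⟨e, he, hle⟩ := h1 x hx'
        refine ⟨e, he, hle.trans ?_⟩
        have h6 := mul_le_mul_of_nonneg_right (hYb x (Ioo_subset_Icc_self hx')) (hY x)
        have h7 := mul_le_mul_of_nonneg_left h6 hK
        linarith
    rw [expMean_const_mul, expMean_add ht.1 (hYt.const_mul _) continuousOn_const,
      expMean_const_mul] at h5
    have h6 := expMean_const_le hκ ht.1 hC₃
    have h7 : K * A * expMean κ t Y ≤ K * A * C₆ :=
      mul_le_mul_of_nonneg_left (h4 t ht) (by positivity)
    have h8 : K * C₆ * D' * r * S ≤ 1 / 4 * S := mul_le_mul_of_nonneg_right hrK hS0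
    rw [hM0] at h5
    rw [hQ]
    rw [hA] at h7 h5
    linarith
  -- evaluation at the time where `M` attains its maximum `S` absorbs `S / 4`
  have hS2 : S ≤ 2 * Q := by
    have h5 := hbd tm htm
    have h6 : 0 ≤ c * expMean κ tm G := mul_nonneg hc.le (expMean_nonneg htm.1 fun s _ => hG s)
    have h7 := hY tm
    linarith
  intro t ht
  have h5 := hbd t ht
  have h6 : 0 ≤ expMean κ t G := expMean_nonneg ht.1 fun s _ => hG s
  have h7 := hY t
  have h8 := hM t
  have h9 : 0 ≤ c * expMean κ t G := by positivity
  have h10 : 0 ≤ 2 * Q / c := by positivity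
  refine ⟨by linarith, ?_⟩
  have h11 : expMean κ t G ≤ 2 * Q / c := by
    rw [le_div_iff₀ hc]; linarith
  linarith

/-! ### Uniform bounds for the semidiscrete problems -/

/-- `a` is a discrete Stokes operator on `J`, with velocity part `A`, and `p`, `q` are constants in
the Poincaré inequalities for `v` and for `∇v`. -/
structure IsDiscreteStokes (J : Submodule ℝ (VField Ω)) (a : VField Ω → VField Ω)
    (A : VField Ω →L[ℝ] L2 Ω Plane) (p q : ℝ) : Prop where
  closed : IsClosed (J : Set (VField Ω))
  apply_eq : ∀ v, A v = (a v).1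
  mem : ∀ v, a v ∈ J
  spec : ∀ v, ∀ φ ∈ J, ⟪(a v).1, φ.1⟫_ℝ = ⟪v.2, φ.2⟫_ℝ
  poincare : ∀ v ∈ J, ‖v.1‖ ≤ p * ‖v.2‖
  grad_le : ∀ v ∈ J, ‖v.2‖ ≤ q * ‖(a v).1‖

theorem abs_le_add_of_sq_le {x p q : ℝ} (hp : 0 ≤ p) (hq : 0 ≤ q) (h : x ^ 2 ≤ 4 * p * q) :
    |x| ≤ p + q := by
  refine abs_le_of_sq_le_sq ?_ (add_nonneg hp hq)
  nlinarith [sq_nonneg (p - q)]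

section

variable {μ γ δ M₀ κ p q : ℝ} {T : EReal} {f : ℝ → L2 Ω Plane} {J : Submodule ℝ (VField Ω)}
  {a : VField Ω → VField Ω} {A : VField Ω →L[ℝ] L2 Ω Plane} {c u : ℝ → VField Ω}

/-- Dissipation inequalities for a semidiscrete Oldroyd problem, with the convection term bounded
by a fraction of the dissipation and a remainder `R` in the first and `Q` in the second energy. The
third inequality, without the stored energy on the left, is used over short times. -/
theorem Solves.exists_dissipation (hμ : 0 < μ) (hγ : 0 < γ) (hS : IsDiscreteStokes J a A p q)
    (hs : Solves μ γ δ T f J c u) (hκp : κ * p ^ 2 ≤ μ / 2) (hκq : κ * q ^ 2 ≤ μ / 2)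
    (hκδ : κ ≤ δ) (hδ : 0 < δ) (hκ : 0 < κ)
    (hf : ∀ t : ℝ, 0 < t → (t : EReal) < T → ‖f t‖ ≤ M₀) {τ : ℝ}
    (hτ : 0 ≤ τ) (hτT : (τ : EReal) < T) {R Q : ℝ → ℝ}
    (hR : ∀ t ∈ Ioo 0 τ, |bForm (c t) (c t) (u t)| ≤ μ / 4 * ‖(u t).2‖ ^ 2 + R t)
    (hQ : ∀ t ∈ Ioo 0 τ, |bForm (c t) (c t) (a (u t))| ≤ μ / 4 * ‖(a (u t)).1‖ ^ 2 + Q t) :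
    ∃ m M : ℝ → ℝ, (∀ t, 0 ≤ m t) ∧ (∀ t, 0 ≤ M t) ∧ m 0 = 0 ∧ M 0 = 0 ∧
      ContinuousOn m (Icc 0 τ) ∧ ContinuousOn M (Icc 0 τ) ∧ ∀ t ∈ Ioo 0 τ,
        (∃ e, HasDerivAt (fun s => 1 / 2 * ‖(u s).1‖ ^ 2 + m s) e t ∧
          e + κ * (1 / 2 * ‖(u t).1‖ ^ 2 + m t) + μ / 4 * ‖(u t).2‖ ^ 2 ≤
            R t + M₀ ^ 2 * p ^ 2 / μ) ∧
        (∃ e, HasDerivAt (fun s => 1 / 2 * ‖(u s).2‖ ^ 2 + M s) e t ∧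
          e + κ * (1 / 2 * ‖(u t).2‖ ^ 2 + M t) + μ / 4 * ‖(a (u t)).1‖ ^ 2 ≤
            Q t + M₀ ^ 2 / μ) ∧
        (∃ e, HasDerivAt (fun s => 1 / 2 * ‖(u s).2‖ ^ 2) e t ∧
          e ≤ Q t + γ / μ * M t + M₀ ^ 2 / μ) := by
  obtain ⟨m, M, hm, hM, hm0, hM0, hmc, hMc, hd⟩ :=
    hs.exists_energy hγ hS.closed hS.apply_eq hS.mem hS.spec hτ hτT
  refine ⟨m, M, hm, hM, hm0, hM0, hmc, hMc, fun t ht => ?_⟩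
  have htT : (t : EReal) < T := lt_of_le_of_lt (EReal.coe_le_coe_iff.2 ht.2.le) hτT
  have huJ : u t ∈ J := hs.mem t ht.1.le htT
  have hft := hf t ht.1 htT
  have hM₀ : 0 ≤ M₀ := (norm_nonneg _).trans hft
  obtain ⟨h1, h2, x, hx, h3⟩ := hd t ht
  have b1 := abs_le.1 (hR t ht)
  have b2 := abs_le.1 (hQ t ht)
  have hP := hS.poincare (u t) huJ
  have hq := hS.grad_le (u t) huJ
  have hPsq := pow_le_pow_left₀ (norm_nonneg _) hP 2
  have hqsq := pow_le_pow_left₀ (norm_nonneg _) hq 2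
  rw [mul_pow] at hPsq hqsq
  set Y := ‖(u t).2‖ with hY
  set G := ‖(a (u t)).1‖ with hG
  set y := ‖(u t).1‖ with hy
  have f1 : |⟪f t, (u t).1⟫_ℝ| ≤ μ / 4 * Y ^ 2 + M₀ ^ 2 * p ^ 2 / μ := by
    refine abs_le_add_of_sq_le (by positivity) (by positivity) ?_
    have h4 : |⟪f t, (u t).1⟫_ℝ| ≤ M₀ * (p * Y) :=
      (abs_real_inner_le_norm _ _).trans (mul_le_mul hft hP (norm_nonneg _) hM₀)
    have h5 := pow_le_pow_left₀ (abs_nonneg _) h4 2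
    rw [sq_abs] at h5
    refine h5.trans (le_of_eq ?_)
    field_simp
  have f2 : |⟪f t, (a (u t)).1⟫_ℝ| ≤ μ / 4 * G ^ 2 + M₀ ^ 2 / μ := by
    refine abs_le_add_of_sq_le (by positivity) (by positivity) ?_
    have h4 : |⟪f t, (a (u t)).1⟫_ℝ| ≤ M₀ * G :=
      (abs_real_inner_le_norm _ _).trans (mul_le_mul_of_nonneg_right hft (norm_nonneg _))
    have h5 := pow_le_pow_left₀ (abs_nonneg _) h4 2
    rw [sq_abs] at h5
    refine h5.trans (le_of_eq ?_)
    field_simp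
  have f3 : |x| ≤ μ / 2 * G ^ 2 + γ / μ * M t := by
    refine abs_le_add_of_sq_le (by positivity) (mul_nonneg (by positivity) (hM t)) ?_
    refine hx.trans (le_of_eq ?_)
    field_simp
    ring
  have g1 := abs_le.1 f1
  have g2 := abs_le.1 f2
  have g3 := abs_le.1 f3
  refine ⟨⟨_, h1, ?_⟩, ⟨_, h2, ?_⟩, ⟨_, h3, ?_⟩⟩
  · have k1 : κ * y ^ 2 ≤ μ / 2 * Y ^ 2 := by
      calc κ * y ^ 2 ≤ κ * (p ^ 2 * Y ^ 2) := mul_le_mul_of_nonneg_left hPsq hκ.le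
        _ = (κ * p ^ 2) * Y ^ 2 := by ring
        _ ≤ μ / 2 * Y ^ 2 := mul_le_mul_of_nonneg_right hκp (sq_nonneg _)
    have k2 : κ * m t ≤ 2 * δ * m t := mul_le_mul_of_nonneg_right (by linarith) (hm t)
    linarith [b1.1, g1.2]
  · have k1 : κ * Y ^ 2 ≤ μ / 2 * G ^ 2 := by
      calc κ * Y ^ 2 ≤ κ * (q ^ 2 * G ^ 2) := mul_le_mul_of_nonneg_left hqsq hκ.le
        _ = (κ * q ^ 2) * G ^ 2 := by ring
        _ ≤ μ / 2 * G ^ 2 := mul_le_mul_of_nonneg_right hκq (sq_nonneg _)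
    have k2 : κ * M t ≤ 2 * δ * M t := mul_le_mul_of_nonneg_right (by linarith) (hM t)
    linarith [b2.1, g2.2]
  · linarith [b2.1, g2.2, g3.1]

/-- Uniform bounds for the nonlinear semidiscrete problem, in which the field convects itself. -/
theorem exists_bound_self_convected {β Y₀ : ℝ} (hμ : 0 < μ) (hγ : 0 < γ) (hδ : 0 < δ)
    (hκ : 0 < κ) (hβ : 0 ≤ β) (hY₀ : 0 ≤ Y₀) (hκp : κ * p ^ 2 ≤ μ / 2)
    (hκq : κ * q ^ 2 ≤ μ / 2) (hκδ : κ ≤ δ) :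
    ∃ N B : ℝ, 0 ≤ N ∧ 0 ≤ B ∧ ∀ (J : Submodule ℝ (VField Ω)) (a : VField Ω → VField Ω)
      (A : VField Ω →L[ℝ] L2 Ω Plane), IsDiscreteStokes J a A p q →
      (∀ v ∈ J, ∀ φ ∈ J, (bForm v v φ) ^ 2 ≤
        β * (‖v.1‖ * ‖(a v).1‖) * ‖v.2‖ ^ 2 * ‖φ.1‖ ^ 2) →
      ∀ (T : EReal) (f : ℝ → L2 Ω Plane) (u : ℝ → VField Ω), Solves μ γ δ T f J u u →
      (∀ t : ℝ, 0 < t → (t : EReal) < T → ‖f t‖ ≤ M₀) → ‖(u 0).2‖ ^ 2 ≤ Y₀ →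
      ∀ τ : ℝ, 0 ≤ τ → (τ : EReal) < T → ∀ t ∈ Icc 0 τ,
        ‖(u t).1‖ ≤ N ∧ ‖(u t).2‖ ^ 2 ≤ B ∧ expMean κ t (fun s => ‖(a (u s)).1‖ ^ 2) ≤ B := by
  set C₃ := M₀ ^ 2 * p ^ 2 / μ with hC₃
  have hC₃0 : 0 ≤ C₃ := by positivity
  set Z := 1 / 2 * (p ^ 2 * Y₀) + C₃ / κ with hZ
  have hZ0 : 0 ≤ Z := by positivity
  set N := √(2 * Z) with hN
  obtain ⟨B, hB0, hB⟩ := exists_bound_of_energy (κ := κ) (c := μ / 4)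
    (K := 8 * β ^ 2 * N ^ 2 / μ ^ 3) (C₃ := M₀ ^ 2 / μ) (C₄ := γ / μ) (C₅ := 4 / μ * (Z + C₃))
    (C₆ := 4 / μ * Z) (Y₀ := Y₀) hκ (by positivity) (by positivity) (by positivity)
    (by positivity) (by positivity) (by positivity) hY₀
  refine ⟨N, B, Real.sqrt_nonneg _, hB0, fun J a A hS hb T f u hs hf hu0 τ hτ hτT => ?_⟩
  have hlt : ∀ t, t ≤ τ → (t : EReal) < T := fun t ht =>
    lt_of_le_of_lt (EReal.coe_le_coe_iff.2 ht) hτT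
  have huc : ContinuousOn u (Icc 0 τ) := hs.cont.mono fun t ht => ⟨ht.1, hlt t ht.2⟩
  have hmem : ∀ t ∈ Icc 0 τ, u t ∈ J := fun t ht => hs.mem t ht.1 (hlt t ht.2)
  have hyc : ContinuousOn (fun t => ‖(u t).1‖ ^ 2) (Icc 0 τ) := huc.fst.norm.pow 2
  have hYc : ContinuousOn (fun t => ‖(u t).2‖ ^ 2) (Icc 0 τ) := huc.snd.norm.pow 2
  have hGc : ContinuousOn (fun t => ‖(a (u t)).1‖ ^ 2) (Icc 0 τ) := by
    simp_rw [← hS.apply_eq]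
    exact (A.continuous.comp_continuousOn huc).norm.pow 2
  -- the first energy, in which the convection term vanishes
  obtain ⟨m, _, hm, -, hm0, -, hmc, -, hd⟩ := hs.exists_dissipation hμ hγ hS hκp hκq hκδ hδ hκ hf
    hτ hτT (R := fun _ => 0) (Q := fun t => |bForm (u t) (u t) (a (u t))|)
    (fun t _ => by rw [bForm_self, abs_zero]; positivity)
    (fun t _ => le_add_of_nonneg_left (by positivity))
  have hu01 : ‖(u 0).1‖ ^ 2 ≤ p ^ 2 * Y₀ := by
    have h1 := pow_le_pow_left₀ (norm_nonneg _)
      (hS.poincare (u 0) (hmem 0 (left_mem_Icc.2 hτ))) 2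
    rw [mul_pow] at h1
    exact h1.trans (mul_le_mul_of_nonneg_left hu0 (sq_nonneg _))
  have hE0 : ∀ t ∈ Icc 0 τ, 1 / 2 * ‖(u t).1‖ ^ 2 + m t +
      μ / 4 * expMean κ t (fun s => ‖(u s).2‖ ^ 2) ≤ Z := by
    intro t ht
    have hsub : Icc 0 t ⊆ Icc 0 τ := Icc_subset_Icc_right ht.2
    have h1 := gronwall_expMean (y := fun s => 1 / 2 * ‖(u s).1‖ ^ 2 + m s)
      (g := fun s => μ / 4 * ‖(u s).2‖ ^ 2) (r := fun _ => C₃) hκ.le ht.1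
      (((hyc.mono hsub).const_mul _).add (hmc.mono hsub)) ((hYc.mono hsub).const_mul _)
      continuousOn_const (by have := hm 0; positivity) fun x hx => by
        obtain ⟨e, he, hle⟩ := (hd x ⟨hx.1, hx.2.trans_le ht.2⟩).1
        exact ⟨e, he, by linarith⟩
    rw [expMean_const_mul, hm0] at h1
    have h2 := expMean_const_le hκ ht.1 hC₃0
    rw [hZ]
    linarith
  have hYm : ∀ t ∈ Icc 0 τ, 0 ≤ μ / 4 * expMean κ t (fun s => ‖(u s).2‖ ^ 2) := fun t ht =>
    mul_nonneg (by positivity) (expMean_nonneg ht.1 fun s _ => sq_nonneg _)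
  have hN' : ∀ t ∈ Icc 0 τ, ‖(u t).1‖ ≤ N := by
    intro t ht
    refine Real.le_sqrt_of_sq_le ?_
    have h1 := hE0 t ht
    have h2 := hYm t ht
    have h3 := hm t
    linarith
  -- the second energy
  obtain ⟨_, M, -, hM, -, hM0, -, hMc, hd'⟩ := hs.exists_dissipation hμ hγ hS hκp hκq hκδ hδ hκ hf
    hτ hτT (R := fun _ => 0) (Q := fun t => 8 * β ^ 2 * N ^ 2 / μ ^ 3 * (‖(u t).2‖ ^ 2) ^ 2)
    (fun t _ => by rw [bForm_self, abs_zero]; positivity)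
    (fun t ht => by
      have ht' := Ioo_subset_Icc_self ht
      have h1 := hb (u t) (hmem t ht') (a (u t)) (hS.mem _)
      have h2 := hN' t ht'
      set Y := ‖(u t).2‖
      set G := ‖(a (u t)).1‖
      have hG0 : 0 ≤ G := norm_nonneg _
      have hN0 : 0 ≤ N := Real.sqrt_nonneg _
      -- Young's inequality twice: the bound `G^{3/2} Y` for the convection term is split into `G²`
      -- and `G Y²`, and the latter into `G²` and `Y⁴`
      have h3 : |bForm (u t) (u t) (a (u t))| ≤ μ / 8 * G ^ 2 + 2 * β * N / μ * (G * Y ^ 2) := by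
        refine abs_le_add_of_sq_le (by positivity) (by positivity) (h1.trans ?_)
        calc β * (‖(u t).1‖ * G) * Y ^ 2 * G ^ 2 ≤ β * (N * G) * Y ^ 2 * G ^ 2 := by gcongr
          _ = _ := by field_simp; ring
      have h4 : |2 * β * N / μ * (G * Y ^ 2)| ≤
          μ / 8 * G ^ 2 + 8 * β ^ 2 * N ^ 2 / μ ^ 3 * (Y ^ 2) ^ 2 := by
        refine abs_le_add_of_sq_le (by positivity) (by positivity) (le_of_eq ?_)
        field_simp
        ring
      have h5 := le_abs_self (2 * β * N / μ * (G * Y ^ 2))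
      linarith)
  have hfin := hB τ hτ (fun t => ‖(u t).2‖ ^ 2) M (fun t => ‖(a (u t)).1‖ ^ 2) hYc hMc hGc
    (fun t => sq_nonneg _) hM (fun t => sq_nonneg _) hM0 hu0 (fun t ht => (hd' t ht).2.1)
    (fun t ht => (hd' t ht).2.2) ?_ ?_
  · exact fun t ht => ⟨hN' t ht, hfin t ht⟩
  · intro s t hs0 hst htτ
    have hsub : Icc s t ⊆ Icc 0 τ := Icc_subset_Icc hs0 htτ
    have h1 := gronwall_integral (y := fun s => 1 / 2 * ‖(u s).1‖ ^ 2 + m s) (κ := 0)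
      (q := fun s => μ / 4 * ‖(u s).2‖ ^ 2 - C₃) hst
      (((hyc.mono hsub).const_mul _).add (hmc.mono hsub))
      (((hYc.mono hsub).const_mul _).sub continuousOn_const) fun x hx => by
        obtain ⟨e, he, hle⟩ := (hd x ⟨hs0.trans_lt hx.1, hx.2.trans_le htτ⟩).1
        have h2 : 0 ≤ κ * (1 / 2 * ‖(u x).1‖ ^ 2 + m x) := by
          have := hm x; positivity
        exact ⟨e, he, by linarith⟩
    simp only [zero_mul, Real.exp_zero, one_mul] at h1
    have hi : IntervalIntegrable (fun s => ‖(u s).2‖ ^ 2) volume s t := by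
      refine ContinuousOn.intervalIntegrable ?_
      rw [uIcc_of_le hst]
      exact hYc.mono hsub
    rw [intervalIntegral.integral_sub (hi.const_mul _) intervalIntegrable_const,
      intervalIntegral.integral_const_mul, intervalIntegral.integral_const, smul_eq_mul] at h1
    have h2 := hE0 s ⟨hs0, hst.trans htτ⟩
    have h3 := hYm s ⟨hs0, hst.trans htτ⟩
    have h4 : 0 ≤ 1 / 2 * ‖(u t).1‖ ^ 2 + m t := by have := hm t; positivity
    have h5 : 0 ≤ Z * (t - s) := mul_nonneg hZ0 (sub_nonneg.2 hst)
    have h6 : μ / 4 * ∫ x in s..t, ‖(u x).2‖ ^ 2 ≤ (Z + C₃) * (1 + (t - s)) := by linarith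
    rw [div_mul_eq_mul_div, div_mul_eq_mul_div, le_div_iff₀ hμ]
    linarith
  · intro t ht
    have h1 := hE0 t ht
    have h2 : 0 ≤ 1 / 2 * ‖(u t).1‖ ^ 2 + m t := by have := hm t; positivity
    rw [div_mul_eq_mul_div, le_div_iff₀ hμ]
    linarith

/-- Bounds for a linear semidiscrete problem whose convection term is bounded by `ρ`. -/
theorem Solves.bound_of_convection (hμ : 0 < μ) (hγ : 0 < γ) (hδ : 0 < δ)
    (hκ : 0 < κ) (hκp : κ * p ^ 2 ≤ μ / 2) (hκq : κ * q ^ 2 ≤ μ / 2) (hκδ : κ ≤ δ)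
    (hS : IsDiscreteStokes J a A p q) (hs : Solves μ γ δ T f J c u)
    (hf : ∀ t : ℝ, 0 < t → (t : EReal) < T → ‖f t‖ ≤ M₀) {t : ℝ} (ht : 0 ≤ t)
    (htT : (t : EReal) < T) {ρ : ℝ → ℝ} (hρ : ContinuousOn ρ (Icc 0 t)) (hρ0 : ∀ s, 0 ≤ ρ s)
    (hb : ∀ s ∈ Ioo 0 t, ∀ φ ∈ J, bForm (c s) (c s) φ ^ 2 ≤ ρ s * ‖φ.1‖ ^ 2) :
    1 / 2 * ‖(u t).1‖ ^ 2 + μ / 4 * expMean κ t (fun s => ‖(u s).2‖ ^ 2) ≤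
      p ^ 2 * (1 / 2 * ‖(u 0).2‖ ^ 2 + (expMean κ t ρ + M₀ ^ 2 / κ) / μ) ∧
    1 / 2 * ‖(u t).2‖ ^ 2 + μ / 4 * expMean κ t (fun s => ‖(a (u s)).1‖ ^ 2) ≤
      1 / 2 * ‖(u 0).2‖ ^ 2 + (expMean κ t ρ + M₀ ^ 2 / κ) / μ := by
  have hlt : ∀ s, s ≤ t → (s : EReal) < T := fun s hs =>
    lt_of_le_of_lt (EReal.coe_le_coe_iff.2 hs) htT
  have huc : ContinuousOn u (Icc 0 t) := hs.cont.mono fun s hs => ⟨hs.1, hlt s hs.2⟩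
  have hmem : ∀ s ∈ Icc 0 t, u s ∈ J := fun s hs' => hs.mem s hs'.1 (hlt s hs'.2)
  have hyc : ContinuousOn (fun t => ‖(u t).1‖ ^ 2) (Icc 0 t) := huc.fst.norm.pow 2
  have hYc : ContinuousOn (fun t => ‖(u t).2‖ ^ 2) (Icc 0 t) := huc.snd.norm.pow 2
  have hGc : ContinuousOn (fun t => ‖(a (u t)).1‖ ^ 2) (Icc 0 t) := by
    simp_rw [← hS.apply_eq]
    exact (A.continuous.comp_continuousOn huc).norm.pow 2
  obtain ⟨m, M, hm, hM, hm0, hM0, hmc, hMc, hd⟩ := hs.exists_dissipation hμ hγ hS hκp hκq hκδ hδ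
    hκ hf ht htT (R := fun s => p ^ 2 / μ * ρ s) (Q := fun s => 1 / μ * ρ s)
    (fun s hs' => by
      have h1 := hb s hs' (u s) (hmem s (Ioo_subset_Icc_self hs'))
      have h2 := pow_le_pow_left₀ (norm_nonneg _)
        (hS.poincare (u s) (hmem s (Ioo_subset_Icc_self hs'))) 2
      refine abs_le_add_of_sq_le (by positivity) (mul_nonneg (by positivity) (hρ0 s)) ?_
      refine h1.trans ((mul_le_mul_of_nonneg_left h2 (hρ0 s)).trans (le_of_eq ?_))
      field_simp)
    (fun s hs' => by
      refine abs_le_add_of_sq_le (by positivity) (mul_nonneg (by positivity) (hρ0 s)) ?_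
      refine (hb s hs' _ (hS.mem _)).trans (le_of_eq ?_)
      field_simp)
  have hc1 := expMean_const_le hκ ht (by positivity : 0 ≤ M₀ ^ 2 * p ^ 2 / μ)
  have hc2 := expMean_const_le hκ ht (by positivity : 0 ≤ M₀ ^ 2 / μ)
  constructor
  · have h1 := gronwall_expMean (y := fun s => 1 / 2 * ‖(u s).1‖ ^ 2 + m s)
      (g := fun s => μ / 4 * ‖(u s).2‖ ^ 2)
      (r := fun s => p ^ 2 / μ * ρ s + M₀ ^ 2 * p ^ 2 / μ) hκ.le ht
      ((hyc.const_mul _).add hmc) (hYc.const_mul _)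
      ((hρ.const_mul _).add continuousOn_const) (by have := hm 0; positivity)
      fun x hx => (hd x hx).1
    rw [expMean_const_mul, expMean_add ht (hρ.const_mul _) continuousOn_const,
      expMean_const_mul, hm0] at h1
    have h2 := pow_le_pow_left₀ (norm_nonneg _)
      (hS.poincare (u 0) (hmem 0 (left_mem_Icc.2 ht))) 2
    rw [mul_pow] at h2
    have h3 := hm t
    have e : p ^ 2 * (1 / 2 * ‖(u 0).2‖ ^ 2 + (expMean κ t ρ + M₀ ^ 2 / κ) / μ) =
        1 / 2 * (p ^ 2 * ‖(u 0).2‖ ^ 2) + (p ^ 2 / μ * expMean κ t ρ +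
          M₀ ^ 2 * p ^ 2 / μ / κ) := by
      field_simp
    rw [e]
    linarith
  · have h1 := gronwall_expMean (y := fun s => 1 / 2 * ‖(u s).2‖ ^ 2 + M s)
      (g := fun s => μ / 4 * ‖(a (u s)).1‖ ^ 2)
      (r := fun s => 1 / μ * ρ s + M₀ ^ 2 / μ) hκ.le ht
      ((hYc.const_mul _).add hMc) (hGc.const_mul _)
      ((hρ.const_mul _).add continuousOn_const) (by have := hM 0; positivity)
      fun x hx => (hd x hx).2.1
    rw [expMean_const_mul, expMean_add ht (hρ.const_mul _) continuousOn_const,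
      expMean_const_mul, hM0] at h1
    have h3 := hM t
    have e : 1 / 2 * ‖(u 0).2‖ ^ 2 + (expMean κ t ρ + M₀ ^ 2 / κ) / μ =
        1 / 2 * ‖(u 0).2‖ ^ 2 + (1 / μ * expMean κ t ρ + M₀ ^ 2 / μ / κ) := by
      field_simp
    rw [e]
    linarith

end

/-- The discrete Stokes operators of a finite element family satisfy the Poincaré inequalities
with constants that do not depend on the mesh. -/
theorem exists_isDiscreteStokes {C : ℝ} (hC : 0 < C) (hΩ : IsOpen Ω)
    (hb : Bornology.IsBounded Ω) :
    ∃ p q : ℝ, 0 < p ∧ 0 < q ∧ ∀ V L, IsFEFamily Ω C V L → ∀ h, 0 < h → h < 1 →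
      ∃ A, IsDiscreteStokes (discJ (V h) (L h)) (discStokes (V h) (L h)) A p q := by
  obtain ⟨p, hp, hP⟩ := exists_poincare hΩ hb
  obtain ⟨q, hq, hQ⟩ := norm_grad_le_discStokes hΩ hb C
  refine ⟨p, q, hp, hq, fun V L hF h h0 h1 => ?_⟩
  obtain ⟨A, hA⟩ := hF.exists_discStokesL hΩ hC h0 h1
  have hfin := hF.finiteDimensional_discJ h0 h1
  exact ⟨A, Submodule.closed_of_finiteDimensional _, hA,
    fun v => (hF.discStokes_spec hΩ h0 h1 v).1, fun v => (hF.discStokes_spec hΩ h0 h1 v).2,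
    fun v hv => hP v (hF.discJ_le_H01 h0 h1 hv), hQ V L hF h h0 h1⟩

/-- Passage from the energy bound at the rate `κ` to the weight `2α ≥ κ` and to the first power of
the norm. -/
theorem add_exp_mul_integral_le {μ κ α t W x : ℝ} {g : ℝ → ℝ} (hμ : 0 < μ) (hκα : κ ≤ 2 * α)
    (ht : 0 ≤ t) (hg : ContinuousOn g (Icc 0 t)) (hg0 : ∀ s, 0 ≤ g s)
    (hle : 1 / 2 * x ^ 2 + μ / 4 * expMean κ t g ≤ W) :
    x + Real.exp (-2 * α * t) * ∫ s in (0 : ℝ)..t, Real.exp (2 * α * s) * g s ≤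
      1 + 2 * W + 4 / μ * W := by
  have h1 : Real.exp (-2 * α * t) * ∫ s in (0 : ℝ)..t, Real.exp (2 * α * s) * g s ≤
      expMean κ t g := by
    rw [show -2 * α * t = -(2 * α) * t by ring, exp_mul_integral_eq_expMean]
    exact expMean_anti ht hκα hg fun s _ => hg0 s
  have h2 : 0 ≤ expMean κ t g := expMean_nonneg ht fun s _ => hg0 s
  have h4 : 0 ≤ μ / 4 * expMean κ t g := by positivity
  have h5 : 0 ≤ 1 / 2 * x ^ 2 := by positivity
  have h3 : expMean κ t g ≤ 4 / μ * W := by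
    rw [div_mul_eq_mul_div, le_div_iff₀ hμ]
    linarith
  have h6 : x ≤ 1 / 2 * x ^ 2 + 1 / 2 := by linarith [sq_nonneg (x - 1)]
  linarith

end Oldroyd

theorem lemma4p3 (Ω : Set Plane) (hopen : IsOpen Ω) (hconn : IsConnected Ω)
    (hbdd : Bornology.IsBounded Ω) (hlip : IsLipschitzDomain Ω)
    (C M₀ μ γ δ α l₁ : ℝ) (hC : 0 < C) (hM : 0 < M₀) (hμ : 0 < μ) (hγ : 0 < γ) (hδ : 0 < δ)
    (hstokes : StokesRegular Ω C) (hl₁ : IsLeast (stokesEigenvalues Ω) l₁)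
    (hα : 0 < α) (hα' : α < min (μ * l₁ / 2) δ) :
    ∃ K : ℝ, 0 < K ∧
      ∀ (V : ℝ → Submodule ℝ (VField Ω)) (L : ℝ → Submodule ℝ (L2 Ω ℝ)), IsFEFamily Ω C V L →
      ∀ T : EReal, 0 < T →
      ∀ u₀ ∈ J1 Ω, ‖u₀.2‖ ≤ M₀ →
      ∀ f : ℝ → L2 Ω Plane, ContinuousOn f {t : ℝ | 0 < t ∧ (t : EReal) < T} →
        (∀ t : ℝ, 0 < t → (t : EReal) < T → ‖f t‖ ≤ M₀) →
      ∀ h H : ℝ, 0 < h → h < H → H < 1 →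
      ∀ uH uh : ℝ → VField Ω,
        Solves μ γ δ T f (discJ (V H) (L H)) uH uH →
        uH 0 = l2Proj (discJ (V H) (L H)) u₀.1 →
        Solves μ γ δ T f (discJ (V h) (L h)) uH uh →
        (uh 0 = l2Proj (discJ (V h) (L h)) u₀.1 ∨ ‖(uh 0).2‖ ≤ M₀) →
      ∀ t : ℝ, 0 < t → (t : EReal) < T →
        ‖(uh t).1‖ + Real.exp (-2 * α * t) *
            ∫ s in (0 : ℝ)..t, Real.exp (2 * α * s) * ‖(uh s).2‖ ^ 2 ≤ K ∧
        ‖(uh t).2‖ + Real.exp (-2 * α * t) *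
            ∫ s in (0 : ℝ)..t, Real.exp (2 * α * s) *
              ‖(discStokes (V h) (L h) (uh s)).1‖ ^ 2 ≤ K := by
  obtain ⟨p, q, hp, hq, hDS⟩ := exists_isDiscreteStokes hC hopen hbdd
  obtain ⟨β, hβ, hconv⟩ := exists_abs_bForm_le hC hopen hbdd hlip hstokes
  obtain ⟨S, hS, hstab⟩ := exists_norm_grad_l2Proj_le hC hopen hstokes
  -- a decay rate that the viscous dissipation, the memory kernel and the weight all allow
  obtain ⟨κ, hκ, hκp, hκq, hκδ, hκα⟩ : ∃ κ : ℝ, 0 < κ ∧ κ * p ^ 2 ≤ μ / 2 ∧ κ * q ^ 2 ≤ μ / 2 ∧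
      κ ≤ δ ∧ κ ≤ 2 * α := by
    refine ⟨min (min (μ / 2 / p ^ 2) (μ / 2 / q ^ 2)) (min δ (2 * α)), by positivity, ?_, ?_,
      (min_le_right _ _).trans (min_le_left _ _), (min_le_right _ _).trans (min_le_right _ _)⟩
    · rw [← le_div_iff₀ (by positivity)]
      exact (min_le_left _ _).trans (min_le_left _ _)
    · rw [← le_div_iff₀ (by positivity)]
      exact (min_le_left _ _).trans (min_le_right _ _)
  set Y₀ := ((S + 1) * M₀) ^ 2 with hY₀
  obtain ⟨N, B, hN, hB, hcoarse⟩ := exists_bound_self_convected (Ω := Ω) (M₀ := M₀) (Y₀ := Y₀)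
    hμ hγ hδ hκ hβ.le (by positivity) hκp hκq hκδ
  set ρ₀ := β * N * B with hρ₀
  set Z := 1 / 2 * Y₀ + (ρ₀ * (1 / κ + B) + M₀ ^ 2 / κ) / μ with hZ
  have hZ0 : 0 ≤ Z := by positivity
  set W := (p ^ 2 + 1) * Z with hW
  have hW0 : 0 ≤ W := by positivity
  refine ⟨1 + 2 * W + 4 / μ * W, by positivity, fun V L hF T _ u₀ hu₀ hu₀M f _ hf h H h0 hhH hH1
    uH uh hsH hH0 hsh hh0 t ht htT => ?_⟩
  have hH : 0 < H := h0.trans hhH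
  have hh1 : h < 1 := hhH.trans hH1
  obtain ⟨AH, hSH⟩ := hDS V L hF H hH hH1
  obtain ⟨Ah, hSh⟩ := hDS V L hF h h0 hh1
  have hinit : ∀ v : VField Ω, ‖v.2‖ ≤ (S + 1) * M₀ → ‖v.2‖ ^ 2 ≤ Y₀ := fun v hv =>
    pow_le_pow_left₀ (norm_nonneg _) hv 2
  have hproj : ∀ h, 0 < h → h < 1 →
      ‖(l2Proj (discJ (V h) (L h)) u₀.1).2‖ ≤ (S + 1) * M₀ := fun h h0 h1 => by
    have h2 := hstab V L hF h h0 h1 u₀ hu₀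
    have h3 := mul_le_mul_of_nonneg_left hu₀M hS.le
    linarith
  have hYH : ‖(uH 0).2‖ ^ 2 ≤ Y₀ := hinit _ (by rw [hH0]; exact hproj H hH hH1)
  have hYh : ‖(uh 0).2‖ ^ 2 ≤ Y₀ := by
    refine hinit _ ?_
    rcases hh0 with hh0 | hh0
    · rw [hh0]; exact hproj h h0 hh1
    · have : 0 ≤ S * M₀ := by positivity
      linarith
  have hHb := hcoarse _ _ AH hSH
    (fun v hv φ hφ => hconv V L hF H hH hH1 v hv φ (hF.discJ_le_H01 hH hH1 hφ)) T f uH hsH hf hYH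
    t ht.le htT
  have hlt : ∀ s, s ≤ t → (s : EReal) < T := fun s hs =>
    lt_of_le_of_lt (EReal.coe_le_coe_iff.2 hs) htT
  have hcont : ∀ {J : Submodule ℝ (VField Ω)} {c u : ℝ → VField Ω}, Solves μ γ δ T f J c u →
      ContinuousOn u (Icc 0 t) := fun hs => hs.cont.mono fun s hs' => ⟨hs'.1, hlt s hs'.2⟩
  set G : ℝ → ℝ := fun s => ‖(discStokes (V H) (L H) (uH s)).1‖ ^ 2 with hG
  have hGc : ContinuousOn G (Icc 0 t) := by
    simp only [hG]
    simp_rw [← hSH.apply_eq]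
    exact (AH.continuous.comp_continuousOn (hcont hsH)).norm.pow 2
  have hρ₀0 : 0 ≤ ρ₀ := by positivity
  have hmain := hsh.bound_of_convection hμ hγ hδ hκ hκp hκq hκδ hSh hf ht.le htT
    (ρ := fun s => ρ₀ * (1 + G s)) ((continuousOn_const.add hGc).const_mul _)
    (fun s => by positivity) (fun s hs φ hφ => by
      have hs' := Ioo_subset_Icc_self hs
      obtain ⟨h1, h2, -⟩ := hHb s hs'
      refine (hconv V L hF H hH hH1 (uH s) (hsH.mem s hs'.1 (hlt s hs'.2)) φ
        (hF.discJ_le_H01 h0 hh1 hφ)).trans (mul_le_mul_of_nonneg_right ?_ (sq_nonneg _))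
      set a := ‖(discStokes (V H) (L H) (uH s)).1‖ with ha
      have h3 : a ≤ 1 + a ^ 2 := by nlinarith [sq_nonneg (a - 1)]
      have ha0 : 0 ≤ a := norm_nonneg _
      calc β * (‖(uH s).1‖ * a) * ‖(uH s).2‖ ^ 2 ≤ β * (N * (1 + a ^ 2)) * B := by gcongr
        _ = ρ₀ * (1 + G s) := by simp only [hG]; rw [hρ₀]; ring)
  have hρm : expMean κ t (fun s => ρ₀ * (1 + G s)) ≤ ρ₀ * (1 / κ + B) := by
    rw [expMean_const_mul, expMean_add ht.le continuousOn_const hGc]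
    exact mul_le_mul_of_nonneg_left
      (add_le_add (expMean_const_le hκ ht.le zero_le_one) (hHb t (right_mem_Icc.2 ht.le)).2.2) hρ₀0
  have hZb : 1 / 2 * ‖(uh 0).2‖ ^ 2 +
      (expMean κ t (fun s => ρ₀ * (1 + G s)) + M₀ ^ 2 / κ) / μ ≤ Z := by
    rw [hZ]; gcongr
  have hc := hcont hsh
  have hYc : ContinuousOn (fun s => ‖(uh s).2‖ ^ 2) (Icc 0 t) := hc.snd.norm.pow 2
  have hAc : ContinuousOn (fun s => ‖(discStokes (V h) (L h) (uh s)).1‖ ^ 2) (Icc 0 t) := by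
    simp_rw [← hSh.apply_eq]
    exact (Ah.continuous.comp_continuousOn hc).norm.pow 2
  refine ⟨add_exp_mul_integral_le hμ hκα ht.le hYc (fun s => sq_nonneg _) (hmain.1.trans ?_),
    add_exp_mul_integral_le hμ hκα ht.le hAc (fun s => sq_nonneg _) (hmain.2.trans (hZb.trans ?_))⟩
  · refine (mul_le_mul_of_nonneg_left hZb (sq_nonneg p)).trans ?_
    rw [hW]; linarith
  · rw [hW]
    have := mul_nonneg (sq_nonneg p) hZ0
    linarith
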